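/- Let $\mathbb T^2=\mathbb R^2/\mathbb Z^2$, let $F_A(x,y)=(13x+8y,\,8x+5y)$ on $\mathbb T^2$, let $\sigma=\ln(9+4\sqrt5)$, and consider the four fixed points $\Omega_0=(0,0)$, $\Omega_1=(\tfrac12,\tfrac12)$, $\Omega_2=(\tfrac12,0)$, $\Omega_3=(0,\tfrac12)$ of $F_A$. Fix linear coordinates $(x,y)$ centred at each $\Omega_i$, obtained from the standard ones by one matrix of determinant $1$ in which $F_A$ becomes $(x,y)\mapsto(e^{\sigma}x,e^{-\sigma}y)$, and the polar coordinates $(x,y)=(\sqrt{2\rho}\cos\theta,\sqrt{2\rho}\sin\theta)$. Let $0<\delta<\varepsilon$, and let $V_i\subset V_i'$ be the closed discs of radii $\delta$ and $\varepsilon$ about $\Omega_i$ in these coordinates, where the $V_i'$ are pairwise disjoint. Let $\psi:[\delta^2/2,\varepsilon^2/2]\to[0,\varepsilon^2/2]$ be a $C^\infty$-diffeomorphism with $\psi(\rho)=\rho-\delta^2/2$ near $\delta^2/2$ and $\psi(\rho)=\rho$ near $\varepsilon^2/2$, and let $\xi$ be a $C^\infty$ function on $\mathbb R$ with $\xi=0$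 near $0$ and $\xi(\rho)=1$ for $\rho\ge\delta^2/2$. Put $\hat I=\mathbb T^2\setminus\bigsqcup_i V_i$ and let $\Psi:\hat I\to\mathbb T^2\setminus\{\Omega_0,\dots,\Omega_3\}$ be the diffeomorphism equal to $(\rho,\theta)\mapsto(\psi(\rho),\theta)$ in $V_i'\setminus V_i$ and to the identity outside $\bigsqcup_i V_i'$. Let $\hat F:\mathbb T^2\to\mathbb T^2$ be equal to $\Psi^{-1}\circ F_A\circ\Psi$ on $\hat I$ and, on each $V_i$, to the time-$\sigma$ map of the flow $\dot x=\partial_y\hat H$, $\dot y=-\partial_x\hat H$ of the Hamiltonian $\hat H=(\rho-\delta^2/2)\sin(2\theta)\,\xi(\rho)$. Then every point of $\hat I$ has positive maximal Lyapunov exponent $\limsup_{n\to\infty}\frac1n\log\|D\hat F^n(\cdot)\|$ for $\hat F$, and $\hat F$ leaves $\hat I$ invariant and is topologically transitive on $\hat I$. Moreover, there is a $C^2$-neighbourhood of $\hat F$ such that for every (not necessarily conservative) $C^2$-diffeomorphism $\tilde F$ of $\mathbb T^2$ in this neighbourhood which keeps each circle $\partial V_i$ invariant ($i=0,1,2,3$),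 the set $\hat I$ is invariant under $\tilde F$, every point of $\hat I$ has positive maximal Lyapunov exponent for $\tilde F$, the restrictions $\tilde F|_{\hat I}$ and $\hat F|_{\hat I}$ are topologically conjugate, and $\tilde F|_{\hat I}$ is topologically transitive. -/

import Mathlib

open Set Filter Topology
open scoped ContDiff

noncomputable section

namespace BlowUp

/-- The Euclidean plane. -/
abbrev Plane := EuclideanSpace ℝ (Fin 2)

/-- The torus `ℝ² / ℤ²`. -/
abbrev Torus := UnitAddTorus (Fin 2)

/-- The projection `ℝ² → ℝ² / ℤ²`. -/
def proj (z : Plane) : Torus := fun i => (z i : UnitAddCircle)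

/-! ### Differential calculus on the flat torus -/

/-- `f : 𝕋² → 𝕋²` is of class `C^r`: it has a `C^r` lift to the universal cover. -/
def TorusContDiff (r : ℕ∞) (f : Torus → Torus) : Prop :=
  ∃ g : Plane → Plane, ContDiff ℝ r g ∧ ∀ z, proj (g z) = f (proj z)

/-- `L` is the derivative of `f : 𝕋² → 𝕋²` at `p`, the tangent spaces of `𝕋²` being identified
with `ℝ²`: some local lift of `f` near a point over `p` has derivative `L` there. -/
def HasTorusFDerivAt (f : Torus → Torus) (L : Plane →L[ℝ] Plane) (p : Torus) : Prop :=
  ∃ (z : Plane) (g : Plane → Plane), proj z = p ∧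
    (∀ᶠ w in 𝓝 z, proj (g w) = f (proj w)) ∧ HasFDerivAt g L z

open Classical in
/-- The derivative `Df(p)` of `f : 𝕋² → 𝕋²` (zero if `f` is not differentiable at `p`). -/
def torusFDeriv (f : Torus → Torus) (p : Torus) : Plane →L[ℝ] Plane :=
  if h : ∃ L, HasTorusFDerivAt f L p then h.choose else 0

/-- The maximal Lyapunov exponent `limsup (1/n) log ‖Df^n(p)‖`. -/
def lyapunov (f : Torus → Torus) (p : Torus) : EReal :=
  limsup (fun n : ℕ => ((1 / (n : ℝ) * Real.log ‖torusFDeriv f^[n] p‖ : ℝ) : EReal)) atTop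

/-- `f` and `g` are `η`-close in the uniform `C²` topology: the difference `f - g` lifts to a
`C²` map `u : ℝ² → ℝ²` which is less than `η` together with its first two derivatives. -/
def C2Close (η : ℝ) (f g : Torus → Torus) : Prop :=
  ∃ u : Plane → Plane, ContDiff ℝ 2 u ∧ (∀ z, f (proj z) = g (proj z) + proj (u z)) ∧
    ∀ k : ℕ, k ≤ 2 → ∀ z, ‖iteratedFDeriv ℝ k u z‖ < η

/-! ### Topological dynamics on an invariant set -/

/-- `K` is invariant under `f` and the restriction of `f` to `K` is topologically transitive. -/
def TransitiveOn (f : Torus → Torus) (K : Set Torus) : Prop :=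
  f '' K = K ∧ ∀ U V : Set Torus, IsOpen U → IsOpen V → (U ∩ K).Nonempty → (V ∩ K).Nonempty →
    ∃ n : ℕ, (f^[n] '' (U ∩ K) ∩ (V ∩ K)).Nonempty

/-- `K` is invariant under `f` and `g`, and a homeomorphism of `K` conjugates `f` to `g`. -/
def ConjugateOn (f g : Torus → Torus) (K : Set Torus) : Prop :=
  ∃ (hf : BijOn f K K) (hg : BijOn g K K) (h : K ≃ₜ K),
    Function.Semiconj h (hf.mapsTo.restrict f K K) (hg.mapsTo.restrict g K K)

/-! ### Hamiltonian flows in the plane -/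

/-- The Hamiltonian vector field `ẋ = ∂H/∂y`, `ẏ = -∂H/∂x`. -/
def hamField (H : Plane → ℝ) (w : Plane) : Plane :=
  !₂[fderiv ℝ H w (EuclideanSpace.single 1 1), -fderiv ℝ H w (EuclideanSpace.single 0 1)]

open Classical in
/-- The time-`t` map of the flow of the vector field `X` (with value `w` at points `w` that are
not on a complete integral curve). -/
def timeMap (X : Plane → Plane) (t : ℝ) (w : Plane) : Plane :=
  if h : ∃ γ : ℝ → Plane, γ 0 = w ∧ IsIntegralCurve γ (fun _ => X) then h.choose t else w

/-! ### The Anosov map and its blow-up -/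

/-- The linear map `A (x, y) = (13 x + 8 y, 8 x + 5 y)` of the plane. -/
def planeA (z : Plane) : Plane := !₂[13 * z 0 + 8 * z 1, 8 * z 0 + 5 * z 1]

/-- The Anosov map `F_A (x, y) = (13 x + 8 y, 8 x + 5 y)` of the torus. -/
def torusA (p : Torus) : Torus :=
  ![(13 : ℕ) • p 0 + (8 : ℕ) • p 1, (8 : ℕ) • p 0 + (5 : ℕ) • p 1]

/-- The logarithm of the unstable eigenvalue of `A`. -/
def sigma : ℝ := Real.log (9 + 4 * √5)

/-- Representatives in the plane of the fixed points `Ω₀, …, Ω₃` of the Anosov map. -/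
def center : Fin 4 → Plane := ![!₂[0, 0], !₂[1 / 2, 1 / 2], !₂[1 / 2, 0], !₂[0, 1 / 2]]

/-- Given linear coordinates `w = P (z - Ωᵢ)` near `Ωᵢ`, the point with coordinates `w`. -/
def chartAt (P : Plane ≃L[ℝ] Plane) (i : Fin 4) (w : Plane) : Torus :=
  proj (center i + P.symm w)

/-- The choices made in the blow-up construction. -/
structure Data where
  /-- linear symplectic coordinates that diagonalize `A` -/
  P : Plane ≃L[ℝ] Plane
  /-- radius of the discs `Vᵢ` -/
  δ : ℝ
  /-- radius of the discs `Vᵢ'` -/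
  ε : ℝ
  /-- the radial diffeomorphism `[δ²/2, ε²/2] → [0, ε²/2]` -/
  ψ : ℝ → ℝ
  /-- the inverse of `ψ` -/
  ψinv : ℝ → ℝ
  /-- the cut-off function of the Hamiltonian -/
  ξ : ℝ → ℝ
  det_P : LinearMap.det (P : Plane →ₗ[ℝ] Plane) = 1
  P_planeA : ∀ z, P (planeA z) = !₂[Real.exp sigma * P z 0, Real.exp (-sigma) * P z 1]
  δ_pos : 0 < δ
  δ_lt : δ < ε
  disjoint_discs : ∀ i j, i ≠ j →
    Disjoint (chartAt P i '' Metric.closedBall 0 ε) (chartAt P j '' Metric.closedBall 0 ε)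
  ψ_smooth : ContDiffOn ℝ ∞ ψ (Icc (δ ^ 2 / 2) (ε ^ 2 / 2))
  ψ_bij : BijOn ψ (Icc (δ ^ 2 / 2) (ε ^ 2 / 2)) (Icc 0 (ε ^ 2 / 2))
  ψinv_smooth : ContDiffOn ℝ ∞ ψinv (Icc 0 (ε ^ 2 / 2))
  ψinv_inv : InvOn ψinv ψ (Icc (δ ^ 2 / 2) (ε ^ 2 / 2)) (Icc 0 (ε ^ 2 / 2))
  ψ_inner : ∀ᶠ ρ in 𝓝[≥] (δ ^ 2 / 2), ψ ρ = ρ - δ ^ 2 / 2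
  ψ_outer : ∀ᶠ ρ in 𝓝[≤] (ε ^ 2 / 2), ψ ρ = ρ
  ξ_smooth : ContDiff ℝ ∞ ξ
  ξ_zero : ∀ᶠ ρ in 𝓝 0, ξ ρ = 0
  ξ_one : ∀ ρ, δ ^ 2 / 2 ≤ ρ → ξ ρ = 1

namespace Data

variable (D : Data)

/-- The closed disc `Vᵢ` of radius `δ` about `Ωᵢ`. -/
def V (i : Fin 4) : Set Torus := chartAt D.P i '' Metric.closedBall 0 D.δ

/-- The circle `∂Vᵢ`. -/
def circle (i : Fin 4) : Set Torus := chartAt D.P i '' Metric.sphere 0 D.δ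

/-- The island `𝕋² \ ⋃ᵢ Vᵢ`. -/
def island : Set Torus := (⋃ i, D.V i)ᶜ

/-- The map `(ρ, θ) ↦ (χ ρ, θ)` in the symplectic polar coordinates
`w = (√(2ρ) cos θ, √(2ρ) sin θ)`, where `ρ = ‖w‖² / 2`. -/
def radial (χ : ℝ → ℝ) (w : Plane) : Plane := (√(2 * χ (‖w‖ ^ 2 / 2)) / ‖w‖) • w

open Classical in
/-- The map of the torus that is `radial χ` in the discs `Vᵢ'` and the identity elsewhere. -/
def surgery (χ : ℝ → ℝ) (p : Torus) : Torus :=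
  if h : ∃ q : Fin 4 × Plane, ‖q.2‖ ≤ D.ε ∧ chartAt D.P q.1 q.2 = p then
    chartAt D.P h.choose.1 (radial χ h.choose.2)
  else p

/-- The diffeomorphism `Ψ` from the island onto `𝕋² \ {Ω₀, Ω₁, Ω₂, Ω₃}`. -/
def Psi : Torus → Torus := D.surgery D.ψ

/-- The inverse of `Ψ`. -/
def PsiInv : Torus → Torus := D.surgery D.ψinv

/-- The Hamiltonian `(ρ - δ²/2) sin(2θ) ξ(ρ)`; note that `ρ sin(2θ) = x y` and `2 ρ = ‖(x, y)‖²`. -/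
def ham (w : Plane) : ℝ := (1 - D.δ ^ 2 / ‖w‖ ^ 2) * (w 0 * w 1) * D.ξ (‖w‖ ^ 2 / 2)

open Classical in
/-- The blown-up map: the time-`σ` map of the Hamiltonian flow in the discs `Vᵢ`, and
`Ψ⁻¹ ∘ F_A ∘ Ψ` on the island. -/
def hatF (p : Torus) : Torus :=
  if h : ∃ q : Fin 4 × Plane, ‖q.2‖ ≤ D.δ ∧ chartAt D.P q.1 q.2 = p then
    chartAt D.P h.choose.1 (timeMap (hamField D.ham) sigma h.choose.2)
  else D.PsiInv (torusA (D.Psi p))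

end Data

end BlowUp

end

noncomputable section

namespace BlowUp

/-! ### The diagonal hyperbolic map -/

/-! Work on the universal cover in the linear coordinates. There `F_A` lifts to `hyp`, the deck
group is the lattice `D.L`, and the lifts of the four fixed points form the lattice `D.Lam` of
halves of `D.L`. The lifts `D.down` and `D.up` of `Ψ` and `Ψ⁻¹` identify the island with the
complement of `D.Lam` modulo `D.L`, so every claim becomes one about a plane map `G` that is `hyp`
on `D.Lam`: `G = hyp` for `hatF`, and `G = D.blown u` for a perturbation `hatF + u`.

The heart is that `G - hyp` has a small Lipschitz constant even across `D.Lam`, where `Ψ⁻¹` is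
singular (`blowDown_estimate`, `exists_nearHyp`). Near a lattice point use the squared radius `ρ`
and the direction `e`; blowing up is then the shift of `ρ` by `δ²`. Since `u` preserves the circle,
the change it makes to the squared radius vanishes at `ρ = 0`, hence is `ρ` times a quotient. The
quotient costs one derivative, but it is still small and Lipschitz because `u` is `C²`-small. After
taking roots, `G - hyp` takes the form `|x| m(|x|², x/|x|)` with `m` small and Lipschitz, and such a
map has a small Lipschitz constant.

Small Lipschitz perturbations of a hyperbolic linear map are conjugate to it by a unique
homeomorphism at bounded distance from the identity (`NearHyp.exists_conj`). Uniqueness forces this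
homeomorphism to fix `D.Lam` and to commute with `D.L`, so it descends to the island. Transitivity
is inherited from `hyp` modulo `D.L`, which is transitive because both coordinate projections of the
lattice are dense (`exists_transit`).

For the exponents, `G` expands an unstable cone by 16 at each step. Returning to the island through
`D.up` may destroy this near `D.Lam`, where radial vectors are crushed. But a `limsup` needs only
infinitely many good times (`frequently_good`). Either the orbit is infinitely often far from
`D.Lam`, or it eventually stays near `D.Lam`. In the second case it follows one lattice orbit inside
the stable cone, so unstable vectors are transversal to the radius and survive the blow-up. -/

/-- The unstable eigenvalue `9 + 4 √5`. -/
def lam : ℝ := Real.exp sigma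

theorem lam_eq : lam = 9 + 4 * √5 := by
  unfold lam sigma
  rw [Real.exp_log (by positivity)]

theorem lam_ge : 17 ≤ lam := by
  have : (2 : ℝ) ≤ √5 := by
    rw [Real.le_sqrt'] <;> norm_num
  rw [lam_eq]
  linarith

theorem lam_le : lam ≤ 18 := by
  have : √5 ≤ (9 / 4 : ℝ) := by
    rw [Real.sqrt_le_left (by norm_num)]
    norm_num
  rw [lam_eq]
  linarith

theorem lam_pos : 0 < lam := by linarith [lam_ge]

theorem exp_neg_sigma : Real.exp (-sigma) = lam⁻¹ := by
  rw [Real.exp_neg, lam]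

theorem lam_inv_pos : 0 < lam⁻¹ := inv_pos.2 lam_pos

theorem lam_inv_le : lam⁻¹ ≤ 1 / 17 := by
  rw [one_div]
  exact inv_anti₀ (by norm_num) lam_ge

theorem lam_mul_inv : lam * lam⁻¹ = 1 := mul_inv_cancel₀ lam_pos.ne'

/-- The linear map `(x, y) ↦ (e^σ x, e^{-σ} y)`. -/
def hyp : Plane ≃L[ℝ] Plane :=
  LinearEquiv.toContinuousLinearEquiv
    { toFun := fun w => !₂[lam * w 0, lam⁻¹ * w 1]
      invFun := fun w => !₂[lam⁻¹ * w 0, lam * w 1]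
      map_add' := fun x y => by
        ext i; fin_cases i <;> simp [mul_add]
      map_smul' := fun c x => by
        ext i; fin_cases i <;> simp <;> ring
      left_inv := fun w => by
        ext i
        fin_cases i
        · simp [lam_pos.ne']
        · simp [← mul_assoc, lam_mul_inv]
      right_inv := fun w => by
        ext i
        fin_cases i
        · simp [← mul_assoc, lam_mul_inv]
        · simp [lam_pos.ne'] }

@[simp] theorem hyp_zero (w : Plane) : hyp w 0 = lam * w 0 := rfl

@[simp] theorem hyp_one (w : Plane) : hyp w 1 = lam⁻¹ * w 1 := rfl

theorem plane_norm_sq (w : Plane) : ‖w‖ ^ 2 = w 0 ^ 2 + w 1 ^ 2 := by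
  rw [EuclideanSpace.norm_sq_eq]
  simp

theorem plane_ext {v w : Plane} (h0 : v 0 = w 0) (h1 : v 1 = w 1) : v = w := by
  ext i
  fin_cases i
  · exact h0
  · exact h1

theorem abs_coord_le (w : Plane) (i : Fin 2) : |w i| ≤ ‖w‖ := by
  simpa using PiLp.norm_apply_le w i

theorem plane_norm_le (w : Plane) : ‖w‖ ≤ |w 0| + |w 1| := by
  apply le_of_sq_le_sq _ (by positivity)
  rw [plane_norm_sq, add_sq, sq_abs, sq_abs]
  nlinarith [mul_nonneg (abs_nonneg (w 0)) (abs_nonneg (w 1))]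

theorem norm_hyp_le (w : Plane) : ‖hyp w‖ ≤ lam * ‖w‖ := by
  apply le_of_sq_le_sq _ (mul_nonneg lam_pos.le (norm_nonneg _))
  rw [mul_pow, plane_norm_sq, plane_norm_sq, hyp_zero, hyp_one, mul_pow, mul_pow, mul_add]
  gcongr
  · exact lam_inv_pos.le
  · linarith [lam_ge, lam_inv_le]

theorem le_norm_hyp (w : Plane) : lam⁻¹ * ‖w‖ ≤ ‖hyp w‖ := by
  apply le_of_sq_le_sq _ (norm_nonneg _)
  rw [mul_pow, plane_norm_sq, plane_norm_sq, hyp_zero, hyp_one, mul_pow, mul_pow, mul_add]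
  gcongr
  · exact lam_inv_pos.le
  · linarith [lam_ge, lam_inv_le]

theorem norm_hyp_symm_le (w : Plane) : ‖hyp.symm w‖ ≤ lam * ‖w‖ := by
  have h := le_norm_hyp (hyp.symm w)
  rw [ContinuousLinearEquiv.apply_symm_apply, inv_mul_le_iff₀ lam_pos] at h
  exact h

/-! ### Lipschitz perturbations of the hyperbolic map -/

/-- `G` differs from the hyperbolic map by a map with Lipschitz constant `1 / 50`. -/
def NearHyp (G : Plane → Plane) : Prop :=
  ∀ x y, ‖(G x - hyp x) - (G y - hyp y)‖ ≤ 1 / 50 * ‖x - y‖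

theorem nearHyp_hyp : NearHyp hyp := fun x y => by
  simp only [sub_self, norm_zero]
  positivity

namespace NearHyp

variable {G : Plane → Plane}

theorem abs_coord (hG : NearHyp G) (x y : Plane) (i : Fin 2) :
    |(G x - G y) i - hyp (x - y) i| ≤ 1 / 50 * (|(x - y) 0| + |(x - y) 1|) := by
  have h1 := (abs_coord_le _ i).trans (hG x y)
  have h2 := plane_norm_le (x - y)
  have h3 : ((G x - hyp x) - (G y - hyp y)) i = (G x - G y) i - hyp (x - y) i := by
    rw [map_sub]
    simp only [PiLp.sub_apply]
    ring
  rw [h3] at h1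
  linarith

/-- Vectors in the unstable cone are expanded and mapped into a smaller cone. -/
theorem unstable (hG : NearHyp G) (x y : Plane) (h : |(x - y) 1| ≤ |(x - y) 0|) :
    16 * |(x - y) 0| ≤ |(G x - G y) 0| ∧ 2 * |(G x - G y) 1| ≤ |(G x - G y) 0| := by
  have h0 := hG.abs_coord x y 0
  have h1 := hG.abs_coord x y 1
  rw [hyp_zero] at h0
  rw [hyp_one] at h1
  have a0 : |lam * (x - y) 0| = lam * |(x - y) 0| := by rw [abs_mul, abs_of_pos lam_pos]
  have a1 : |lam⁻¹ * (x - y) 1| = lam⁻¹ * |(x - y) 1| := by rw [abs_mul, abs_of_pos lam_inv_pos]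
  have b0 := abs_sub_abs_le_abs_sub (lam * (x - y) 0) ((G x - G y) 0)
  rw [abs_sub_comm] at b0
  have b1 := abs_sub_abs_le_abs_sub ((G x - G y) 1) (lam⁻¹ * (x - y) 1)
  have c0 : 17 * |(x - y) 0| ≤ lam * |(x - y) 0| := by gcongr; exact lam_ge
  have c1 : lam⁻¹ * |(x - y) 1| ≤ 1 / 17 * |(x - y) 1| := by gcongr; exact lam_inv_le
  have p := abs_nonneg ((x - y) 0)
  -- `17 - 2/50 ≥ 16` gives the expansion, and `2 (1/17 + 2/50)` is far below `16`, which gives the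
  -- narrower cone.
  constructor <;> linarith

/-- The unstable cone is forward invariant, so its complement is backward invariant. There the
second coordinate contracts by `1/17 + 2/50 < 1/2`. -/
theorem stable (hG : NearHyp G) (x y : Plane) (h : |(G x - G y) 0| < |(G x - G y) 1|) :
    |(x - y) 0| < |(x - y) 1| ∧ 2 * |(G x - G y) 1| ≤ |(x - y) 1| := by
  have h' : |(x - y) 0| < |(x - y) 1| := by
    by_contra hc
    have := (hG.unstable x y (not_lt.1 hc)).2
    have := abs_nonneg ((G x - G y) 1)
    linarith
  refine ⟨h', ?_⟩
  have h1 := hG.abs_coord x y 1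
  rw [hyp_one] at h1
  have a1 : |lam⁻¹ * (x - y) 1| = lam⁻¹ * |(x - y) 1| := by rw [abs_mul, abs_of_pos lam_inv_pos]
  have b1 := abs_sub_abs_le_abs_sub ((G x - G y) 1) (lam⁻¹ * (x - y) 1)
  have c1 : lam⁻¹ * |(x - y) 1| ≤ 1 / 17 * |(x - y) 1| := by gcongr; exact lam_inv_le
  have p := abs_nonneg ((x - y) 0)
  linarith

/-- Two semiconjugacies to `G` at a bounded distance from each other agree. -/
theorem eqOn_of_bounded (hG : NearHyp G) {X : Type*} {S : Set X} {T : X ≃ X}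
    (hT : ∀ x ∈ S, T x ∈ S)
    (hT' : ∀ x ∈ S, T.symm x ∈ S) {h k : X → Plane} {K : ℝ}
    (hb : ∀ x ∈ S, ‖h x - k x‖ ≤ K) (hh : ∀ x ∈ S, h (T x) = G (h x))
    (hk : ∀ x ∈ S, k (T x) = G (k x)) : EqOn h k S := by
  -- Expansivity: if the first coordinate of `h - k` dominates, it is at least 16 times larger one
  -- step later; if the second dominates, it is at least twice as large one step earlier. Either way
  -- a uniform bound on `S` halves. The freedom in `X` and `S` allows lattice points, or pairs
  -- (point, deck translation), as the base.
  have step : ∀ K : ℝ, (∀ x ∈ S, max |(h x - k x) 0| |(h x - k x) 1| ≤ K) →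
      ∀ x ∈ S, max |(h x - k x) 0| |(h x - k x) 1| ≤ K / 2 := by
    intro K hK x hx
    by_cases hc : |(h x - k x) 1| ≤ |(h x - k x) 0|
    · have h1 := (hG.unstable _ _ hc).1
      have h2 := hK _ (hT x hx)
      rw [hh x hx, hk x hx] at h2
      have h3 := (le_max_left _ _).trans h2
      rw [max_eq_left hc]
      have := abs_nonneg ((h x - k x) 0)
      linarith
    · rw [not_le] at hc
      have e1 : h x = G (h (T.symm x)) := by
        rw [← hh _ (hT' x hx), Equiv.apply_symm_apply]
      have e2 : k x = G (k (T.symm x)) := by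
        rw [← hk _ (hT' x hx), Equiv.apply_symm_apply]
      rw [max_eq_right hc.le]
      rw [e1, e2] at hc ⊢
      have h1 := (hG.stable _ _ hc).2
      have h3 := (le_max_right _ _).trans (hK _ (hT' x hx))
      linarith
  have iter : ∀ n : ℕ, ∀ x ∈ S, max |(h x - k x) 0| |(h x - k x) 1| ≤ K / 2 ^ n := by
    intro n
    induction n with
    | zero =>
      intro x hx
      rw [pow_zero, div_one]
      exact max_le ((abs_coord_le _ 0).trans (hb x hx)) ((abs_coord_le _ 1).trans (hb x hx))
    | succ n ih =>
      intro x hx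
      have := step _ ih x hx
      rwa [div_div, ← pow_succ] at this
  intro x hx
  have lim : Tendsto (fun n : ℕ => K / 2 ^ n) atTop (𝓝 0) := by
    have := (tendsto_pow_atTop_nhds_zero_of_lt_one (r := (1 / 2 : ℝ)) (by norm_num)
      (by norm_num)).const_mul K
    simpa [div_eq_mul_inv] using this
  have h0 := ge_of_tendsto' lim (fun n => iter n x hx)
  have hz0 : (h x - k x) 0 = 0 := abs_nonpos_iff.1 ((le_max_left _ _).trans h0)
  have hz1 : (h x - k x) 1 = 0 := abs_nonpos_iff.1 ((le_max_right _ _).trans h0)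
  exact sub_eq_zero.1 (plane_ext hz0 hz1)

theorem continuous (hG : NearHyp G) : Continuous G := by
  have h : LipschitzWith (1 / 50) (fun x => G x - hyp x) := LipschitzWith.of_dist_le_mul fun x y => by
    rw [dist_eq_norm, dist_eq_norm]
    simpa using hG x y
  refine (h.continuous.add hyp.continuous).congr fun x => ?_
  simp

/-- A Lipschitz perturbation of the hyperbolic map is a homeomorphism. -/
theorem exists_homeomorph (hG : NearHyp G) : ∃ T : Plane ≃ₜ Plane, ∀ x, T x = G x := by
  have h : ApproximatesLinearOn G (hyp : Plane →L[ℝ] Plane) univ (1 / 50) := by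
    intro x _ y _
    have := hG x y
    simp only [ContinuousLinearEquiv.coe_coe, map_sub]
    calc _ = ‖G x - hyp x - (G y - hyp y)‖ := by congr 1; abel
      _ ≤ _ := by simpa using this
  -- Invertibility of a perturbed linear isomorphism requires the Lipschitz constant to be below the
  -- reciprocal norm of the inverse, here at least `1/18`.
  have hc : (1 / 50 : NNReal) < ‖(hyp.symm : Plane →L[ℝ] Plane)‖₊⁻¹ := by
    have hn : ‖(hyp.symm : Plane →L[ℝ] Plane)‖₊ ≤ 18 := by
      rw [← NNReal.coe_le_coe, coe_nnnorm]
      refine ContinuousLinearMap.opNorm_le_bound _ (by norm_num) fun x => ?_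
      refine (norm_hyp_symm_le x).trans ?_
      gcongr
      exact lam_le
    have hp : 0 < ‖(hyp.symm : Plane →L[ℝ] Plane)‖₊ := by
      exact hyp.nnnorm_symm_pos
    calc (1 / 50 : NNReal) < 18⁻¹ := by
          rw [one_div]
          exact inv_strictAnti₀ (by norm_num) (by norm_num)
      _ ≤ _ := inv_anti₀ hp hn
  exact ⟨h.toHomeomorph G (Or.inr hc), fun x => rfl⟩

end NearHyp

/-! ### Conjugacies to the hyperbolic map -/

/-- Existence of semiconjugacies between Lipschitz perturbations of the hyperbolic map. -/
theorem exists_semiconj {G₂ : Plane → Plane} (h₂ : NearHyp G₂) (T : Plane ≃ₜ Plane) {K : ℝ}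
    (hb₁ : ∀ x, ‖T x - hyp x‖ ≤ K) (hb₂ : ∀ x, ‖G₂ x - hyp x‖ ≤ K) :
    ∃ h : Plane → Plane, Continuous h ∧ (∃ C, ∀ x, ‖h x - x‖ ≤ C) ∧ ∀ x, h (T x) = G₂ (h x) := by
  let φ₁ : Plane → Plane := fun x => T x - hyp x
  let φ₂ : Plane → Plane := fun x => G₂ x - hyp x
  have c₁ : Continuous φ₁ := T.continuous.sub hyp.continuous
  have c₂ : Continuous φ₂ := h₂.continuous.sub hyp.continuous
  let E := BoundedContinuousFunction Plane Plane
  -- With `h = id + w`, the equation `h ∘ T = G₂ ∘ h` is solved in the expanding coordinate for `w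
  -- x`, dividing by `lam`, and in the contracting coordinate for `w (T x)`, then shifted by
  -- `T.symm`. Both coordinates of `Γ` are thereby contracting.
  let Γ : E → Plane → Plane := fun w x =>
    !₂[lam⁻¹ * (w (T x) 0 + φ₁ x 0 - φ₂ (x + w x) 0),
      lam⁻¹ * w (T.symm x) 1 - φ₁ (T.symm x) 1 + φ₂ (T.symm x + w (T.symm x)) 1]
  have bnd : ∀ (w : E) x, ‖Γ w x‖ ≤ 2 * (‖w‖ + K + K) := by
    intro w x
    have t0 : |w (T x) 0| ≤ ‖w‖ := (abs_coord_le _ 0).trans (w.norm_coe_le_norm _)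
    have t1 : |w (T.symm x) 1| ≤ ‖w‖ := (abs_coord_le _ 1).trans (w.norm_coe_le_norm _)
    have t2 : |φ₁ x 0| ≤ K := (abs_coord_le _ 0).trans (hb₁ _)
    have t3 : |φ₁ (T.symm x) 1| ≤ K := (abs_coord_le _ 1).trans (hb₁ _)
    have t4 : |φ₂ (x + w x) 0| ≤ K := (abs_coord_le _ 0).trans (hb₂ _)
    have t5 : |φ₂ (T.symm x + w (T.symm x)) 1| ≤ K := (abs_coord_le _ 1).trans (hb₂ _)
    have e0 : |Γ w x 0| ≤ ‖w‖ + K + K := by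
      have : |w (T x) 0 + φ₁ x 0 - φ₂ (x + w x) 0| ≤ ‖w‖ + K + K :=
        (abs_sub _ _).trans (add_le_add ((abs_add_le _ _).trans (add_le_add t0 t2)) t4)
      change |lam⁻¹ * _| ≤ _
      rw [abs_mul, abs_of_pos lam_inv_pos]
      have l := lam_inv_le
      calc _ ≤ 1 * |w (T x) 0 + φ₁ x 0 - φ₂ (x + w x) 0| := by gcongr; linarith
        _ ≤ _ := by rwa [one_mul]
    have e1 : |Γ w x 1| ≤ ‖w‖ + K + K := by
      have : |lam⁻¹ * w (T.symm x) 1| ≤ ‖w‖ := by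
        rw [abs_mul, abs_of_pos lam_inv_pos]
        have l := lam_inv_le
        calc _ ≤ 1 * |w (T.symm x) 1| := by gcongr; linarith
          _ ≤ _ := by rwa [one_mul]
      exact (abs_add_le _ _).trans (add_le_add ((abs_sub _ _).trans (add_le_add this t3)) t5)
    linarith [plane_norm_le (Γ w x)]
  have cont : ∀ w : E, Continuous (Γ w) := by
    intro w
    have hw := w.continuous
    have hT := T.continuous
    have hT' := T.symm.continuous
    have hcoord : ∀ i : Fin 2, Continuous (fun v : Plane => v i) := fun i => by fun_prop
    apply (PiLp.continuous_toLp 2 _).comp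
    apply continuous_pi
    intro i
    fin_cases i
    · change Continuous fun x => lam⁻¹ * (w (T x) 0 + φ₁ x 0 - φ₂ (x + w x) 0)
      fun_prop
    · change Continuous fun x => lam⁻¹ * w (T.symm x) 1 - φ₁ (T.symm x) 1 +
        φ₂ (T.symm x + w (T.symm x)) 1
      fun_prop
  let Γb : E → E := fun w => BoundedContinuousFunction.ofNormedAddCommGroup (Γ w) (cont w) _ (bnd w)
  have contr : ContractingWith (1 / 2) Γb := by
    refine ⟨by rw [← NNReal.coe_lt_coe]; norm_num, LipschitzWith.of_dist_le_mul fun w w' => ?_⟩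
    rw [BoundedContinuousFunction.dist_le (by positivity)]
    intro x
    have dw : ∀ y, ‖w y - w' y‖ ≤ dist w w' := fun y => by
      rw [← dist_eq_norm]; exact BoundedContinuousFunction.dist_coe_le_dist y
    have dφ : ∀ y i, |(φ₂ (y + w y) - φ₂ (y + w' y)) i| ≤ 1 / 50 * dist w w' := fun y i => by
      refine (abs_coord_le _ i).trans ((h₂ _ _).trans ?_)
      gcongr
      rw [add_sub_add_left_eq_sub]
      exact dw y
    have l := lam_inv_le
    have lp := lam_inv_pos
    have dc : ∀ y i, |(w y - w' y) i| ≤ dist w w' := fun y i => (abs_coord_le _ i).trans (dw y)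
    have lm : ∀ a c : ℝ, |a| ≤ c → |lam⁻¹ * a| ≤ 1 / 17 * c := fun a c h => by
      rw [abs_mul, abs_of_pos lp]; gcongr
    rw [dist_eq_norm]
    change ‖Γ w x - Γ w' x‖ ≤ _
    refine (plane_norm_le _).trans ?_
    have e0 : (Γ w x - Γ w' x) 0 = lam⁻¹ * (w (T x) - w' (T x)) 0 -
        lam⁻¹ * (φ₂ (x + w x) - φ₂ (x + w' x)) 0 := by
      change lam⁻¹ * (w (T x) 0 + φ₁ x 0 - φ₂ (x + w x) 0) -
        lam⁻¹ * (w' (T x) 0 + φ₁ x 0 - φ₂ (x + w' x) 0) = lam⁻¹ * (w (T x) 0 - w' (T x) 0) -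
        lam⁻¹ * (φ₂ (x + w x) 0 - φ₂ (x + w' x) 0)
      ring
    have e1 : (Γ w x - Γ w' x) 1 = lam⁻¹ * (w (T.symm x) - w' (T.symm x)) 1 +
        (φ₂ (T.symm x + w (T.symm x)) - φ₂ (T.symm x + w' (T.symm x))) 1 := by
      change (lam⁻¹ * w (T.symm x) 1 - φ₁ (T.symm x) 1 + φ₂ (T.symm x + w (T.symm x)) 1) -
        (lam⁻¹ * w' (T.symm x) 1 - φ₁ (T.symm x) 1 + φ₂ (T.symm x + w' (T.symm x)) 1) =
        lam⁻¹ * (w (T.symm x) 1 - w' (T.symm x) 1) +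
        (φ₂ (T.symm x + w (T.symm x)) 1 - φ₂ (T.symm x + w' (T.symm x)) 1)
      ring
    rw [e0, e1]
    have f0 := (abs_sub _ _).trans (add_le_add (lm _ _ (dc (T x) 0)) (lm _ _ (dφ x 0)))
    have f1 := (abs_add_le _ _).trans (add_le_add (lm _ _ (dc (T.symm x) 1)) (dφ (T.symm x) 1))
    have hd : 0 ≤ dist w w' := dist_nonneg
    simp only [NNReal.coe_div, NNReal.coe_one, NNReal.coe_ofNat]
    linarith
  have : Nonempty E := ⟨0⟩
  obtain ⟨w, hw⟩ : ∃ w : E, Γb w = w := ⟨_, contr.fixedPoint_isFixedPt⟩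
  have hw' : ∀ x, Γ w x = w x := fun x => DFunLike.congr_fun hw x
  refine ⟨fun x => x + w x, continuous_id.add w.continuous, ⟨‖w‖, fun x => ?_⟩, fun x => ?_⟩
  · rw [add_sub_cancel_left]
    exact w.norm_coe_le_norm x
  · have hl := lam_pos.ne'
    have k0 : lam⁻¹ * (w (T x) 0 + (T x 0 - lam * x 0) - (G₂ (x + w x) 0 - lam * (x 0 + w x 0)))
        = w x 0 := congrArg (fun v : Plane => v 0) (hw' x)
    have k1 : lam⁻¹ * w (T.symm (T x)) 1 - (T (T.symm (T x)) 1 - lam⁻¹ * (T.symm (T x)) 1) +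
        (G₂ (T.symm (T x) + w (T.symm (T x))) 1 - lam⁻¹ * ((T.symm (T x)) 1 + w (T.symm (T x)) 1))
        = w (T x) 1 := congrArg (fun v : Plane => v 1) (hw' (T x))
    apply plane_ext
    · change T x 0 + w (T x) 0 = G₂ (x + w x) 0
      field_simp at k0
      linarith
    · change T x 1 + w (T x) 1 = G₂ (x + w x) 1
      rw [T.symm_apply_apply] at k1
      linarith

/-- A bounded Lipschitz perturbation of the hyperbolic map that agrees with it on an invariant set
`S` and commutes with the translations in an invariant group `L` is conjugate to it by a
homeomorphism that is the identity on `S` and commutes with `L`. -/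
theorem NearHyp.exists_conj {G : Plane → Plane} (hG : NearHyp G) {K : ℝ}
    (hb : ∀ x, ‖G x - hyp x‖ ≤ K) {S : Set Plane} (hS : ∀ x ∈ S, hyp x ∈ S)
    (hS' : ∀ x ∈ S, hyp.symm x ∈ S) (hGS : ∀ x ∈ S, G x = hyp x) {L : AddSubgroup Plane}
    (hL : ∀ x ∈ L, hyp x ∈ L) (hL' : ∀ x ∈ L, hyp.symm x ∈ L)
    (hGL : ∀ x, ∀ l ∈ L, G (x + l) = G x + hyp l) :
    ∃ H : Plane ≃ₜ Plane, (∀ x, H (hyp x) = G (H x)) ∧ (∀ x ∈ S, H x = x) ∧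
      ∀ x, ∀ l ∈ L, H (x + l) = H x + l := by
  obtain ⟨T, hT⟩ := hG.exists_homeomorph
  have hK : 0 ≤ K := (norm_nonneg _).trans (hb 0)
  obtain ⟨h, hc, ⟨C, hC⟩, hh⟩ := exists_semiconj hG hyp.toHomeomorph (K := K)
    (fun x => by simpa using hK) hb
  obtain ⟨k, kc, ⟨C', hC'⟩, hk⟩ := exists_semiconj nearHyp_hyp T (K := K)
    (fun x => by rw [hT]; exact hb x) (fun x => by simpa using hK)
  have hh : ∀ x, h (hyp x) = G (h x) := hh
  have hkG : ∀ x, k (G x) = hyp (k x) := fun x => by rw [← hT]; exact hk x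
  -- `k ∘ h` and the identity both commute with `hyp` and are a bounded distance apart, so
  -- uniqueness identifies them; likewise for `h ∘ k` and `G`.
  have hkh : ∀ x, k (h x) = x := fun x => by
    refine nearHyp_hyp.eqOn_of_bounded (S := univ) (T := hyp.toEquiv) (K := C' + C)
      (h := fun x => k (h x)) (k := id) (fun _ _ => trivial) (fun _ _ => trivial)
      (fun x _ => ?_) (fun x _ => ?_) (fun x _ => rfl) (mem_univ x)
    · calc ‖k (h x) - x‖ = ‖(k (h x) - h x) + (h x - x)‖ := by congr 1; abel
        _ ≤ _ := (norm_add_le _ _).trans (add_le_add (hC' _) (hC _))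
    · change k (h (hyp x)) = _
      rw [hh, hkG]
  have hhk : ∀ x, h (k x) = x := fun x => by
    refine hG.eqOn_of_bounded (S := univ) (T := T.toEquiv) (K := C + C')
      (h := fun x => h (k x)) (k := id) (fun _ _ => trivial) (fun _ _ => trivial)
      (fun x _ => ?_) (fun x _ => ?_) (fun x _ => hT x) (mem_univ x)
    · calc ‖h (k x) - x‖ = ‖(h (k x) - k x) + (k x - x)‖ := by congr 1; abel
        _ ≤ _ := (norm_add_le _ _).trans (add_le_add (hC _) (hC' _))
    · change h (k (T x)) = _
      rw [hT, hkG, hh]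
  refine ⟨⟨⟨h, k, hkh, hhk⟩, hc, kc⟩, hh, ?_, ?_⟩
  · exact hG.eqOn_of_bounded (S := S) (T := hyp.toEquiv) (h := h) (k := id) hS hS'
      (fun x _ => hC x) (fun x _ => hh x) (fun x hx => (hGS x hx).symm)
  · intro x l hl
    -- Uniqueness over the product map `hyp × hyp` on pairs `(x, l)`: both `h (x + l) - l` and `h x`
    -- are semiconjugacies to `G`, the first because `G` commutes with translations up to `hyp`.
    have := hG.eqOn_of_bounded (X := Plane × Plane) (S := {p | p.2 ∈ L})
      (T := hyp.toEquiv.prodCongr hyp.toEquiv) (h := fun p => h (p.1 + p.2) - p.2)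
      (k := fun p => h p.1) (K := C + C) (fun p hp => hL _ hp) (fun p hp => hL' _ hp)
      (fun p _ => ?_) (fun p hp => ?_) (fun p _ => hh _) (x := (x, l)) hl
    · change h (x + l) = h x + l
      have h2 : h (x + l) - l = h x := this
      rw [← h2, sub_add_cancel]
    · calc ‖h (p.1 + p.2) - p.2 - h p.1‖ = ‖(h (p.1 + p.2) - (p.1 + p.2)) - (h p.1 - p.1)‖ := by
            congr 1; abel
        _ ≤ _ := (norm_sub_le _ _).trans (add_le_add (hC _) (hC _))
    · change h (hyp p.1 + hyp p.2) - hyp p.2 = G (h (p.1 + p.2) - p.2)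
      have h3 := hGL (h (p.1 + p.2) - p.2) p.2 hp
      rw [sub_add_cancel] at h3
      rw [← map_add, hh, h3, add_sub_cancel_right]

end BlowUp

namespace BlowUp

/-! ### Uniformly bounded and Lipschitz families -/

section UBL

variable {ι X E F G : Type*} [PseudoMetricSpace X] [NormedAddCommGroup E] [NormedAddCommGroup F]
  [NormedAddCommGroup G]

/-- The functions `f i` are bounded and Lipschitz on `S`, both with constants of order `w i`. -/
def UBL (S : Set X) (w : ι → ℝ) (f : ι → X → E) : Prop :=
  ∃ K, 0 ≤ K ∧ ∀ i, ∀ x ∈ S, ‖f i x‖ ≤ K * w i ∧ ∀ y ∈ S, ‖f i x - f i y‖ ≤ K * w i * dist x y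

namespace UBL

variable {S : Set X} {w w' : ι → ℝ} {f g : ι → X → E}

theorem mono_weight (hf : UBL S w f) (h : ∀ i, w i ≤ w' i) : UBL S w' f := by
  obtain ⟨K, hK, H⟩ := hf
  refine ⟨K, hK, fun i x hx => ⟨(H i x hx).1.trans ?_, fun y hy => ((H i x hx).2 y hy).trans ?_⟩⟩
  · exact mul_le_mul_of_nonneg_left (h i) hK
  · exact mul_le_mul_of_nonneg_right (mul_le_mul_of_nonneg_left (h i) hK) dist_nonneg

theorem add (hf : UBL S w f) (hg : UBL S w g) : UBL S w (fun i x => f i x + g i x) := by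
  obtain ⟨K, hK, H⟩ := hf
  obtain ⟨K', hK', H'⟩ := hg
  refine ⟨K + K', add_nonneg hK hK', fun i x hx => ⟨?_, fun y hy => ?_⟩⟩
  · rw [add_mul]
    exact (norm_add_le _ _).trans (add_le_add (H i x hx).1 (H' i x hx).1)
  · rw [add_mul, add_mul, add_sub_add_comm]
    exact (norm_add_le _ _).trans (add_le_add ((H i x hx).2 y hy) ((H' i x hx).2 y hy))

theorem neg (hf : UBL S w f) : UBL S w (fun i x => -f i x) := by
  obtain ⟨K, hK, H⟩ := hf
  refine ⟨K, hK, fun i x hx => ⟨by rw [norm_neg]; exact (H i x hx).1, fun y hy => ?_⟩⟩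
  rw [neg_sub_neg, norm_sub_rev]
  exact (H i x hx).2 y hy

theorem sub (hf : UBL S w f) (hg : UBL S w g) : UBL S w (fun i x => f i x - g i x) := by
  simpa only [sub_eq_add_neg] using hf.add hg.neg

/-- The Leibniz estimate, with weights multiplying; scalar multiplication, inner products and
application of linear maps are all instances. -/
theorem bilinear (op : E → F → G) (h₁ : ∀ a b, ‖op a b‖ ≤ ‖a‖ * ‖b‖)
    (h₂ : ∀ a a' b b', op a b - op a' b' = op (a - a') b + op a' (b - b'))
    (hf : UBL S w f) {g : ι → X → F} (hg : UBL S w' g) :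
    UBL S (fun i => w i * w' i) (fun i x => op (f i x) (g i x)) := by
  obtain ⟨K, hK, H⟩ := hf
  obtain ⟨K', hK', H'⟩ := hg
  have key : ∀ i, ∀ x ∈ S, 0 ≤ K * w i * (K' * w' i) := fun i x hx =>
    mul_nonneg ((norm_nonneg _).trans (H i x hx).1) ((norm_nonneg _).trans (H' i x hx).1)
  refine ⟨2 * (K * K'), by positivity, fun i x hx => ⟨?_, fun y hy => ?_⟩⟩
  · calc _ ≤ ‖f i x‖ * ‖g i x‖ := h₁ _ _
      _ ≤ (K * w i) * (K' * w' i) := mul_le_mul (H i x hx).1 (H' i x hx).1 (norm_nonneg _)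
          ((norm_nonneg _).trans (H i x hx).1)
      _ ≤ _ := by nlinarith [key i x hx]
  · rw [h₂]
    have e1 : ‖op (f i x - f i y) (g i x)‖ ≤ (K * w i * dist x y) * (K' * w' i) :=
      (h₁ _ _).trans (mul_le_mul ((H i x hx).2 y hy) (H' i x hx).1 (norm_nonneg _)
        ((norm_nonneg _).trans ((H i x hx).2 y hy)))
    have e2 : ‖op (f i y) (g i x - g i y)‖ ≤ (K * w i) * (K' * w' i * dist x y) :=
      (h₁ _ _).trans (mul_le_mul (H i y hy).1 ((H' i x hx).2 y hy) (norm_nonneg _)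
        ((norm_nonneg _).trans (H i y hy).1))
    refine (norm_add_le _ _).trans ((add_le_add e1 e2).trans (le_of_eq ?_))
    ring

theorem smul [NormedSpace ℝ E] {f : ι → X → ℝ} (hf : UBL S w f) (hg : UBL S w' g) :
    UBL S (fun i => w i * w' i) (fun i x => f i x • g i x) :=
  bilinear (fun (a : ℝ) (b : E) => a • b) (fun a b => (norm_smul a b).le)
    (fun a a' b b' => by rw [sub_smul, smul_sub]; abel) hf hg

theorem mul {f g : ι → X → ℝ} (hf : UBL S w f) (hg : UBL S w' g) :
    UBL S (fun i => w i * w' i) (fun i x => f i x * g i x) := hf.smul hg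

theorem inner [InnerProductSpace ℝ E] (hf : UBL S w f) (hg : UBL S w' g) :
    UBL S (fun i => w i * w' i) (fun i x => inner ℝ (f i x) (g i x)) :=
  bilinear (fun a b : E => Inner.inner ℝ a b) (fun a b => norm_inner_le_norm a b)
    (fun a a' b b' => by rw [inner_sub_left, inner_sub_right]; abel) hf hg

theorem clm_apply [NormedSpace ℝ E] [NormedSpace ℝ F] {f : ι → X → E →L[ℝ] F} (hf : UBL S w f)
    (hg : UBL S w' g) : UBL S (fun i => w i * w' i) (fun i x => f i x (g i x)) :=
  bilinear (fun (a : E →L[ℝ] F) b => a b) (fun a b => a.le_opNorm b)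
    (fun a a' b b' => by simp) hf hg

theorem const_mul {f : ι → X → ℝ} (c : ℝ) (hf : UBL S w f) : UBL S w (fun i x => c * f i x) := by
  have hc : UBL S (fun _ : ι => 1) (fun _ _ => c) :=
    ⟨|c|, abs_nonneg c, fun i x hx => ⟨by simp, fun y hy => by simp; positivity⟩⟩
  simpa using hc.mul hf

theorem norm (hf : UBL S w f) : UBL S w (fun i x => ‖f i x‖) := by
  obtain ⟨K, hK, H⟩ := hf
  refine ⟨K, hK, fun i x hx => ⟨by simpa using (H i x hx).1, fun y hy => ?_⟩⟩
  exact (abs_norm_sub_norm_le _ _).trans ((H i x hx).2 y hy)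

theorem inv {f : ι → X → ℝ} {c : ℝ} (hc : 0 < c) (hcf : ∀ i, ∀ x ∈ S, c ≤ f i x)
    (hf : UBL S (fun _ => 1) f) : UBL S (fun _ => 1) (fun i x => (f i x)⁻¹) := by
  obtain ⟨K, hK, H⟩ := hf
  refine ⟨c⁻¹ + K * (c⁻¹ * c⁻¹), by positivity, fun i x hx => ⟨?_, fun y hy => ?_⟩⟩
  · have hp : 0 < f i x := hc.trans_le (hcf i x hx)
    rw [Real.norm_eq_abs, abs_of_pos (inv_pos.2 hp), mul_one]
    have : (f i x)⁻¹ ≤ c⁻¹ := inv_anti₀ hc (hcf i x hx)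
    have : 0 ≤ K * (c⁻¹ * c⁻¹) := by positivity
    linarith
  · have hx' := hc.trans_le (hcf i x hx)
    have hy' := hc.trans_le (hcf i y hy)
    rw [inv_sub_inv hx'.ne' hy'.ne', norm_div, norm_sub_rev, norm_mul, Real.norm_eq_abs (f i x),
      Real.norm_eq_abs (f i y), abs_of_pos hx', abs_of_pos hy', div_eq_mul_inv, mul_inv]
    have h1 := (H i x hx).2 y hy
    rw [mul_one] at h1 ⊢
    calc _ ≤ (K * dist x y) * (c⁻¹ * c⁻¹) := by
          gcongr
          · exact hcf i x hx
          · exact hcf i y hy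
      _ ≤ _ := by
          have : 0 ≤ c⁻¹ * dist x y := by positivity
          linarith

/-- The lower bound keeps away from the singularity of the root: the difference of the roots times
their sum is the difference of the arguments, and the sum is at least `√c`. -/
theorem sqrt {f : ι → X → ℝ} {c : ℝ} (hc : 0 < c) (hcf : ∀ i, ∀ x ∈ S, c ≤ f i x)
    (hf : UBL S (fun _ => 1) f) : UBL S (fun _ => 1) (fun i x => √(f i x)) := by
  obtain ⟨K, hK, H⟩ := hf
  have hs : 0 < √c := Real.sqrt_pos.2 hc
  refine ⟨1 + K + K * (√c)⁻¹, by positivity, fun i x hx => ⟨?_, fun y hy => ?_⟩⟩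
  · rw [Real.norm_eq_abs, abs_of_nonneg (Real.sqrt_nonneg _), mul_one]
    have h1 := (H i x hx).1
    rw [mul_one] at h1
    have h2 := (le_abs_self _).trans h1
    have h3 : √(f i x) ≤ 1 + K := by
      rw [Real.sqrt_le_left (by positivity)]
      nlinarith
    have : 0 ≤ K * (√c)⁻¹ := by positivity
    linarith
  · have hx' := hc.trans_le (hcf i x hx)
    have hy' := hc.trans_le (hcf i y hy)
    have sx : √c ≤ √(f i x) := Real.sqrt_le_sqrt (hcf i x hx)
    have h1 := (H i x hx).2 y hy
    rw [mul_one] at h1 ⊢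
    have e : (√(f i x) - √(f i y)) * (√(f i x) + √(f i y)) = f i x - f i y := by
      have := Real.mul_self_sqrt hx'.le
      have := Real.mul_self_sqrt hy'.le
      linarith
    have hle : ‖√(f i x) - √(f i y)‖ * √c ≤ K * dist x y := by
      calc _ ≤ ‖√(f i x) - √(f i y)‖ * ‖√(f i x) + √(f i y)‖ := by
            gcongr
            rw [Real.norm_eq_abs, abs_of_nonneg (by positivity)]
            linarith [Real.sqrt_nonneg (f i y)]
        _ = ‖f i x - f i y‖ := by rw [← norm_mul, e]
        _ ≤ _ := h1
    have h2 : ‖√(f i x) - √(f i y)‖ ≤ K * dist x y * (√c)⁻¹ := by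
      rwa [← div_eq_mul_inv, le_div_iff₀ hs]
    have : 0 ≤ (1 + K) * dist x y := by positivity
    linarith

/-- Averaging over the segments from `(0, e)` to `(ρ, e)`. -/
theorem average {ρ₀ : ℝ} {T : Set X} {f : ι → ℝ × X → ℝ} {w : ι → ℝ}
    (hf : UBL (Icc 0 ρ₀ ×ˢ T) w f) :
    UBL (Icc 0 ρ₀ ×ˢ T) w (fun i x => ∫ t in (0 : ℝ)..1, f i (t * x.1, x.2)) := by
  obtain ⟨K, hK, H⟩ := hf
  have mem : ∀ x ∈ Icc 0 ρ₀ ×ˢ T, ∀ t ∈ Icc (0 : ℝ) 1, (t * x.1, x.2) ∈ Icc 0 ρ₀ ×ˢ T := by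
    intro x hx t ht
    refine ⟨⟨mul_nonneg ht.1 hx.1.1, ?_⟩, hx.2⟩
    exact (mul_le_of_le_one_left hx.1.1 ht.2).trans hx.1.2
  have cont : ∀ i, ∀ x ∈ Icc 0 ρ₀ ×ˢ T,
      IntervalIntegrable (fun t => f i (t * x.1, x.2)) MeasureTheory.volume 0 1 := by
    intro i x hx
    apply ContinuousOn.intervalIntegrable
    rw [uIcc_of_le zero_le_one]
    have hl : LipschitzOnWith (Real.toNNReal (K * w i * |x.1|)) (fun t => f i (t * x.1, x.2))
        (Icc 0 1) := by
      have hKw : 0 ≤ K * w i := (norm_nonneg _).trans (H i x hx).1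
      refine LipschitzOnWith.of_dist_le_mul fun s hs t ht => ?_
      have := (H i _ (mem x hx s hs)).2 _ (mem x hx t ht)
      rw [dist_eq_norm, Real.coe_toNNReal _ (by positivity)]
      refine this.trans (le_of_eq ?_)
      rw [Prod.dist_eq, dist_self, max_eq_left dist_nonneg, Real.dist_eq, Real.dist_eq, ← sub_mul,
        abs_mul]
      ring
    exact hl.continuousOn
  refine ⟨K, hK, fun i x hx => ⟨?_, fun y hy => ?_⟩⟩
  · have := intervalIntegral.norm_integral_le_of_norm_le_const (a := (0 : ℝ)) (b := 1)
      (f := fun t => f i (t * x.1, x.2)) (C := K * w i) fun t ht => by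
        rw [uIoc_of_le zero_le_one] at ht
        exact (H i _ (mem x hx t ⟨ht.1.le, ht.2⟩)).1
    simpa using this
  · rw [← intervalIntegral.integral_sub (cont i x hx) (cont i y hy)]
    have hKw : 0 ≤ K * w i := (norm_nonneg _).trans (H i x hx).1
    have := intervalIntegral.norm_integral_le_of_norm_le_const (a := (0 : ℝ)) (b := 1)
      (f := fun t => f i (t * x.1, x.2) - f i (t * y.1, y.2)) (C := K * w i * dist x y)
      fun t ht => by
        rw [uIoc_of_le zero_le_one] at ht
        have ht' : t ∈ Icc (0 : ℝ) 1 := ⟨ht.1.le, ht.2⟩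
        refine ((H i _ (mem x hx t ht')).2 _ (mem y hy t ht')).trans ?_
        gcongr
        rw [Prod.dist_eq, Prod.dist_eq]
        refine max_le_max ?_ le_rfl
        simp only [Real.dist_eq]
        rw [← mul_sub, abs_mul, abs_of_nonneg ht.1.le]
        exact mul_le_of_le_one_left (abs_nonneg _) ht.2
    simpa using this

end UBL

end UBL

/-- Maps of the form `x ↦ |x| m(|x|², x/|x|)` with a bounded and Lipschitz `m` are Lipschitz. -/
theorem lipschitz_of_polar {τ K : ℝ} (hτ : 0 ≤ τ) (hK : 0 ≤ K) {m : ℝ × Plane → Plane}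
    (hm : ∀ x ∈ Icc 0 (τ ^ 2) ×ˢ Metric.sphere (0 : Plane) 1, ‖m x‖ ≤ K ∧
      ∀ y ∈ Icc 0 (τ ^ 2) ×ˢ Metric.sphere (0 : Plane) 1, ‖m x - m y‖ ≤ K * dist x y)
    {g : Plane → Plane} (h0 : g 0 = 0)
    (hg : ∀ x, x ≠ 0 → ‖x‖ ≤ τ → g x = ‖x‖ • m (‖x‖ ^ 2, ‖x‖⁻¹ • x)) :
    ∀ x y, ‖x‖ ≤ τ → ‖y‖ ≤ τ → ‖g x - g y‖ ≤ (2 * τ ^ 2 + 3) * K * ‖x - y‖ := by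
  have mem : ∀ x : Plane, x ≠ 0 → ‖x‖ ≤ τ →
      (‖x‖ ^ 2, ‖x‖⁻¹ • x) ∈ Icc 0 (τ ^ 2) ×ˢ Metric.sphere (0 : Plane) 1 := by
    intro x hx hxτ
    refine ⟨⟨by positivity, pow_le_pow_left₀ (norm_nonneg x) hxτ 2⟩, ?_⟩
    rw [mem_sphere_zero_iff_norm, norm_smul, norm_inv, norm_norm,
      inv_mul_cancel₀ (norm_ne_zero_iff.2 hx)]
  have base : ∀ x, ‖x‖ ≤ τ → ‖g x‖ ≤ (2 * τ ^ 2 + 3) * K * ‖x‖ := by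
    intro x hxτ
    by_cases hx : x = 0
    · simp [hx, h0]
    · rw [hg x hx hxτ, norm_smul, norm_norm, mul_comm]
      have h1 := (hm _ (mem x hx hxτ)).1
      gcongr
      nlinarith [sq_nonneg τ]
  intro x y hx hy
  by_cases hx0 : x = 0
  · rw [hx0, h0, zero_sub, norm_neg, zero_sub, norm_neg]
    exact base y hy
  by_cases hy0 : y = 0
  · rw [hy0, h0, sub_zero, sub_zero]
    exact base x hx
  have px : 0 < ‖x‖ := norm_pos_iff.2 hx0
  have py : 0 < ‖y‖ := norm_pos_iff.2 hy0
  have hxy : |‖x‖ - ‖y‖| ≤ ‖x - y‖ := abs_norm_sub_norm_le x y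
  rw [hg x hx0 hx, hg y hy0 hy]
  set a := m (‖x‖ ^ 2, ‖x‖⁻¹ • x)
  set b := m (‖y‖ ^ 2, ‖y‖⁻¹ • y)
  have hab : ‖a - b‖ ≤ K * dist (‖x‖ ^ 2, ‖x‖⁻¹ • x) (‖y‖ ^ 2, ‖y‖⁻¹ • y) :=
    (hm _ (mem x hx0 hx)).2 _ (mem y hy0 hy)
  have hb : ‖b‖ ≤ K := (hm _ (mem y hy0 hy)).1
  have d1 : ‖x‖ * |‖x‖ ^ 2 - ‖y‖ ^ 2| ≤ 2 * τ ^ 2 * ‖x - y‖ := by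
    have : ‖x‖ ^ 2 - ‖y‖ ^ 2 = (‖x‖ + ‖y‖) * (‖x‖ - ‖y‖) := by ring
    rw [this, abs_mul, abs_of_pos (by positivity)]
    calc _ ≤ τ * ((τ + τ) * ‖x - y‖) := by gcongr
      _ = _ := by ring
  -- The direction `x / ‖x‖` has a Lipschitz constant of order `1 / ‖x‖`; the prefactor `‖x‖`
  -- exactly compensates.
  have d2 : ‖x‖ * ‖‖x‖⁻¹ • x - ‖y‖⁻¹ • y‖ ≤ 2 * ‖x - y‖ := by
    have e : ‖x‖ • (‖x‖⁻¹ • x - ‖y‖⁻¹ • y) = (x - y) + (‖y‖ - ‖x‖) • ‖y‖⁻¹ • y := by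
      rw [smul_sub, smul_smul, mul_inv_cancel₀ px.ne', one_smul, sub_smul, smul_smul ‖y‖,
        mul_inv_cancel₀ py.ne', one_smul]
      abel
    rw [← norm_smul_of_nonneg px.le, e]
    refine (norm_add_le _ _).trans ?_
    rw [norm_smul, norm_smul, norm_inv, norm_norm, inv_mul_cancel₀ py.ne', mul_one,
      Real.norm_eq_abs, abs_sub_comm]
    linarith
  have d3 : ‖x‖ * dist (‖x‖ ^ 2, ‖x‖⁻¹ • x) (‖y‖ ^ 2, ‖y‖⁻¹ • y) ≤
      (2 * τ ^ 2 + 2) * ‖x - y‖ := by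
    rw [Prod.dist_eq, mul_max_of_nonneg _ _ px.le]
    have n1 : 0 ≤ τ ^ 2 * ‖x - y‖ := by positivity
    apply max_le
    · rw [Real.dist_eq]
      nlinarith [norm_nonneg (x - y)]
    · rw [dist_eq_norm]
      nlinarith [norm_nonneg (x - y)]
  have e : ‖x‖ • a - ‖y‖ • b = ‖x‖ • (a - b) + (‖x‖ - ‖y‖) • b := by
    rw [smul_sub, sub_smul]; abel
  rw [e]
  refine (norm_add_le _ _).trans ?_
  rw [norm_smul, norm_smul, norm_norm, Real.norm_eq_abs]
  have f1 : ‖x‖ * ‖a - b‖ ≤ K * ((2 * τ ^ 2 + 2) * ‖x - y‖) := by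
    calc _ ≤ ‖x‖ * (K * dist (‖x‖ ^ 2, ‖x‖⁻¹ • x) (‖y‖ ^ 2, ‖y‖⁻¹ • y)) := by gcongr
      _ = K * (‖x‖ * dist (‖x‖ ^ 2, ‖x‖⁻¹ • x) (‖y‖ ^ 2, ‖y‖⁻¹ • y)) := by ring
      _ ≤ _ := by gcongr
  have f2 : |‖x‖ - ‖y‖| * ‖b‖ ≤ ‖x - y‖ * K := by gcongr
  linarith

end BlowUp

namespace BlowUp

/-! ### Perturbations of the blown-up saddle -/

/-- `u` is bounded by `η` together with its derivative and the Lipschitz constant of the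
derivative. -/
structure SmallC2 (η : ℝ) (u : Plane → Plane) : Prop where
  diff : Differentiable ℝ u
  bound : ∀ x, ‖u x‖ ≤ η
  bound_fderiv : ∀ x, ‖fderiv ℝ u x‖ ≤ η
  lip_fderiv : ∀ x y, ‖fderiv ℝ u x - fderiv ℝ u y‖ ≤ η * ‖x - y‖

theorem SmallC2.lip {η : ℝ} {u : Plane → Plane} (h : SmallC2 η u) (x y : Plane) :
    ‖u x - u y‖ ≤ η * ‖x - y‖ :=
  convex_univ.norm_image_sub_le_of_norm_fderiv_le (fun z _ => h.diff z)
    (fun z _ => h.bound_fderiv z) (mem_univ y) (mem_univ x)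

theorem SmallC2.nonneg {η : ℝ} {u : Plane → Plane} (h : SmallC2 η u) : 0 ≤ η :=
  (norm_nonneg _).trans (h.bound 0)

/-- The map `r ↦ √(r² + δ²)` of the radius. -/
def blowOut (δ : ℝ) (x : Plane) : Plane := (√(‖x‖ ^ 2 + δ ^ 2) / ‖x‖) • x

/-- The map `r ↦ √(r² - δ²)` of the radius. -/
def blowIn (δ : ℝ) (x : Plane) : Plane := (√(‖x‖ ^ 2 - δ ^ 2) / ‖x‖) • x

namespace Saddle

/-- The circle of directions times an interval of values of `ρ = |x|²`. -/
def dom (ρ₀ : ℝ) : Set (ℝ × Plane) := Icc 0 ρ₀ ×ˢ Metric.sphere (0 : Plane) 1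

variable (δ : ℝ)

/-- The radius of the point blown out of `x = √ρ e`. -/
def rad (x : ℝ × Plane) : ℝ := √(x.1 + δ ^ 2)

/-- The point blown out of `x = √ρ e`. -/
def pt (x : ℝ × Plane) : Plane := rad δ x • x.2

/-- The derivative of `pt` in `ρ`. -/
def pt' (x : ℝ × Plane) : Plane := (2 * rad δ x)⁻¹ • x.2

/-- The expansion of the direction `e`. -/
def ex (x : ℝ × Plane) : ℝ := ‖hyp x.2‖

/-- The image of the direction `e`. -/
def dir (x : ℝ × Plane) : Plane := (ex x)⁻¹ • hyp x.2

/-- The radius of the image of `pt`. -/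
def imRad (x : ℝ × Plane) : ℝ := √(x.1 * ex x ^ 2 + δ ^ 2)

/-- The image of `pt` under the blown-up map. -/
def im (x : ℝ × Plane) : Plane := imRad δ x • dir x

/-- The derivative of `im` in `ρ`. -/
def im' (x : ℝ × Plane) : Plane := (ex x ^ 2 * (2 * imRad δ x)⁻¹) • dir x

variable (u : Plane → Plane)

/-- The change of the squared radius caused by the perturbation `u`. -/
def chg (x : ℝ × Plane) : ℝ :=
  2 * inner ℝ (im δ x) (u (pt δ x)) + inner ℝ (u (pt δ x)) (u (pt δ x))

/-- The derivative of `chg` in `ρ`. -/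
def chg' (x : ℝ × Plane) : ℝ :=
  2 * (inner ℝ (im' δ x) (u (pt δ x)) + inner ℝ (im δ x) (fderiv ℝ u (pt δ x) (pt' δ x)))
    + 2 * inner ℝ (u (pt δ x)) (fderiv ℝ u (pt δ x) (pt' δ x))

/-- The quotient `chg / ρ`. -/
def quo (x : ℝ × Plane) : ℝ := ∫ t in (0 : ℝ)..1, chg' δ u (t * x.1, x.2)

/-- The image of `pt` under the perturbed map. -/
def pert (x : ℝ × Plane) : Plane := im δ x + u (pt δ x)

/-- The expansion of the perturbed map after blowing down. -/
def exP (x : ℝ × Plane) : ℝ := √(ex x ^ 2 + quo δ u x)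

/-- The perturbation after blowing down, divided by the radius. -/
def disp (x : ℝ × Plane) : Plane :=
  exP δ u x • (‖pert δ u x‖⁻¹ • u (pt δ x) -
      (chg δ u x * (‖pert δ u x‖ * imRad δ x * (‖pert δ u x‖ + imRad δ x))⁻¹) • im δ x) +
    (quo δ u x * (exP δ u x + ex x)⁻¹) • dir x

variable {δ u} {ρ₀ : ℝ} {x : ℝ × Plane}

theorem ex_pos (hx : ‖x.2‖ = 1) : lam⁻¹ ≤ ex x := by
  have := le_norm_hyp x.2
  rwa [hx, mul_one] at this

theorem ex_le (hx : ‖x.2‖ = 1) : ex x ≤ lam := by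
  have := norm_hyp_le x.2
  rwa [hx, mul_one] at this

theorem norm_dir (hx : ‖x.2‖ = 1) : ‖dir x‖ = 1 := by
  have h := lam_inv_pos.trans_le (ex_pos hx)
  rw [dir, norm_smul, norm_inv, Real.norm_eq_abs, abs_of_pos h]
  exact inv_mul_cancel₀ h.ne'

theorem norm_dom (hx : x ∈ dom ρ₀) : ‖x.2‖ = 1 := mem_sphere_zero_iff_norm.1 hx.2

theorem le_rad (hδ : 0 < δ) (hx : 0 ≤ x.1) : δ ≤ rad δ x := by
  rw [rad, Real.le_sqrt' hδ]
  linarith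

theorem le_imRad (hδ : 0 < δ) (hx : 0 ≤ x.1) : δ ≤ imRad δ x := by
  rw [imRad, Real.le_sqrt' hδ]
  have : 0 ≤ x.1 * ex x ^ 2 := by positivity
  linarith

theorem norm_im (hδ : 0 < δ) (hx : 0 ≤ x.1) (hx' : ‖x.2‖ = 1) : ‖im δ x‖ = imRad δ x := by
  rw [im, norm_smul, norm_dir hx', mul_one, Real.norm_eq_abs,
    abs_of_pos (hδ.trans_le (le_imRad hδ hx))]

theorem imRad_sq (hx : 0 ≤ x.1) : imRad δ x ^ 2 = x.1 * ex x ^ 2 + δ ^ 2 :=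
  Real.sq_sqrt (by positivity)

theorem norm_pert_sq (hδ : 0 < δ) (hx : 0 ≤ x.1) (hx' : ‖x.2‖ = 1) :
    ‖pert δ u x‖ ^ 2 = x.1 * ex x ^ 2 + δ ^ 2 + chg δ u x := by
  rw [pert, norm_add_sq_real, norm_im hδ hx hx', imRad_sq hx, chg, real_inner_self_eq_norm_sq]
  ring

theorem hasDerivAt_chg (hδ : 0 < δ) (hu : Differentiable ℝ u) (hx : 0 ≤ x.1) :
    HasDerivAt (fun s => chg δ u (s, x.2)) (chg' δ u x) x.1 := by
  have hp : HasDerivAt (fun s => pt δ (s, x.2)) (pt' δ x) x.1 := by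
    have h1 : HasDerivAt (fun s => s + δ ^ 2) 1 x.1 := (hasDerivAt_id x.1).add_const _
    have h2 := (h1.sqrt (by positivity)).smul_const x.2
    rw [one_div] at h2
    exact h2
  have hi : HasDerivAt (fun s => im δ (s, x.2)) (im' δ x) x.1 := by
    have h1 : HasDerivAt (fun s => s * ex x ^ 2 + δ ^ 2) (1 * ex x ^ 2) x.1 :=
      ((hasDerivAt_id x.1).mul_const _).add_const _
    have h2 := (h1.sqrt (by positivity)).smul_const (dir x)
    rw [one_mul, div_eq_mul_inv] at h2
    exact h2
  have hup : HasDerivAt (fun s => u (pt δ (s, x.2))) (fderiv ℝ u (pt δ x) (pt' δ x)) x.1 :=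
    (hu (pt δ x)).hasFDerivAt.comp_hasDerivAt x.1 hp
  have := ((hi.inner ℝ hup).const_mul 2).add (hup.inner ℝ hup)
  refine this.congr_deriv ?_
  change 2 * (inner ℝ (im δ x) (fderiv ℝ u (pt δ x) (pt' δ x)) + inner ℝ (im' δ x) (u (pt δ x))) +
    (inner ℝ (u (pt δ x)) (fderiv ℝ u (pt δ x) (pt' δ x)) +
      inner ℝ (fderiv ℝ u (pt δ x) (pt' δ x)) (u (pt δ x))) = _
  rw [chg', real_inner_comm (u (pt δ x)) (fderiv ℝ u (pt δ x) (pt' δ x))]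
  ring

/-! ### Uniform estimates in polar form -/

section families

variable {ι : Type*}

theorem ubl_const (c : ℝ) : UBL (dom ρ₀) (fun _ : ι => 1) (fun _ _ => c) :=
  ⟨|c|, abs_nonneg c, fun i x hx => ⟨by simp, fun y hy => by simp; positivity⟩⟩

theorem ubl_fst : UBL (dom ρ₀) (fun _ : ι => 1) (fun _ x => x.1) := by
  refine ⟨|ρ₀| + 1, by positivity, fun i x hx => ⟨?_, fun y hy => ?_⟩⟩
  · rw [Real.norm_eq_abs, abs_of_nonneg hx.1.1]
    linarith [hx.1.2, le_abs_self ρ₀]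
  · rw [mul_one, ← dist_eq_norm]
    have : dist x.1 y.1 ≤ dist x y := le_max_left _ _
    nlinarith [abs_nonneg ρ₀, dist_nonneg (x := x) (y := y)]

theorem ubl_snd : UBL (dom ρ₀) (fun _ : ι => 1) (fun _ x => x.2) := by
  refine ⟨1, zero_le_one, fun i x hx => ⟨by simp [norm_dom hx], fun y hy => ?_⟩⟩
  rw [mul_one, one_mul, ← dist_eq_norm]
  exact le_max_right _ _

theorem ubl_hyp : UBL (dom ρ₀) (fun _ : ι => 1) (fun _ x => hyp x.2) := by
  refine ⟨lam, lam_pos.le, fun i x hx => ⟨?_, fun y hy => ?_⟩⟩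
  · simpa [norm_dom hx] using norm_hyp_le x.2
  · rw [← map_sub, mul_one]
    refine (norm_hyp_le _).trans (mul_le_mul_of_nonneg_left ?_ lam_pos.le)
    rw [← dist_eq_norm]
    exact le_max_right _ _

theorem ubl_ex : UBL (dom ρ₀) (fun _ : ι => 1) (fun _ x => ex x) := ubl_hyp.norm

theorem ubl_dir : UBL (dom ρ₀) (fun _ : ι => 1) (fun _ x => dir x) := by
  have h := (ubl_ex (ρ₀ := ρ₀) (ι := ι)).inv lam_inv_pos fun _ x hx => ex_pos (norm_dom hx)
  exact (h.smul ubl_hyp).mono_weight fun _ => by simp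

theorem ubl_rad (hδ : 0 < δ) : UBL (dom ρ₀) (fun _ : ι => 1) (fun _ x => rad δ x) :=
  (ubl_fst.add (ubl_const (δ ^ 2))).sqrt (c := δ ^ 2) (by positivity)
    fun _ x hx => by linarith [hx.1.1]

theorem ubl_pt (hδ : 0 < δ) : UBL (dom ρ₀) (fun _ : ι => 1) (fun _ x => pt δ x) := by
  exact ((ubl_rad hδ).smul ubl_snd).mono_weight fun _ => by simp

theorem ubl_pt' (hδ : 0 < δ) : UBL (dom ρ₀) (fun _ : ι => 1) (fun _ x => pt' δ x) := by
  have h := ((ubl_rad (ρ₀ := ρ₀) (ι := ι) hδ).const_mul 2).inv hδ fun _ x hx => by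
    linarith [le_rad hδ hx.1.1]
  exact (h.smul ubl_snd).mono_weight fun _ => by simp

theorem ubl_ex_sq : UBL (dom ρ₀) (fun _ : ι => 1) (fun _ x => ex x ^ 2) := by
  simpa [sq] using ubl_ex.mul ubl_ex

theorem ubl_imRad (hδ : 0 < δ) : UBL (dom ρ₀) (fun _ : ι => 1) (fun _ x => imRad δ x) := by
  have h : UBL (dom ρ₀) (fun _ : ι => 1) (fun _ x => x.1 * ex x ^ 2) := by
    simpa using ubl_fst.mul ubl_ex_sq
  exact (h.add (ubl_const (δ ^ 2))).sqrt (c := δ ^ 2) (by positivity)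
    fun _ x hx => by
      have : 0 ≤ x.1 * ex x ^ 2 := mul_nonneg hx.1.1 (sq_nonneg _)
      linarith

theorem ubl_im (hδ : 0 < δ) : UBL (dom ρ₀) (fun _ : ι => 1) (fun _ x => im δ x) := by
  exact ((ubl_imRad hδ).smul ubl_dir).mono_weight fun _ => by simp

theorem ubl_im' (hδ : 0 < δ) : UBL (dom ρ₀) (fun _ : ι => 1) (fun _ x => im' δ x) := by
  have h := ((ubl_imRad (ρ₀ := ρ₀) (ι := ι) hδ).const_mul 2).inv hδ fun _ x hx => by
    linarith [le_imRad hδ hx.1.1]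
  exact ((ubl_ex_sq.mul h).smul ubl_dir).mono_weight fun _ => by simp

variable {w : ι → ℝ} {v : ι → Plane → Plane}

theorem ubl_comp_pt {E : Type*} [NormedAddCommGroup E] (hδ : 0 < δ) {f : ι → Plane → E}
    (h1 : ∀ i x, ‖f i x‖ ≤ w i) (h2 : ∀ i x y, ‖f i x - f i y‖ ≤ w i * ‖x - y‖) :
    UBL (dom ρ₀) w (fun i x => f i (pt δ x)) := by
  obtain ⟨K, hK, H⟩ := ubl_pt (ρ₀ := ρ₀) (ι := ι) hδ
  refine ⟨1 + K, by positivity, fun i x hx => ?_⟩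
  have hw : 0 ≤ w i := (norm_nonneg _).trans (h1 i 0)
  refine ⟨(h1 i _).trans (by nlinarith), fun y hy => (h2 i _ _).trans ?_⟩
  have := (H i x hx).2 y hy
  rw [mul_one] at this
  have hd := dist_nonneg (x := x) (y := y)
  calc _ ≤ w i * (K * dist x y) := by gcongr
    _ ≤ _ := by nlinarith [mul_nonneg hw hd]

theorem ubl_u (hδ : 0 < δ) (hv : ∀ i, SmallC2 (w i) (v i)) :
    UBL (dom ρ₀) w (fun i x => v i (pt δ x)) :=
  ubl_comp_pt hδ (fun i => (hv i).bound) fun i => (hv i).lip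

theorem ubl_du (hδ : 0 < δ) (hv : ∀ i, SmallC2 (w i) (v i)) :
    UBL (dom ρ₀) w (fun i x => fderiv ℝ (v i) (pt δ x) (pt' δ x)) := by
  simpa using (ubl_comp_pt hδ (fun i => (hv i).bound_fderiv) fun i => (hv i).lip_fderiv).clm_apply
    (ubl_pt' hδ)

theorem ubl_inner_small (hw : ∀ i, 0 ≤ w i) (hw1 : ∀ i, w i ≤ 1) {f g : ι → ℝ × Plane → Plane}
    (hf : UBL (dom ρ₀) w f) (hg : UBL (dom ρ₀) w g) :
    UBL (dom ρ₀) w (fun i x => inner ℝ (f i x) (g i x)) :=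
  (hf.inner hg).mono_weight fun i => mul_le_of_le_one_left (hw i) (hw1 i)

theorem ubl_chg (hδ : 0 < δ) (hw1 : ∀ i, w i ≤ 1) (hv : ∀ i, SmallC2 (w i) (v i)) :
    UBL (dom ρ₀) w (fun i x => chg δ (v i) x) := by
  have hU := ubl_u (ρ₀ := ρ₀) hδ hv
  have h1 : UBL (dom ρ₀) w (fun i x => inner ℝ (im δ x) (v i (pt δ x))) := by
    simpa using (ubl_im hδ).inner hU
  exact (h1.const_mul 2).add (ubl_inner_small (fun i => (hv i).nonneg) hw1 hU hU)

/-- Dividing by `ρ` costs a derivative: `quo` averages `chg'`, which contains `fderiv ℝ u`. Its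
Lipschitz bound therefore rests on the Lipschitz bound for that derivative, which is why `C²`
closeness enters. -/
theorem ubl_quo (hδ : 0 < δ) (hw1 : ∀ i, w i ≤ 1) (hv : ∀ i, SmallC2 (w i) (v i)) :
    UBL (dom ρ₀) w (fun i x => quo δ (v i) x) := by
  have hU := ubl_u (ρ₀ := ρ₀) hδ hv
  have hD := ubl_du (ρ₀ := ρ₀) hδ hv
  have h1 : UBL (dom ρ₀) w (fun i x => inner ℝ (im' δ x) (v i (pt δ x))) := by
    simpa using (ubl_im' hδ).inner hU
  have h2 : UBL (dom ρ₀) w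
      (fun i x => inner ℝ (im δ x) (fderiv ℝ (v i) (pt δ x) (pt' δ x))) := by
    simpa using (ubl_im hδ).inner hD
  have h3 := ubl_inner_small (fun i => (hv i).nonneg) hw1 hU hD
  exact UBL.average (((h1.add h2).const_mul 2).add (h3.const_mul 2))

/-- Each summand of `disp` carries one factor of order `w`, namely `u`, `chg` or `quo`. The other
factors are bounded and Lipschitz because the denominators stay away from zero: `‖pert‖ ≥ δ / 2` by
`hwδ`, `imRad ≥ δ` and `ex ≥ lam⁻¹`. The hypothesis `hq` does the same for the root in `exP`. -/
theorem ubl_disp (hδ : 0 < δ) (hw1 : ∀ i, w i ≤ 1) (hwδ : ∀ i, w i ≤ δ / 2)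
    (hv : ∀ i, SmallC2 (w i) (v i))
    (hq : ∀ i, ∀ x ∈ dom ρ₀, (lam⁻¹) ^ 2 / 2 ≤ ex x ^ 2 + quo δ (v i) x) :
    UBL (dom ρ₀) w (fun i x => disp δ (v i) x) := by
  have hU := ubl_u (ρ₀ := ρ₀) hδ hv
  have hQ := ubl_quo (ρ₀ := ρ₀) hδ hw1 hv
  have hC := ubl_chg (ρ₀ := ρ₀) hδ hw1 hv
  have hb := ubl_imRad (ρ₀ := ρ₀) (ι := ι) hδ
  have lp := lam_inv_pos
  have hE : UBL (dom ρ₀) (fun _ => 1) (fun i x => exP δ (v i) x) :=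
    (ubl_ex_sq.add (hQ.mono_weight hw1)).sqrt (by positivity) hq
  have hP : UBL (dom ρ₀) (fun _ => 1) (fun i x => ‖pert δ (v i) x‖) :=
    ((ubl_im hδ).add (hU.mono_weight hw1)).norm
  have hPl : ∀ i, ∀ x ∈ dom ρ₀, δ / 2 ≤ ‖pert δ (v i) x‖ := by
    intro i x hx
    have h1 := norm_im hδ hx.1.1 (norm_dom hx)
    have h2 := le_imRad hδ hx.1.1
    have h3 := norm_sub_le_norm_add (im δ x) (v i (pt δ x))
    have h4 := (hv i).bound (pt δ x)
    have h5 := hwδ i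
    rw [pert]
    linarith
  have hPi := hP.inv (by positivity) hPl
  have hden : UBL (dom ρ₀) (fun _ => 1)
      (fun i x => ‖pert δ (v i) x‖ * imRad δ x * (‖pert δ (v i) x‖ + imRad δ x)) :=
    ((hP.mul hb).mul (hP.add hb)).mono_weight fun _ => by simp
  have hdi := hden.inv (c := δ / 2 * δ * (δ / 2 + δ)) (by positivity) fun i x hx => by
    have h1 := hPl i x hx
    have h2 := le_imRad hδ hx.1.1
    have h3 : 0 ≤ imRad δ x := hδ.le.trans h2
    gcongr
  have h1 : UBL (dom ρ₀) w (fun i x => ‖pert δ (v i) x‖⁻¹ • v i (pt δ x)) :=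
    (hPi.smul hU).mono_weight fun _ => by simp
  have h2 : UBL (dom ρ₀) w (fun i x =>
      (chg δ (v i) x * (‖pert δ (v i) x‖ * imRad δ x * (‖pert δ (v i) x‖ + imRad δ x))⁻¹) • im δ x) :=
    ((hC.mul hdi).smul (ubl_im hδ)).mono_weight fun _ => by simp
  have hsi := (hE.add ubl_ex).inv lp fun i x hx => by
    have := ex_pos (norm_dom hx)
    have : 0 ≤ exP δ (v i) x := Real.sqrt_nonneg _
    linarith
  have h3 : UBL (dom ρ₀) w (fun i x => (quo δ (v i) x * (exP δ (v i) x + ex x)⁻¹) • dir x) :=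
    ((hQ.mul hsi).smul ubl_dir).mono_weight fun _ => by simp
  have h4 : UBL (dom ρ₀) w (fun i x => exP δ (v i) x • (‖pert δ (v i) x‖⁻¹ • v i (pt δ x) -
      (chg δ (v i) x * (‖pert δ (v i) x‖ * imRad δ x * (‖pert δ (v i) x‖ + imRad δ x))⁻¹) •
        im δ x)) :=
    (hE.smul (h1.sub h2)).mono_weight fun _ => by simp
  exact h4.add h3

end families

/-- The fundamental theorem of calculus along `t ↦ (t ρ, e)`: a function vanishing on the circle `ρ
= 0` is divisible by `ρ`. -/
theorem chg_eq {η : ℝ} (hδ : 0 < δ) (hu : SmallC2 η u) (hx : x ∈ dom ρ₀)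
    (h0 : chg δ u (0, x.2) = 0) : chg δ u x = x.1 * quo δ u x := by
  have hd : ∀ t ∈ uIcc (0 : ℝ) 1, HasDerivAt (fun t => chg δ u (t * x.1, x.2))
      (x.1 * chg' δ u (t * x.1, x.2)) t := by
    intro t ht
    rw [uIcc_of_le zero_le_one] at ht
    have h1 := hasDerivAt_chg (x := (t * x.1, x.2)) hδ hu.diff (mul_nonneg ht.1 hx.1.1)
    have h2 : HasDerivAt (fun t => t * x.1) x.1 t := by
      simpa using (hasDerivAt_id t).mul_const x.1
    have h3 := HasDerivAt.comp t h1 h2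
    exact h3.congr_deriv (mul_comm _ _)
  have hcont : ContinuousOn (fun t => chg' δ u (t * x.1, x.2)) (uIcc 0 1) := by
    have hr : ∀ t ∈ uIcc (0 : ℝ) 1, 0 ≤ t * x.1 := fun t ht => by
      rw [uIcc_of_le zero_le_one] at ht
      exact mul_nonneg ht.1 hx.1.1
    have c0 : ContinuousOn (fun t : ℝ => rad δ (t * x.1, x.2)) (uIcc 0 1) := by
      unfold rad
      fun_prop
    have c1 : ContinuousOn (fun t : ℝ => pt δ (t * x.1, x.2)) (uIcc 0 1) :=
      c0.smul continuousOn_const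
    have c2 : ContinuousOn (fun t : ℝ => pt' δ (t * x.1, x.2)) (uIcc 0 1) := by
      refine ContinuousOn.smul ((continuousOn_const.mul c0).inv₀ fun t ht => ?_) continuousOn_const
      have := hδ.trans_le (le_rad (x := (t * x.1, x.2)) hδ (hr t ht))
      exact mul_ne_zero two_ne_zero this.ne'
    have c3 : ContinuousOn (fun t : ℝ => imRad δ (t * x.1, x.2)) (uIcc 0 1) := by
      unfold imRad ex
      fun_prop
    have c4 : ContinuousOn (fun t : ℝ => im δ (t * x.1, x.2)) (uIcc 0 1) :=
      c3.smul (continuousOn_const (c := dir x))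
    have c5 : ContinuousOn (fun t : ℝ => im' δ (t * x.1, x.2)) (uIcc 0 1) := by
      refine ContinuousOn.smul ((continuousOn_const (c := ex x ^ 2)).mul
        ((continuousOn_const.mul c3).inv₀ fun t ht => ?_)) (continuousOn_const (c := dir x))
      have := hδ.trans_le (le_imRad (x := (t * x.1, x.2)) hδ (hr t ht))
      exact mul_ne_zero two_ne_zero this.ne'
    have c6 : ContinuousOn (fun t : ℝ => u (pt δ (t * x.1, x.2))) (uIcc 0 1) :=
      hu.diff.continuous.comp_continuousOn c1
    have c7 : Continuous (fderiv ℝ u) := by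
      refine (LipschitzWith.of_dist_le_mul (K := Real.toNNReal η) fun a b => ?_).continuous
      rw [dist_eq_norm, dist_eq_norm, Real.coe_toNNReal _ hu.nonneg]
      exact hu.lip_fderiv a b
    have c8 : ContinuousOn (fun t : ℝ => fderiv ℝ u (pt δ (t * x.1, x.2)) (pt' δ (t * x.1, x.2)))
        (uIcc 0 1) := (c7.comp_continuousOn c1).clm_apply c2
    exact (((c5.inner c6).add (c4.inner c8)).const_mul 2 |>.add ((c6.inner c8).const_mul 2))
  have := intervalIntegral.integral_eq_sub_of_hasDerivAt hd
    (continuousOn_const.mul hcont).intervalIntegrable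
  rw [intervalIntegral.integral_const_mul, one_mul, zero_mul, h0, sub_zero] at this
  exact this.symm

/-- The perturbed map after blowing down, in terms of `disp`. -/
theorem blowIn_pert (hδ : 0 < δ) (hx : 0 < x.1) (hx' : ‖x.2‖ = 1)
    (hq : 0 < ex x ^ 2 + quo δ u x) (hc : chg δ u x = x.1 * quo δ u x) :
    δ < ‖pert δ u x‖ ∧ ‖pert δ u x‖ ^ 2 = δ ^ 2 + x.1 * (ex x ^ 2 + quo δ u x) ∧
      blowIn δ (pert δ u x) = √x.1 • (hyp x.2 + disp δ u x) := by
  have hn : ‖pert δ u x‖ ^ 2 = δ ^ 2 + x.1 * (ex x ^ 2 + quo δ u x) := by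
    rw [norm_pert_sq hδ hx.le hx', hc]
    ring
  have hlt : δ < ‖pert δ u x‖ := by
    apply lt_of_pow_lt_pow_left₀ 2 (norm_nonneg _)
    rw [hn]
    have := mul_pos hx hq
    linarith
  refine ⟨hlt, hn, ?_⟩
  have hN : 0 < ‖pert δ u x‖ := hδ.trans hlt
  have he : 0 < ex x := lam_inv_pos.trans_le (ex_pos hx')
  have hI : 0 < imRad δ x := hδ.trans_le (le_imRad hδ hx.le)
  have hE : 0 < exP δ u x := Real.sqrt_pos.2 hq
  have hsub : √(‖pert δ u x‖ ^ 2 - δ ^ 2) = √x.1 * exP δ u x := by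
    rw [hn, add_sub_cancel_left, Real.sqrt_mul hx.le, exP]
  have hh : hyp x.2 = ex x • dir x := by
    rw [dir, smul_smul, mul_inv_cancel₀ he.ne', one_smul]
  -- `disp` is written with the differences `exP - ex` and `1 / imRad - 1 / ‖pert‖` rationalised, so
  -- that the small factors `quo` and `chg` are visible. Here and in `hr` the rationalisation is
  -- undone.
  have hk : quo δ u x * (exP δ u x + ex x)⁻¹ = exP δ u x - ex x := by
    have : exP δ u x ^ 2 = ex x ^ 2 + quo δ u x := Real.sq_sqrt hq.le
    rw [← div_eq_mul_inv, div_eq_iff (by positivity)]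
    linarith
  have hr : chg δ u x * (‖pert δ u x‖ * imRad δ x * (‖pert δ u x‖ + imRad δ x))⁻¹ =
      (imRad δ x)⁻¹ - ‖pert δ u x‖⁻¹ := by
    have h1 := imRad_sq (δ := δ) hx.le
    have h2 := norm_pert_sq (u := u) hδ hx.le hx'
    have h3 : chg δ u x = (‖pert δ u x‖ - imRad δ x) * (‖pert δ u x‖ + imRad δ x) := by
      linarith
    rw [h3]
    field_simp
  rw [blowIn, hsub, disp, hk, hr, hh, pert, im, div_eq_mul_inv]
  set N := ‖imRad δ x • dir x + u (pt δ x)‖⁻¹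
  rw [mul_assoc, ← smul_smul]
  congr 1
  have hI1 : (imRad δ x)⁻¹ * imRad δ x = 1 := inv_mul_cancel₀ hI.ne'
  have hI2 : exP δ u x * ((imRad δ x)⁻¹ - N) * imRad δ x =
      exP δ u x - exP δ u x * N * imRad δ x := by
    rw [mul_assoc, sub_mul, hI1]
    ring
  rw [smul_sub, smul_smul, smul_smul, smul_smul, smul_add, smul_smul, hI2]
  module

/-- This is where invariance of the circle enters: at `ρ = 0` the image has norm `δ` with and
without `u`. -/
theorem chg_zero {e : Plane} (hδ : 0 < δ) (he : ‖e‖ = 1)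
    (h : ‖(δ / ‖hyp e‖) • hyp e + u (δ • e)‖ = δ) : chg δ u (0, e) = 0 := by
  have h1 := norm_pert_sq (x := (0, e)) (u := u) hδ le_rfl he
  have h2 : pert δ u (0, e) = (δ / ‖hyp e‖) • hyp e + u (δ • e) := by
    simp only [pert, im, imRad, dir, ex, pt, rad, zero_mul, zero_add, Real.sqrt_sq hδ.le]
    rw [smul_smul, div_eq_mul_inv]
  rw [h2, h] at h1
  simp only [zero_mul, zero_add] at h1
  linarith

theorem pt_eq {x : Plane} : pt δ (‖x‖ ^ 2, ‖x‖⁻¹ • x) = blowOut δ x := by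
  rw [pt, rad, blowOut, smul_smul, div_eq_mul_inv]

theorem im_eq {x : Plane} (hx : x ≠ 0) : im δ (‖x‖ ^ 2, ‖x‖⁻¹ • x) = blowOut δ (hyp x) := by
  have hx' : 0 < ‖x‖ := norm_pos_iff.2 hx
  have he : ‖hyp (‖x‖⁻¹ • x)‖ = ‖x‖⁻¹ * ‖hyp x‖ := by
    rw [map_smul, norm_smul, norm_inv, norm_norm]
  have hy : 0 < ‖hyp x‖ := norm_pos_iff.2 (by simpa using hx)
  have hr : imRad δ (‖x‖ ^ 2, ‖x‖⁻¹ • x) = √(‖hyp x‖ ^ 2 + δ ^ 2) := by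
    rw [imRad, ex, he]
    congr 2
    field_simp
  rw [im, hr, dir, ex, he, blowOut, map_smul, smul_smul, smul_smul]
  congr 1
  field_simp

end Saddle

open Saddle in
/-- A `C²`-small perturbation of the blown-up saddle that preserves the exceptional circle becomes
Lipschitz-small after blowing down. -/
theorem blowDown_estimate {δ τ : ℝ} (hδ : 0 < δ) (hτ : 0 < τ) : ∃ C η₁ : ℝ, 0 < C ∧ 0 < η₁ ∧
    ∀ η u, η ≤ η₁ → SmallC2 η u →
      (∀ e, ‖e‖ = 1 → ‖(δ / ‖hyp e‖) • hyp e + u (δ • e)‖ = δ) →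
      (∀ x, x ≠ 0 → ‖x‖ ≤ τ → δ < ‖blowOut δ (hyp x) + u (blowOut δ x)‖ ∧
        ‖blowOut δ (hyp x) + u (blowOut δ x)‖ ^ 2 ≤ δ ^ 2 + (lam ^ 2 + 1) * τ ^ 2) ∧
      ∀ g : Plane → Plane, g 0 = 0 →
        (∀ x, x ≠ 0 → ‖x‖ ≤ τ → g x = blowIn δ (blowOut δ (hyp x) + u (blowOut δ x)) - hyp x) →
        ∀ x y, ‖x‖ ≤ τ → ‖y‖ ≤ τ → ‖g x - g y‖ ≤ C * η * ‖x - y‖ := by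
  -- Indexing by all pairs `(η, u)` at once makes the resulting constants independent of the
  -- perturbation.
  let ι := {q : ℝ × (Plane → Plane) // q.1 ≤ 1 ∧ SmallC2 q.1 q.2}
  obtain ⟨K, hK, HK⟩ := ubl_quo (ρ₀ := τ ^ 2) (ι := ι) (w := fun i => i.1.1) (v := fun i => i.1.2)
    hδ (fun i => i.2.1) (fun i => i.2.2)
  have lp := lam_inv_pos
  have ll : lam⁻¹ ≤ 1 := lam_inv_le.trans (by norm_num)
  -- The bound `1` absorbs terms quadratic in `u`, `δ / 2` keeps the perturbed image away from the
  -- centre, and the last bound makes `|quo|` at most half of the lower bound `lam⁻¹ ^ 2` for `ex ^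
  -- 2`.
  let η₁ : ℝ := min (min 1 (δ / 2)) ((lam⁻¹) ^ 2 / (2 * (K + 1)))
  have hη₁ : 0 < η₁ := by positivity
  have quo_le : ∀ η u, η ≤ η₁ → SmallC2 η u → ∀ x ∈ dom (τ ^ 2),
      |quo δ u x| ≤ (lam⁻¹) ^ 2 / 2 := by
    intro η u hη hu x hx
    have h1 : η ≤ 1 := hη.trans ((min_le_left _ _).trans (min_le_left _ _))
    have h2 := (HK ⟨(η, u), h1, hu⟩ x hx).1
    have h3 : η ≤ (lam⁻¹) ^ 2 / (2 * (K + 1)) := hη.trans (min_le_right _ _)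
    rw [le_div_iff₀ (by positivity)] at h3
    rw [Real.norm_eq_abs] at h2
    have := hu.nonneg
    refine h2.trans ?_
    change K * η ≤ _
    nlinarith
  let κ := {q : ℝ × (Plane → Plane) // q.1 ≤ η₁ ∧ SmallC2 q.1 q.2}
  obtain ⟨C, hC, HC⟩ := ubl_disp (ρ₀ := τ ^ 2) (ι := κ) (w := fun i => i.1.1) (v := fun i => i.1.2)
    hδ (fun i => i.2.1.trans ((min_le_left _ _).trans (min_le_left _ _)))
    (fun i => i.2.1.trans ((min_le_left _ _).trans (min_le_right _ _)))
    (fun i => i.2.2) (fun i x hx => by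
      have h1 := (abs_le.1 (quo_le i.1.1 i.1.2 i.2.1 i.2.2 x hx)).1
      have h2 := pow_le_pow_left₀ lp.le (ex_pos (norm_dom hx)) 2
      linarith)
  refine ⟨(2 * τ ^ 2 + 3) * C + 1, η₁, by positivity, hη₁, fun η u hη hu hcirc => ?_⟩
  have mem : ∀ x : Plane, x ≠ 0 → ‖x‖ ≤ τ → (‖x‖ ^ 2, ‖x‖⁻¹ • x) ∈ dom (τ ^ 2) := by
    intro x hx hxτ
    refine ⟨⟨by positivity, pow_le_pow_left₀ (norm_nonneg x) hxτ 2⟩, ?_⟩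
    rw [mem_sphere_zero_iff_norm, norm_smul, norm_inv, norm_norm,
      inv_mul_cancel₀ (norm_ne_zero_iff.2 hx)]
  have key : ∀ x : Plane, x ≠ 0 → ‖x‖ ≤ τ →
      δ < ‖blowOut δ (hyp x) + u (blowOut δ x)‖ ∧
      ‖blowOut δ (hyp x) + u (blowOut δ x)‖ ^ 2 ≤ δ ^ 2 + (lam ^ 2 + 1) * τ ^ 2 ∧
      blowIn δ (blowOut δ (hyp x) + u (blowOut δ x)) - hyp x =
        ‖x‖ • disp δ u (‖x‖ ^ 2, ‖x‖⁻¹ • x) := by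
    intro x hx hxτ
    have hm := mem x hx hxτ
    have hx' : 0 < ‖x‖ := norm_pos_iff.2 hx
    have hq := abs_le.1 (quo_le η u hη hu _ hm)
    have he := pow_le_pow_left₀ lp.le (ex_pos (norm_dom hm)) 2
    have hpos : 0 < ex (‖x‖ ^ 2, ‖x‖⁻¹ • x) ^ 2 + quo δ u (‖x‖ ^ 2, ‖x‖⁻¹ • x) := by
      have : 0 < lam⁻¹ ^ 2 := by positivity
      linarith
    have h0 := chg_zero hδ (norm_dom hm) (hcirc _ (norm_dom hm))
    have hc := chg_eq hδ hu hm h0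
    obtain ⟨b1, b2, b3⟩ := blowIn_pert hδ (x := (‖x‖ ^ 2, ‖x‖⁻¹ • x)) (by positivity)
      (norm_dom hm) hpos hc
    rw [pert, pt_eq, im_eq hx] at b1 b2 b3
    refine ⟨b1, ?_, ?_⟩
    · rw [b2]
      have e1 := pow_le_pow_left₀ (lp.le.trans (ex_pos (norm_dom hm))) (ex_le (norm_dom hm)) 2
      have e2 : lam⁻¹ ^ 2 ≤ 1 := pow_le_one₀ lp.le ll
      have e3 : ‖x‖ ^ 2 ≤ τ ^ 2 := by gcongr
      have : ex (‖x‖ ^ 2, ‖x‖⁻¹ • x) ^ 2 + quo δ u (‖x‖ ^ 2, ‖x‖⁻¹ • x) ≤ lam ^ 2 + 1 := by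
        linarith
      have := mul_le_mul e3 this hpos.le (by positivity)
      dsimp only
      linarith
    · rw [b3]
      dsimp only
      rw [Real.sqrt_sq hx'.le, smul_add, map_smul, smul_smul, mul_inv_cancel₀ hx'.ne', one_smul,
        add_sub_cancel_left]
  refine ⟨fun x hx hxτ => ⟨(key x hx hxτ).1, (key x hx hxτ).2.1⟩, fun g hg0 hg x y hx hy => ?_⟩
  have hη0 := hu.nonneg
  have := lipschitz_of_polar hτ.le (mul_nonneg hC hη0) (m := disp δ u)
    (HC ⟨(η, u), hη, hu⟩) hg0 (fun x hx hxτ => (hg x hx hxτ).trans (key x hx hxτ).2.2) x y hx hy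
  refine this.trans ?_
  have h1 : 0 ≤ η * ‖x - y‖ := by positivity
  linarith

end BlowUp

namespace BlowUp

/-! ### The covering of the torus -/

/-- The lattice `ℤ²`. -/
def intLattice : AddSubgroup Plane where
  carrier := {z | ∀ i, ∃ n : ℤ, z i = n}
  add_mem' := fun {a b} ha hb i => by
    obtain ⟨m, hm⟩ := ha i
    obtain ⟨n, hn⟩ := hb i
    exact ⟨m + n, by simp [hm, hn]⟩
  zero_mem' := fun i => ⟨0, by simp⟩
  neg_mem' := fun {a} ha i => by
    obtain ⟨m, hm⟩ := ha i
    exact ⟨-m, by simp [hm]⟩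

theorem mem_intLattice {z : Plane} : z ∈ intLattice ↔ ∀ i, ∃ n : ℤ, z i = n := Iff.rfl

theorem proj_eq_proj_iff {z z' : Plane} : proj z = proj z' ↔ z - z' ∈ intLattice := by
  rw [mem_intLattice]
  have h : ∀ i, (proj z i = proj z' i ↔ ∃ n : ℤ, (z - z') i = n) := fun i => by
    change (z i : UnitAddCircle) = z' i ↔ _
    rw [← sub_eq_zero, ← AddCircle.coe_sub, AddCircle.coe_eq_zero_iff]
    exact exists_congr fun n => by simp [eq_comm]
  exact funext_iff.trans (forall_congr' h)

theorem proj_add (z z' : Plane) : proj (z + z') = proj z + proj z' := by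
  funext i
  simp [proj]

theorem continuous_proj : Continuous proj := by
  refine continuous_pi fun i => ?_
  exact (AddCircle.continuous_mk' 1).comp (by fun_prop)

theorem proj_surjective : Function.Surjective proj := by
  intro p
  choose f hf using fun i => QuotientAddGroup.mk_surjective (p i)
  exact ⟨WithLp.toLp 2 f, funext hf⟩

theorem isOpenMap_proj : IsOpenMap proj := by
  have h1 : IsOpenMap (fun (f : Fin 2 → ℝ) i => (f i : UnitAddCircle)) :=
    IsOpenMap.piMap (fun i => QuotientAddGroup.isOpenMap_coe) (by simp)
  exact h1.comp (PiLp.homeomorph 2 _).isOpenMap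

theorem torusA_proj (z : Plane) : torusA (proj z) = proj (planeA z) := by
  funext i
  fin_cases i <;> simp [torusA, proj, planeA, ← AddCircle.coe_nsmul]

namespace Data

variable (D : Data)

/-- The covering map of the torus in the linear coordinates. -/
def cov (w : Plane) : Torus := proj (D.P.symm w)

/-- The lattice of deck transformations in the linear coordinates. -/
def L : AddSubgroup Plane := intLattice.comap (D.P.symm : Plane →+ Plane)

/-- The lattice formed by all lifts of the points `Ωᵢ`. -/
def Lam : AddSubgroup Plane := D.L.comap (nsmulAddMonoidHom 2)

theorem mem_L {w : Plane} : w ∈ D.L ↔ ∀ i, ∃ n : ℤ, D.P.symm w i = n := Iff.rfl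

theorem mem_Lam {w : Plane} : w ∈ D.Lam ↔ ∀ i, ∃ n : ℤ, 2 * D.P.symm w i = n := by
  change (∀ i, ∃ n : ℤ, D.P.symm (2 • w) i = n) ↔ _
  simp [map_nsmul]

theorem L_le_Lam : D.L ≤ D.Lam := fun _ hw => D.L.nsmul_mem hw 2

theorem cov_eq_iff {w w' : Plane} : D.cov w = D.cov w' ↔ w - w' ∈ D.L := by
  rw [cov, cov, proj_eq_proj_iff, ← map_sub]
  rfl

theorem cov_add (w w' : Plane) : D.cov (w + w') = D.cov w + D.cov w' := by
  rw [cov, map_add, proj_add]; rfl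

theorem continuous_cov : Continuous D.cov := continuous_proj.comp D.P.symm.continuous

theorem cov_surjective : Function.Surjective D.cov :=
  proj_surjective.comp D.P.symm.surjective

theorem isOpenMap_cov : IsOpenMap D.cov :=
  isOpenMap_proj.comp D.P.symm.toHomeomorph.isOpenMap

theorem chartAt_eq (i : Fin 4) (w : Plane) : chartAt D.P i w = D.cov (D.P (center i) + w) := by
  rw [chartAt, cov, map_add, ContinuousLinearEquiv.symm_apply_apply]

theorem center_mem (i : Fin 4) : D.P (center i) ∈ D.Lam := by
  rw [mem_Lam]
  intro j
  rw [ContinuousLinearEquiv.symm_apply_apply]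
  fin_cases i <;> fin_cases j <;>
    first | (refine ⟨0, ?_⟩; simp [center]; done) | (refine ⟨1, ?_⟩; simp [center])

/-- The parities of the two doubled coordinates decide which of the four centres occurs. -/
theorem exists_center {c : Plane} (hc : c ∈ D.Lam) : ∃ i, ∃ l ∈ D.L, c = D.P (center i) + l := by
  rw [mem_Lam] at hc
  suffices h : ∃ i, D.P.symm c - center i ∈ intLattice by
    obtain ⟨i, hi⟩ := h
    refine ⟨i, c - D.P (center i), ?_, by abel⟩
    change D.P.symm (c - D.P (center i)) ∈ intLattice
    rwa [map_sub, ContinuousLinearEquiv.symm_apply_apply]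
  obtain ⟨a, ha⟩ := hc 0
  obtain ⟨b, hb⟩ := hc 1
  have key : ∀ (s : ℝ) (n : ℤ), 2 * s = n → (Even n → ∃ k : ℤ, s - 0 = k) ∧
      (Odd n → ∃ k : ℤ, s - 1 / 2 = k) := by
    intro s n h
    constructor
    · rintro ⟨k, rfl⟩
      exact ⟨k, by push_cast at h; linarith⟩
    · rintro ⟨k, rfl⟩
      exact ⟨k, by push_cast at h; linarith⟩
  have k0 := key _ a ha
  have k1 := key _ b hb
  rcases Int.even_or_odd a with ea | oa <;> rcases Int.even_or_odd b with eb | ob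
  · exact ⟨0, fun j => by fin_cases j; exacts [k0.1 ea, k1.1 eb]⟩
  · exact ⟨3, fun j => by fin_cases j; exacts [k0.1 ea, k1.2 ob]⟩
  · exact ⟨2, fun j => by fin_cases j; exacts [k0.2 oa, k1.1 eb]⟩
  · exact ⟨1, fun j => by fin_cases j; exacts [k0.2 oa, k1.2 ob]⟩

theorem P_planeA' (z : Plane) : D.P (planeA z) = hyp (D.P z) := by
  rw [D.P_planeA, exp_neg_sigma]
  rfl

theorem torusA_cov (w : Plane) : torusA (D.cov w) = D.cov (hyp w) := by
  rw [cov, torusA_proj, cov]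
  congr 1
  apply D.P.injective
  rw [P_planeA', ContinuousLinearEquiv.apply_symm_apply, ContinuousLinearEquiv.apply_symm_apply]

theorem symm_hyp (w : Plane) : D.P.symm (hyp w) = planeA (D.P.symm w) := by
  apply D.P.injective
  rw [P_planeA', ContinuousLinearEquiv.apply_symm_apply, ContinuousLinearEquiv.apply_symm_apply]

/-- The inverse matrix is integral since `13 · 5 - 8² = 1`; this gives invariance of the lattices
under `hyp.symm`. -/
theorem symm_hyp_symm (w : Plane) : D.P.symm (hyp.symm w) =
    !₂[5 * D.P.symm w 0 - 8 * D.P.symm w 1, 13 * D.P.symm w 1 - 8 * D.P.symm w 0] := by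
  have h := D.symm_hyp (hyp.symm w)
  rw [ContinuousLinearEquiv.apply_symm_apply] at h
  rw [h]
  apply plane_ext <;> simp [planeA] <;> ring

theorem hyp_mem_L {w : Plane} (hw : w ∈ D.L) : hyp w ∈ D.L := by
  rw [mem_L] at hw ⊢
  obtain ⟨a, ha⟩ := hw 0
  obtain ⟨b, hb⟩ := hw 1
  intro i
  rw [symm_hyp]
  fin_cases i
  · exact ⟨13 * a + 8 * b, by simp [planeA, ha, hb]⟩
  · exact ⟨8 * a + 5 * b, by simp [planeA, ha, hb]⟩

theorem hyp_symm_mem_L {w : Plane} (hw : w ∈ D.L) : hyp.symm w ∈ D.L := by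
  rw [mem_L] at hw ⊢
  obtain ⟨a, ha⟩ := hw 0
  obtain ⟨b, hb⟩ := hw 1
  intro i
  rw [symm_hyp_symm]
  fin_cases i
  · exact ⟨5 * a - 8 * b, by simp [ha, hb]⟩
  · exact ⟨13 * b - 8 * a, by simp [ha, hb]⟩

theorem hyp_mem_Lam {w : Plane} (hw : w ∈ D.Lam) : hyp w ∈ D.Lam := by
  have : hyp (2 • w) ∈ D.L := D.hyp_mem_L hw
  rwa [map_nsmul] at this

theorem hyp_symm_mem_Lam {w : Plane} (hw : w ∈ D.Lam) : hyp.symm w ∈ D.Lam := by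
  have : hyp.symm (2 • w) ∈ D.L := D.hyp_symm_mem_L hw
  rwa [map_nsmul] at this

theorem hyp_mem_Lam_iff {w : Plane} : hyp w ∈ D.Lam ↔ w ∈ D.Lam :=
  ⟨fun h => by simpa using D.hyp_symm_mem_Lam h, D.hyp_mem_Lam⟩

theorem ε_pos : 0 < D.ε := D.δ_pos.trans D.δ_lt

/-- The two points lie over different centres. Were they within `2ε`, their midpoint would project
into both discs. -/
theorem sep_of_not_mem_L {c c' : Plane} (hc : c ∈ D.Lam) (hc' : c' ∈ D.Lam) (h : c - c' ∉ D.L) :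
    2 * D.ε < ‖c - c'‖ := by
  by_contra hle
  rw [not_lt] at hle
  obtain ⟨i, l, hl, rfl⟩ := D.exists_center hc
  obtain ⟨j, l', hl', rfl⟩ := D.exists_center hc'
  have hij : i ≠ j := by
    rintro rfl
    apply h
    rw [add_sub_add_left_eq_sub]
    exact D.L.sub_mem hl hl'
  set c := D.P (center i) + l with hcdef
  set c' := D.P (center j) + l' with hcdef'
  set m := (1 / 2 : ℝ) • (c' - c) with hm
  have hmn : ‖m‖ ≤ D.ε := by
    rw [hm, norm_smul, norm_sub_rev]
    norm_num
    linarith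
  have hdisj := Set.disjoint_left.1 (D.disjoint_discs i j hij)
  refine @hdisj (D.cov (c + m)) ?_ ?_
  · refine ⟨m, by simpa using hmn, ?_⟩
    rw [chartAt_eq, cov_eq_iff, hcdef]
    have : D.P (center i) + m - (D.P (center i) + l + m) = -l := by abel
    rw [this]
    exact D.L.neg_mem hl
  · refine ⟨-m, by simpa using hmn, ?_⟩
    rw [chartAt_eq, cov_eq_iff]
    have e : c + m = c' - m := by rw [hm]; module
    have : D.P (center j) + -m - (c + m) = -l' := by rw [e, hcdef']; abel
    rw [this]
    exact D.L.neg_mem hl'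

/-- Distinct lifts of the points `Ωᵢ` are more than `2ε` apart. -/
theorem sep {c c' : Plane} (hc : c ∈ D.Lam) (hc' : c' ∈ D.Lam) (h : c ≠ c') :
    2 * D.ε < ‖c - c'‖ := by
  by_cases hL : c - c' ∈ D.L
  swap
  · exact D.sep_of_not_mem_L hc hc' hL
  by_contra hle
  rw [not_lt] at hle
  set v := c - c'
  have hε := D.ε_pos
  -- Two lifts of the same centre are handled by halving. If `v ∈ D.L` has norm at most `2ε`, then
  -- `v / 2` lies in `D.Lam` that close to `0`, so the previous case puts it in `D.L` again.
  -- Iterating contradicts discreteness unless `v = 0`. Thus disjointness of the discs already makes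
  -- each chart injective.
  have hpow : ∀ n : ℕ, ((1 / 2 : ℝ) ^ n) • v ∈ D.L := by
    intro n
    induction n with
    | zero => simpa using hL
    | succ n ih =>
      by_contra hn
      have hmem : ((1 / 2 : ℝ) ^ (n + 1)) • v ∈ D.Lam := by
        change 2 • (((1 / 2 : ℝ) ^ (n + 1)) • v) ∈ D.L
        convert ih using 1
        rw [pow_succ]
        module
      have h1 := D.sep_of_not_mem_L hmem D.Lam.zero_mem (by rwa [sub_zero])
      rw [sub_zero, norm_smul, Real.norm_eq_abs, abs_of_pos (by positivity)] at h1
      have h2 : (1 / 2 : ℝ) ^ (n + 1) ≤ 1 := pow_le_one₀ (by norm_num) (by norm_num)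
      nlinarith [norm_nonneg v]
  have hz : D.P.symm v = 0 := by
    ext i
    by_contra hi
    have hi : D.P.symm v i ≠ 0 := hi
    have lim : Tendsto (fun n : ℕ => (1 / 2 : ℝ) ^ n * |D.P.symm v i|) atTop (𝓝 0) := by
      simpa using (tendsto_pow_atTop_nhds_zero_of_lt_one (r := (1 / 2 : ℝ)) (by norm_num)
        (by norm_num)).mul_const |D.P.symm v i|
    obtain ⟨n, hn⟩ := (lim.eventually (gt_mem_nhds one_pos)).exists
    obtain ⟨k, hk⟩ := (D.mem_L.1 (hpow n)) i
    rw [map_smul] at hk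
    have hk' : (1 / 2 : ℝ) ^ n * D.P.symm v i = k := hk
    have h1 : |(k : ℝ)| < 1 := by
      rw [← hk', abs_mul, abs_of_pos (by positivity)]
      exact hn
    have h2 : k = 0 := by
      rw [← Int.abs_lt_one_iff]
      exact_mod_cast h1
    rw [h2, Int.cast_zero] at hk'
    rcases mul_eq_zero.1 hk' with h3 | h3
    · exact absurd h3 (by positivity)
    · exact hi h3
  have : v = 0 := by simpa using hz
  exact h (sub_eq_zero.1 this)

theorem eq_of_near {c c' : Plane} (hc : c ∈ D.Lam) (hc' : c' ∈ D.Lam) (h : ‖c - c'‖ ≤ 2 * D.ε) :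
    c = c' := by
  by_contra hne
  linarith [D.sep hc hc' hne]

theorem cov_inj_of_near {w w' : Plane} (h : D.cov w = D.cov w') (hn : ‖w - w'‖ ≤ 2 * D.ε) :
    w = w' := by
  have := D.eq_of_near (D.L_le_Lam (D.cov_eq_iff.1 h)) D.Lam.zero_mem (by simpa using hn)
  exact sub_eq_zero.1 this

/-! ### Lifts of the surgery maps -/

open Classical in
/-- The lift of `surgery χ` in the linear coordinates. -/
def lift (χ : ℝ → ℝ) (w : Plane) : Plane :=
  if h : ∃ c ∈ D.Lam, ‖w - c‖ ≤ D.ε then h.choose + radial χ (w - h.choose) else w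

variable {D} {χ : ℝ → ℝ}

/-- Two centres within `ε` of `w` are within `2ε` of each other, hence equal, so the choice in
`lift` is forced. -/
theorem lift_of_mem {w c : Plane} (hc : c ∈ D.Lam) (h : ‖w - c‖ ≤ D.ε) :
    D.lift χ w = c + radial χ (w - c) := by
  have hex : ∃ c ∈ D.Lam, ‖w - c‖ ≤ D.ε := ⟨c, hc, h⟩
  have e : hex.choose = c := by
    apply D.eq_of_near hex.choose_spec.1 hc
    have h1 := hex.choose_spec.2
    calc _ = ‖(w - c) - (w - hex.choose)‖ := by congr 1; abel
      _ ≤ _ := (norm_sub_le _ _).trans (by linarith)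
  rw [lift, dif_pos hex, e]

theorem lift_of_far {w : Plane} (h : ∀ c ∈ D.Lam, D.ε < ‖w - c‖) : D.lift χ w = w := by
  rw [lift, dif_neg]
  rintro ⟨c, hc, hle⟩
  linarith [h c hc]

theorem lift_add {w l : Plane} (hl : l ∈ D.Lam) : D.lift χ (w + l) = D.lift χ w + l := by
  by_cases h : ∃ c ∈ D.Lam, ‖w - c‖ ≤ D.ε
  · obtain ⟨c, hc, hle⟩ := h
    rw [lift_of_mem hc hle, lift_of_mem (D.Lam.add_mem hc hl) (by rwa [add_sub_add_right_eq_sub]),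
      add_sub_add_right_eq_sub]
    abel
  · push Not at h
    rw [lift_of_far h, lift_of_far]
    intro c hc
    have := h _ (D.Lam.sub_mem hc hl)
    rwa [sub_sub_eq_add_sub] at this

/-- Whatever disc and coordinate `q.2` are chosen in `surgery`, `w - q.2` is a lattice point within
`ε` of `w`, so it is the centre that `lift` uses. -/
theorem surgery_cov (w : Plane) : D.surgery χ (D.cov w) = D.cov (D.lift χ w) := by
  unfold surgery
  split_ifs with h
  · obtain ⟨h1, h2⟩ := h.choose_spec
    set q := h.choose
    rw [chartAt_eq, cov_eq_iff] at h2
    have hc : w - q.2 ∈ D.Lam := by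
      have : w - q.2 = D.P (center q.1) - (D.P (center q.1) + q.2 - w) := by abel
      rw [this]
      exact D.Lam.sub_mem (D.center_mem _) (D.L_le_Lam h2)
    have e : w - (w - q.2) = q.2 := by abel
    rw [lift_of_mem hc (by rwa [e]), e, chartAt_eq, cov_eq_iff]
    convert h2 using 1
    abel
  · rw [lift_of_far]
    intro c hc
    by_contra hle
    rw [not_lt] at hle
    obtain ⟨i, l, hl, rfl⟩ := D.exists_center hc
    refine h ⟨(i, w - (D.P (center i) + l)), hle, ?_⟩
    rw [chartAt_eq, cov_eq_iff]
    dsimp only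
    have : D.P (center i) + (w - (D.P (center i) + l)) - w = -l := by abel
    rw [this]
    exact D.L.neg_mem hl

variable (D) in
/-- The preimage of the island in the linear coordinates. -/
def isl : Set Plane := {w | ∀ c ∈ D.Lam, D.δ < ‖w - c‖}

theorem cov_mem_island {w : Plane} : D.cov w ∈ D.island ↔ w ∈ D.isl := by
  have key : D.cov w ∈ D.island ↔ ¬ ∃ q : Fin 4 × Plane, ‖q.2‖ ≤ D.δ ∧
      chartAt D.P q.1 q.2 = D.cov w := by
    simp [island, V]
  rw [key, not_iff_comm]
  constructor
  · intro h
    simp only [isl, mem_ofPred_eq, not_forall, not_lt] at h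
    obtain ⟨c, hc, hle⟩ := h
    obtain ⟨i, l, hl, rfl⟩ := D.exists_center hc
    refine ⟨(i, w - (D.P (center i) + l)), hle, ?_⟩
    rw [chartAt_eq, cov_eq_iff]
    dsimp only
    have : D.P (center i) + (w - (D.P (center i) + l)) - w = -l := by abel
    rw [this]
    exact D.L.neg_mem hl
  · rintro ⟨q, h1, h2⟩ hw
    rw [chartAt_eq, cov_eq_iff] at h2
    have := hw (w - q.2) (by
      have : w - q.2 = D.P (center q.1) - (D.P (center q.1) + q.2 - w) := by abel
      rw [this]
      exact D.Lam.sub_mem (D.center_mem _) (D.L_le_Lam h2))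
    rw [sub_sub_cancel] at this
    linarith

theorem hatF_cov {w : Plane} (hw : w ∈ D.isl) :
    D.hatF (D.cov w) = D.cov (D.lift D.ψinv (hyp (D.lift D.ψ w))) := by
  have h := cov_mem_island.2 hw
  rw [hatF, dif_neg, Psi, PsiInv, surgery_cov, torusA_cov, surgery_cov]
  simpa [island, V] using h

end Data

end BlowUp

namespace BlowUp

namespace Data

variable {D : Data} {χ : ℝ → ℝ}

/-! ### The radial diffeomorphisms -/

theorem half_mem {a b s : ℝ} (h1 : a ^ 2 ≤ s) (h2 : s ≤ b ^ 2) :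
    s / 2 ∈ Icc (a ^ 2 / 2) (b ^ 2 / 2) := ⟨by linarith, by linarith⟩

theorem sq_lt : D.δ ^ 2 < D.ε ^ 2 := by
  have := D.δ_pos
  have := D.δ_lt
  gcongr

variable (D) in
theorem ψ_left : D.ψ (D.δ ^ 2 / 2) = 0 := by
  have := D.ψ_inner.self_of_nhdsWithin (mem_Ici.2 le_rfl)
  simpa using this

theorem ψ_pos {ρ : ℝ} (h : ρ ∈ Ioc (D.δ ^ 2 / 2) (D.ε ^ 2 / 2)) : 0 < D.ψ ρ := by
  have h' : ρ ∈ Icc (D.δ ^ 2 / 2) (D.ε ^ 2 / 2) := Ioc_subset_Icc_self h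
  refine lt_of_le_of_ne (D.ψ_bij.mapsTo h').1 fun h0 => ?_
  have h1 : D.δ ^ 2 / 2 ∈ Icc (D.δ ^ 2 / 2) (D.ε ^ 2 / 2) := ⟨le_rfl, h'.1.trans h'.2⟩
  have := D.ψ_bij.injOn h1 h' (by rw [← h0, D.ψ_left])
  exact h.1.ne this

theorem ψinv_mem {y : ℝ} (h : y ∈ Icc 0 (D.ε ^ 2 / 2)) :
    D.ψinv y ∈ Icc (D.δ ^ 2 / 2) (D.ε ^ 2 / 2) := by
  obtain ⟨ρ, hρ, rfl⟩ := D.ψ_bij.surjOn h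
  rwa [D.ψinv_inv.1 hρ]

theorem ψinv_gt {y : ℝ} (h : y ∈ Ioc 0 (D.ε ^ 2 / 2)) : D.δ ^ 2 / 2 < D.ψinv y := by
  have h' : y ∈ Icc 0 (D.ε ^ 2 / 2) := Ioc_subset_Icc_self h
  refine lt_of_le_of_ne (ψinv_mem h').1 fun h0 => ?_
  have := D.ψinv_inv.2 h'
  rw [← h0, D.ψ_left] at this
  exact h.1.ne this

-- Near the circle the profile is a pure shift, so in the squared radius `s` the surgeries are `s ↦
-- s - δ²` and its inverse, that is, `blowIn` and `blowOut`.
variable (D) in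
theorem exists_inner : ∃ s₁ : ℝ, 0 < s₁ ∧ D.δ ^ 2 + s₁ < D.ε ^ 2 ∧
    (∀ s, D.δ ^ 2 ≤ s → s ≤ D.δ ^ 2 + s₁ → 2 * D.ψ (s / 2) = s - D.δ ^ 2) ∧
    ∀ s, 0 ≤ s → s ≤ s₁ → 2 * D.ψinv (s / 2) = s + D.δ ^ 2 := by
  have h := D.ψ_inner
  rw [eventually_nhdsWithin_iff, Metric.eventually_nhds_iff] at h
  obtain ⟨d, hd, H⟩ := h
  have hlt := D.sq_lt
  let s₁ := min d ((D.ε ^ 2 - D.δ ^ 2) / 2)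
  have hs₁ : 0 < s₁ := lt_min hd (by linarith)
  have hs₁d : s₁ ≤ d := min_le_left _ _
  have hs₁ε : s₁ ≤ (D.ε ^ 2 - D.δ ^ 2) / 2 := min_le_right _ _
  have key : ∀ s, D.δ ^ 2 ≤ s → s ≤ D.δ ^ 2 + s₁ → D.ψ (s / 2) = (s - D.δ ^ 2) / 2 := by
    intro s h1 h2
    have := H (y := s / 2) (by
      rw [Real.dist_eq, abs_of_nonneg (by linarith)]
      linarith) (mem_Ici.2 (by linarith))
    rw [this]
    ring
  refine ⟨s₁, hs₁, by linarith, fun s h1 h2 => by rw [key s h1 h2]; ring, fun s h1 h2 => ?_⟩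
  have h3 := key (s + D.δ ^ 2) (by linarith) (by linarith)
  rw [add_sub_cancel_right] at h3
  rw [← h3, D.ψinv_inv.1 (half_mem (by linarith) (by linarith))]
  ring

-- The collar below the radius `ε` on which both profiles are the identity makes the surgery glue
-- smoothly to the identity outside.
variable (D) in
theorem exists_outer : ∃ ε₁ : ℝ, D.δ < ε₁ ∧ ε₁ < D.ε ∧
    (∀ s, ε₁ ^ 2 ≤ s → s ≤ D.ε ^ 2 → 2 * D.ψ (s / 2) = s) ∧
    ∀ s, ε₁ ^ 2 ≤ s → s ≤ D.ε ^ 2 → 2 * D.ψinv (s / 2) = s := by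
  have h := D.ψ_outer
  rw [eventually_nhdsWithin_iff, Metric.eventually_nhds_iff] at h
  obtain ⟨d, hd, H⟩ := h
  have hlt := D.sq_lt
  have hδ := D.δ_pos
  have hε := D.ε_pos
  let q := max (D.ε ^ 2 - d) ((D.ε ^ 2 + D.δ ^ 2) / 2)
  have hq1 : D.ε ^ 2 - d ≤ q := le_max_left _ _
  have hq2 : D.δ ^ 2 < q := lt_of_lt_of_le (by linarith) (le_max_right _ _)
  have hq3 : q < D.ε ^ 2 := max_lt (by linarith) (by linarith)
  have hq0 : 0 ≤ q := (sq_nonneg _).trans hq2.le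
  have hsq : √q ^ 2 = q := Real.sq_sqrt hq0
  have key : ∀ s, √q ^ 2 ≤ s → s ≤ D.ε ^ 2 → D.ψ (s / 2) = s / 2 := by
    intro s h1 h2
    rw [hsq] at h1
    refine H (y := s / 2) ?_ (mem_Iic.2 (by linarith))
    rw [Real.dist_eq, abs_sub_comm, abs_of_nonneg (by linarith)]
    linarith
  refine ⟨√q, (Real.lt_sqrt hδ.le).2 hq2, (Real.sqrt_lt' hε).2 hq3, fun s h1 h2 => ?_,
    fun s h1 h2 => ?_⟩
  · rw [key s h1 h2]
    ring
  · have h3 := D.ψinv_inv.1 (half_mem (hq2.le.trans (hsq ▸ h1)) h2)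
    rw [key s h1 h2] at h3
    rw [h3]
    ring

theorem norm_radial {w : Plane} (hw : w ≠ 0) : ‖radial χ w‖ = √(2 * χ (‖w‖ ^ 2 / 2)) := by
  have : 0 < ‖w‖ := norm_pos_iff.2 hw
  rw [radial, norm_smul, norm_div, norm_norm, div_mul_cancel₀ _ this.ne', Real.norm_eq_abs,
    abs_of_nonneg (Real.sqrt_nonneg _)]

theorem radial_zero : radial χ 0 = 0 := by simp [radial]

theorem radial_eq_self {w : Plane} (h : 2 * χ (‖w‖ ^ 2 / 2) = ‖w‖ ^ 2) : radial χ w = w := by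
  by_cases hw : w = 0
  · rw [hw, radial_zero]
  · rw [radial, h, Real.sqrt_sq (norm_nonneg _), div_self (norm_ne_zero_iff.2 hw), one_smul]

theorem radial_radial {χ' : ℝ → ℝ} {w : Plane} (hw : w ≠ 0) (hpos : 0 < χ (‖w‖ ^ 2 / 2))
    (h : χ' (χ (‖w‖ ^ 2 / 2)) = ‖w‖ ^ 2 / 2) : radial χ' (radial χ w) = w := by
  have hn := norm_radial (χ := χ) hw
  have hw' : 0 < ‖w‖ := norm_pos_iff.2 hw
  have hs : 0 < √(2 * χ (‖w‖ ^ 2 / 2)) := Real.sqrt_pos.2 (by linarith)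
  rw [radial, hn, Real.sq_sqrt (by linarith), mul_div_cancel_left₀ _ two_ne_zero, h,
    mul_div_cancel₀ _ two_ne_zero, Real.sqrt_sq hw'.le, radial, smul_smul,
    div_mul_div_cancel₀ hs.ne', div_self hw'.ne', one_smul]

theorem radial_ψ_norm {w : Plane} (h1 : D.δ < ‖w‖) (h2 : ‖w‖ ≤ D.ε) :
    0 < ‖radial D.ψ w‖ ∧ ‖radial D.ψ w‖ ≤ D.ε := by
  have hw : w ≠ 0 := norm_pos_iff.1 (D.δ_pos.trans h1)
  have hδ := D.δ_pos
  have m : ‖w‖ ^ 2 / 2 ∈ Ioc (D.δ ^ 2 / 2) (D.ε ^ 2 / 2) :=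
    ⟨by gcongr, by gcongr⟩
  rw [norm_radial hw]
  have hp := ψ_pos m
  have hle := (D.ψ_bij.mapsTo (Ioc_subset_Icc_self m)).2
  exact ⟨Real.sqrt_pos.2 (by linarith), (Real.sqrt_le_left D.ε_pos.le).2 (by linarith)⟩

theorem radial_ψinv_norm {w : Plane} (h1 : w ≠ 0) (h2 : ‖w‖ ≤ D.ε) :
    D.δ < ‖radial D.ψinv w‖ ∧ ‖radial D.ψinv w‖ ≤ D.ε := by
  have hw : 0 < ‖w‖ := norm_pos_iff.2 h1
  have m : ‖w‖ ^ 2 / 2 ∈ Ioc 0 (D.ε ^ 2 / 2) := ⟨by positivity, by gcongr⟩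
  rw [norm_radial h1]
  have hp := ψinv_gt m
  have hle := (ψinv_mem (Ioc_subset_Icc_self m)).2
  exact ⟨(Real.lt_sqrt D.δ_pos.le).2 (by linarith), (Real.sqrt_le_left D.ε_pos.le).2 (by linarith)⟩

theorem radial_ψinv_ψ {w : Plane} (h1 : D.δ < ‖w‖) (h2 : ‖w‖ ≤ D.ε) :
    radial D.ψinv (radial D.ψ w) = w := by
  have hδ := D.δ_pos
  have m : ‖w‖ ^ 2 / 2 ∈ Ioc (D.δ ^ 2 / 2) (D.ε ^ 2 / 2) := ⟨by gcongr, by gcongr⟩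
  exact radial_radial (norm_pos_iff.1 (D.δ_pos.trans h1)) (ψ_pos m)
    (D.ψinv_inv.1 (Ioc_subset_Icc_self m))

theorem radial_ψ_ψinv {w : Plane} (h1 : w ≠ 0) (h2 : ‖w‖ ≤ D.ε) :
    radial D.ψ (radial D.ψinv w) = w := by
  have hw : 0 < ‖w‖ := norm_pos_iff.2 h1
  have m : ‖w‖ ^ 2 / 2 ∈ Ioc 0 (D.ε ^ 2 / 2) := ⟨by positivity, by gcongr⟩
  exact radial_radial h1 (lt_of_le_of_lt (by positivity) (ψinv_gt m))
    (D.ψinv_inv.2 (Ioc_subset_Icc_self m))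

variable (D) in
/-- The lift of `Ψ`. -/
abbrev down : Plane → Plane := D.lift D.ψ

variable (D) in
/-- The lift of `Ψ⁻¹`. -/
abbrev up : Plane → Plane := D.lift D.ψinv

theorem not_mem_Lam_of_near {x c : Plane} (hc : c ∈ D.Lam) (h : ‖x - c‖ ≤ D.ε) (hx : x ≠ c) :
    x ∉ D.Lam := fun hx' => hx (D.eq_of_near hx' hc (by linarith [D.ε_pos]))

theorem mem_isl_of_near {x c : Plane} (hc : c ∈ D.Lam) (h : ‖x - c‖ ≤ D.ε) (hx : D.δ < ‖x - c‖) :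
    x ∈ D.isl := by
  intro c' hc'
  by_cases hcc : c = c'
  · rwa [← hcc]
  · have h1 := D.sep hc hc' hcc
    have h2 : ‖c - c'‖ ≤ ‖x - c'‖ + ‖x - c‖ := by
      calc _ = ‖(x - c') - (x - c)‖ := by congr 1; abel
        _ ≤ _ := norm_sub_le _ _
    linarith [D.δ_lt]

theorem up_down {w : Plane} (hw : w ∈ D.isl) : D.up (D.down w) = w ∧ D.down w ∉ D.Lam := by
  by_cases h : ∃ c ∈ D.Lam, ‖w - c‖ ≤ D.ε
  · obtain ⟨c, hc, hle⟩ := h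
    have h1 := radial_ψ_norm (hw c hc) hle
    rw [down, lift_of_mem hc hle]
    have e : c + radial D.ψ (w - c) - c = radial D.ψ (w - c) := by abel
    constructor
    · rw [up, lift_of_mem hc (by rw [e]; exact h1.2), e, radial_ψinv_ψ (hw c hc) hle]
      abel
    · apply not_mem_Lam_of_near hc (by rw [e]; exact h1.2)
      intro h0
      rw [h0, sub_self] at e
      rw [← e, norm_zero] at h1
      exact lt_irrefl _ h1.1
  · push Not at h
    rw [down, lift_of_far h]
    refine ⟨lift_of_far h, fun hw' => ?_⟩
    have := h w hw'
    rw [sub_self, norm_zero] at this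
    linarith [D.ε_pos]

theorem down_up {x : Plane} (hx : x ∉ D.Lam) : D.down (D.up x) = x ∧ D.up x ∈ D.isl := by
  by_cases h : ∃ c ∈ D.Lam, ‖x - c‖ ≤ D.ε
  · obtain ⟨c, hc, hle⟩ := h
    have hne : x - c ≠ 0 := fun h0 => hx (by rwa [sub_eq_zero.1 h0])
    have h1 := radial_ψinv_norm hne hle
    rw [up, lift_of_mem hc hle]
    have e : c + radial D.ψinv (x - c) - c = radial D.ψinv (x - c) := by abel
    constructor
    · rw [down, lift_of_mem hc (by rw [e]; exact h1.2), e, radial_ψ_ψinv hne hle]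
      abel
    · exact mem_isl_of_near hc (by rw [e]; exact h1.2) (by rw [e]; exact h1.1)
  · push Not at h
    rw [up, lift_of_far h]
    exact ⟨lift_of_far h, fun c hc => D.δ_lt.trans (h c hc)⟩

/-- The lift of `Ψ⁻¹` maps points away from the lattice to points away from the discs. -/
theorem up_far {r : ℝ} (hr : 0 < r) : ∃ t, 0 < t ∧ D.δ + t ≤ D.ε ∧
    ∀ x, (∀ c ∈ D.Lam, r ≤ ‖x - c‖) → ∀ c ∈ D.Lam, D.δ + t ≤ ‖D.up x - c‖ := by
  have hε := D.ε_pos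
  let r' := min r D.ε
  have hr' : 0 < r' := lt_min hr hε
  have hsub : Icc (r' ^ 2 / 2) (D.ε ^ 2 / 2) ⊆ Ioc 0 (D.ε ^ 2 / 2) := fun y hy =>
    ⟨lt_of_lt_of_le (by positivity) hy.1, hy.2⟩
  -- No monotonicity of `ψinv` is invoked: its minimum over a compact interval away from `0` gives
  -- the gap.
  obtain ⟨y₀, hy₀, hmin⟩ := isCompact_Icc.exists_isMinOn
    (nonempty_Icc.2 (by gcongr; exact min_le_right _ _))
    (D.ψinv_smooth.continuousOn.mono (hsub.trans Ioc_subset_Icc_self))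
  have hm := ψinv_gt (hsub hy₀)
  set m := D.ψinv y₀
  have hm' : D.δ < √(2 * m) := (Real.lt_sqrt D.δ_pos.le).2 (by linarith)
  have hδε := D.δ_lt
  refine ⟨min (√(2 * m) - D.δ) (D.ε - D.δ), lt_min (by linarith) (by linarith), ?_, ?_⟩
  · linarith [min_le_right (√(2 * m) - D.δ) (D.ε - D.δ)]
  intro x hx c' hc'
  by_cases h : ∃ c ∈ D.Lam, ‖x - c‖ ≤ D.ε
  · obtain ⟨c, hc, hle⟩ := h
    have hne : x - c ≠ 0 := norm_pos_iff.1 (hr.trans_le (hx c hc))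
    have h1 := radial_ψinv_norm hne hle
    rw [up, lift_of_mem hc hle]
    by_cases hcc : c = c'
    · rw [← hcc, add_sub_cancel_left, norm_radial hne]
      have hin : ‖x - c‖ ^ 2 / 2 ∈ Icc (r' ^ 2 / 2) (D.ε ^ 2 / 2) := by
        refine ⟨?_, by gcongr⟩
        have : r' ≤ ‖x - c‖ := (min_le_left _ _).trans (hx c hc)
        gcongr
      have h2 : m ≤ D.ψinv (‖x - c‖ ^ 2 / 2) := hmin hin
      have h3 : √(2 * m) ≤ √(2 * D.ψinv (‖x - c‖ ^ 2 / 2)) := Real.sqrt_le_sqrt (by linarith)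
      linarith [min_le_left (√(2 * m) - D.δ) (D.ε - D.δ)]
    · have h2 := D.sep hc hc' hcc
      have h3 : ‖c - c'‖ ≤ ‖c + radial D.ψinv (x - c) - c'‖ + ‖radial D.ψinv (x - c)‖ := by
        calc _ = ‖(c + radial D.ψinv (x - c) - c') - radial D.ψinv (x - c)‖ := by congr 1; abel
          _ ≤ _ := norm_sub_le _ _
      linarith [min_le_right (√(2 * m) - D.δ) (D.ε - D.δ)]
  · push Not at h
    rw [up, lift_of_far h]
    linarith [h c' hc', min_le_right (√(2 * m) - D.δ) (D.ε - D.δ)]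

/-! ### Local representations -/

variable (D) in
/-- The map `radial χ` extended by the identity. -/
def ext (χ : ℝ → ℝ) (w : Plane) : Plane := if ‖w‖ ≤ D.ε then radial χ w else w

/-- Beyond `ε₁` the surgery about any other centre acts trivially. One formula with a single centre
is therefore valid on a whole ball, even where the ball enters the collar of another disc. -/
theorem lift_eq_ext {ε₁ : ℝ} (h₁ : ∀ s, ε₁ ^ 2 ≤ s → s ≤ D.ε ^ 2 → 2 * χ (s / 2) = s)
    (hε₁ : 0 ≤ ε₁) {z c : Plane} (hc : c ∈ D.Lam) (h : ∀ c' ∈ D.Lam, c' ≠ c → ε₁ ≤ ‖z - c'‖) :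
    D.lift χ z = c + D.ext χ (z - c) := by
  unfold ext
  split_ifs with hz
  · exact lift_of_mem hc hz
  · rw [add_sub_cancel]
    by_cases hex : ∃ c' ∈ D.Lam, ‖z - c'‖ ≤ D.ε
    · obtain ⟨c', hc', hle⟩ := hex
      have hne : c' ≠ c := by rintro rfl; exact hz hle
      rw [lift_of_mem hc' hle, radial_eq_self, add_sub_cancel]
      have := h c' hc' hne
      exact h₁ _ (by gcongr) (by gcongr)
    · push Not at hex
      exact lift_of_far hex

variable (D) in
/-- Near every point there is at most one relevant lattice point. -/
theorem exists_lattice_near {ε₁ : ℝ} (z₀ : Plane) : ∃ c ∈ D.Lam, ∀ z,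
    ‖z - z₀‖ ≤ D.ε - ε₁ → ∀ c' ∈ D.Lam, c' ≠ c → ε₁ ≤ ‖z - c'‖ := by
  have tri : ∀ z c' : Plane, ‖z₀ - c'‖ ≤ ‖z - c'‖ + ‖z - z₀‖ := fun z c' => by
    calc _ = ‖(z - c') - (z - z₀)‖ := by congr 1; abel
      _ ≤ _ := norm_sub_le _ _
  by_cases h : ∃ c ∈ D.Lam, ‖z₀ - c‖ ≤ D.ε
  · obtain ⟨c, hc, hle⟩ := h
    refine ⟨c, hc, fun z hz c' hc' hne => ?_⟩
    have h1 := D.sep hc hc' hne.symm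
    have h2 : ‖c - c'‖ ≤ ‖z₀ - c'‖ + ‖z₀ - c‖ := by
      calc _ = ‖(z₀ - c') - (z₀ - c)‖ := by congr 1; abel
        _ ≤ _ := norm_sub_le _ _
    linarith [tri z c']
  · push Not at h
    -- No centre is within `ε`, so any lattice point serves; `0` is a default.
    refine ⟨0, D.Lam.zero_mem, fun z hz c' hc' _ => ?_⟩
    linarith [tri z c', h c' hc']

theorem up_inner {s₁ : ℝ} (hs : s₁ ≤ D.ε ^ 2)
    (h : ∀ s, 0 ≤ s → s ≤ s₁ → 2 * D.ψinv (s / 2) = s + D.δ ^ 2) {x c : Plane} (hc : c ∈ D.Lam)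
    (hx : ‖x - c‖ ^ 2 ≤ s₁) : D.up x = c + blowOut D.δ (x - c) := by
  have hle : ‖x - c‖ ≤ D.ε := le_of_sq_le_sq (hx.trans hs) D.ε_pos.le
  rw [up, lift_of_mem hc hle, radial, h _ (by positivity) hx, blowOut]

theorem down_inner {s₁ : ℝ} (hs : D.δ ^ 2 + s₁ ≤ D.ε ^ 2)
    (h : ∀ s, D.δ ^ 2 ≤ s → s ≤ D.δ ^ 2 + s₁ → 2 * D.ψ (s / 2) = s - D.δ ^ 2) {w c : Plane}
    (hc : c ∈ D.Lam) (hw : D.δ ≤ ‖w - c‖) (hw' : ‖w - c‖ ^ 2 ≤ D.δ ^ 2 + s₁) :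
    D.down w = c + blowIn D.δ (w - c) := by
  have hle : ‖w - c‖ ≤ D.ε := le_of_sq_le_sq (hw'.trans hs) D.ε_pos.le
  have hδ := D.δ_pos
  rw [down, lift_of_mem hc hle, radial, h _ (by gcongr) hw', blowIn]

/-! ### Smoothness -/

variable (D) in
/-- The factor by which `ext χ` stretches vectors of squared length `s`. -/
def prof (χ : ℝ → ℝ) (s : ℝ) : ℝ := if s ≤ D.ε ^ 2 then √(2 * χ (s / 2) / s) else 1

theorem ext_eq (w : Plane) : D.ext χ w = D.prof χ (‖w‖ ^ 2) • w := by
  unfold ext prof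
  by_cases h : ‖w‖ ≤ D.ε
  · have h' : ‖w‖ ^ 2 ≤ D.ε ^ 2 := by gcongr
    rw [if_pos h, if_pos h', radial, Real.sqrt_div' _ (by positivity), Real.sqrt_sq (norm_nonneg _)]
  · have h' : ¬ ‖w‖ ^ 2 ≤ D.ε ^ 2 := fun h' => h (le_of_sq_le_sq h' D.ε_pos.le)
    rw [if_neg h, if_neg h', one_smul]

/-- The properties of the profiles `ψ` and `ψ⁻¹` that are needed for smoothness. -/
structure IsProfile (D : Data) (a : ℝ) (χ : ℝ → ℝ) : Prop where
  nonneg : 0 ≤ a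
  smooth : ContDiffOn ℝ ∞ χ (Icc (a ^ 2 / 2) (D.ε ^ 2 / 2))
  pos : ∀ ρ ∈ Ioc (a ^ 2 / 2) (D.ε ^ 2 / 2), 0 < χ ρ
  outer : ∃ ε₁, 0 ≤ ε₁ ∧ ε₁ < D.ε ∧ ∀ s, ε₁ ^ 2 ≤ s → s ≤ D.ε ^ 2 → 2 * χ (s / 2) = s

variable (D) in
theorem isProfile_ψ : D.IsProfile D.δ D.ψ := by
  obtain ⟨ε₁, h1, h2, h3, -⟩ := D.exists_outer
  exact ⟨D.δ_pos.le, D.ψ_smooth, fun ρ hρ => ψ_pos hρ,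
    ε₁, (D.δ_pos.trans h1).le, h2, h3⟩

variable (D) in
theorem isProfile_ψinv : D.IsProfile 0 D.ψinv := by
  obtain ⟨ε₁, h1, h2, -, h3⟩ := D.exists_outer
  refine ⟨le_rfl, by simpa using D.ψinv_smooth, fun ρ hρ => ?_,
    ε₁, (D.δ_pos.trans h1).le, h2, h3⟩
  have := ψinv_gt (D := D) (y := ρ) (by simpa using hρ)
  exact lt_of_le_of_lt (by positivity) this

namespace IsProfile

variable {a : ℝ}

/-- Below `ε²` the root formula is smooth because `χ` is positive. From `ε²` on, `prof` is locally
`1`, since the identity collar reaches below `ε²`. -/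
theorem contDiffAt_prof (h : D.IsProfile a χ) {s : ℝ} (hs : a ^ 2 < s) :
    ContDiffAt ℝ ∞ (D.prof χ) s := by
  obtain ⟨ε₁, h1, h2, h3⟩ := h.outer
  have hs0 : 0 < s := lt_of_le_of_lt (sq_nonneg a) hs
  by_cases hsε : s < D.ε ^ 2
  · have hev : D.prof χ =ᶠ[𝓝 s] fun s => √(2 * χ (s / 2) / s) := by
      filter_upwards [Iio_mem_nhds hsε] with t ht
      rw [prof, if_pos (le_of_lt ht)]
    refine ContDiffAt.congr_of_eventuallyEq ?_ hev
    have hχ : ContDiffAt ℝ ∞ χ (s / 2) :=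
      h.smooth.contDiffAt (Icc_mem_nhds (by linarith) (by linarith))
    have hχ2 : ContDiffAt ℝ ∞ (fun s => χ (s / 2)) s :=
      ContDiffAt.comp s hχ (contDiffAt_id.div_const 2)
    have hp := h.pos (s / 2) ⟨by linarith, by linarith⟩
    exact ((contDiffAt_const.mul hχ2).div contDiffAt_id hs0.ne').sqrt (by
      have : 0 < 2 * χ (s / 2) / s := by positivity
      exact this.ne')
  · have hlt : ε₁ ^ 2 < s := lt_of_lt_of_le (by gcongr) (not_lt.1 hsε)
    have hev : D.prof χ =ᶠ[𝓝 s] fun _ => 1 := by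
      filter_upwards [Ioi_mem_nhds hlt, Ioi_mem_nhds hs0] with t ht ht0
      rw [prof]
      split_ifs with hle
      · rw [h3 t (le_of_lt ht) hle, div_self (ne_of_gt ht0), Real.sqrt_one]
      · rfl
    exact contDiffAt_const.congr_of_eventuallyEq hev

theorem contDiffAt_ext (h : D.IsProfile a χ) {w : Plane} (hw : a < ‖w‖) :
    ContDiffAt ℝ ∞ (D.ext χ) w := by
  have : D.ext χ = fun w => D.prof χ (‖w‖ ^ 2) • w := funext ext_eq
  rw [this]
  have h0 := h.nonneg
  have h1 : ContDiffAt ℝ ∞ (D.prof χ) (‖w‖ ^ 2) := h.contDiffAt_prof (by gcongr)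
  exact (ContDiffAt.comp w h1 (contDiff_norm_sq ℝ).contDiffAt).smul contDiffAt_id

/-- Away from the inner circle, `ext χ` agrees with a map that is globally Lipschitz together
with its derivative. -/
theorem exists_regular (h : D.IsProfile a χ) {b : ℝ} (hb : a < b) :
    ∃ (M : ℝ) (E : Plane → Plane), 0 ≤ M ∧
    (∀ w, b ≤ ‖w‖ → D.ext χ w = E w) ∧ Differentiable ℝ E ∧
    (∀ x y, ‖E x - E y‖ ≤ M * ‖x - y‖) ∧
    ∀ x y, ‖fderiv ℝ E x - fderiv ℝ E y‖ ≤ M * ‖x - y‖ := by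
  have ha := h.nonneg
  have hab : a ^ 2 < b ^ 2 := by gcongr
  let m := (a ^ 2 + b ^ 2) / 2
  have hm1 : a ^ 2 < m := by simp only [m]; linarith
  have hm2 : m < b ^ 2 := by simp only [m]; linarith
  -- Cut off the deviation of `prof` from `1` between the squared radii `m` and `b²`. It becomes
  -- smooth, and `k` gets compact support, which bounds the Lipschitz constants of `k` and of its
  -- derivative.
  let q : ℝ → ℝ := fun s => Real.smoothTransition ((s - m) / (b ^ 2 - m)) * (D.prof χ s - 1)
  have hq : ContDiff ℝ ∞ q := by
    rw [contDiff_iff_contDiffAt]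
    intro s
    by_cases hs : a ^ 2 < s
    · have h1 : ContDiffAt ℝ ∞ (fun s => Real.smoothTransition ((s - m) / (b ^ 2 - m))) s :=
        ContDiffAt.comp s Real.smoothTransition.contDiffAt
          ((contDiffAt_id.sub contDiffAt_const).div_const _)
      exact h1.mul ((h.contDiffAt_prof hs).sub contDiffAt_const)
    · have hev : q =ᶠ[𝓝 s] fun _ => 0 := by
        filter_upwards [Iio_mem_nhds (lt_of_le_of_lt (not_lt.1 hs) hm1)] with t ht
        have ht : t < m := ht
        simp only [q]
        rw [Real.smoothTransition.zero_of_nonpos, zero_mul]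
        exact div_nonpos_of_nonpos_of_nonneg (by linarith) (by linarith)
      exact contDiffAt_const.congr_of_eventuallyEq hev
  let k : Plane → Plane := fun w => q (‖w‖ ^ 2) • w
  have hk : ContDiff ℝ ∞ k := (hq.comp (contDiff_norm_sq ℝ)).smul contDiff_id
  have hks : HasCompactSupport k := by
    refine HasCompactSupport.intro (isCompact_closedBall (0 : Plane) D.ε) fun w hw => ?_
    rw [mem_closedBall_zero_iff, not_le] at hw
    have hε := D.ε_pos
    have : ¬ ‖w‖ ^ 2 ≤ D.ε ^ 2 := not_le.2 (by gcongr)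
    simp [k, q, prof, this]
  obtain ⟨C, hC⟩ := hk.lipschitzWith_of_hasCompactSupport hks (by simp)
  have hfk : ContDiff ℝ 1 (fderiv ℝ k) := hk.fderiv_right (WithTop.coe_le_coe.2 le_top)
  obtain ⟨C', hC'⟩ := hfk.lipschitzWith_of_hasCompactSupport (hks.fderiv ℝ) (by simp)
  have hkd : Differentiable ℝ k := hk.differentiable (by simp)
  have hfd : ∀ x, fderiv ℝ (fun w => w + k w) x = ContinuousLinearMap.id ℝ Plane + fderiv ℝ k x :=
    fun x => ((hasFDerivAt_id x).add (hkd x).hasFDerivAt).fderiv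
  refine ⟨1 + C + C', fun w => w + k w, by positivity, fun w hw => ?_,
    differentiable_id.add hkd, fun x y => ?_, fun x y => ?_⟩
  · have hb0 : 0 ≤ b := ha.trans hb.le
    have h1 : 1 ≤ (‖w‖ ^ 2 - m) / (b ^ 2 - m) := by
      rw [le_div_iff₀ (by linarith)]
      have : b ^ 2 ≤ ‖w‖ ^ 2 := by gcongr
      linarith
    simp only [k, q]
    rw [Real.smoothTransition.one_of_one_le h1, ext_eq]
    module
  · have h1 := hC.dist_le_mul x y
    rw [dist_eq_norm, dist_eq_norm] at h1
    calc ‖x + k x - (y + k y)‖ = ‖(x - y) + (k x - k y)‖ := by congr 1; abel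
      _ ≤ ‖x - y‖ + C * ‖x - y‖ := (norm_add_le _ _).trans (add_le_add le_rfl h1)
      _ ≤ _ := by nlinarith [mul_nonneg C'.coe_nonneg (norm_nonneg (x - y))]
  · have h1 := hC'.dist_le_mul x y
    rw [dist_eq_norm, dist_eq_norm] at h1
    rw [hfd, hfd, add_sub_add_left_eq_sub]
    refine h1.trans ?_
    nlinarith [mul_nonneg C.coe_nonneg (norm_nonneg (x - y)), norm_nonneg (x - y)]

theorem contDiffAt_lift (h : D.IsProfile a χ) {w : Plane} (hw : ∀ c ∈ D.Lam, a < ‖w - c‖) :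
    ContDiffAt ℝ ∞ (D.lift χ) w := by
  obtain ⟨ε₁, h1, h2, h3⟩ := h.outer
  obtain ⟨c, hc, H⟩ := D.exists_lattice_near (ε₁ := ε₁) w
  have hev : D.lift χ =ᶠ[𝓝 w] fun z => c + D.ext χ (z - c) := by
    filter_upwards [Metric.closedBall_mem_nhds w (sub_pos.2 h2)] with z hz
    exact lift_eq_ext h3 h1 hc (H z (by rwa [mem_closedBall_iff_norm] at hz))
  have h4 : ContDiffAt ℝ ∞ (fun z : Plane => z - c) w := contDiffAt_id.sub contDiffAt_const
  have h5 : ContDiffAt ℝ ∞ (D.ext χ ∘ fun z : Plane => z - c) w :=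
    (h.contDiffAt_ext (hw c hc)).comp w h4
  exact (contDiffAt_const.add h5).congr_of_eventuallyEq hev

end IsProfile

theorem contDiffAt_down {w : Plane} (hw : w ∈ D.isl) : ContDiffAt ℝ ∞ D.down w :=
  D.isProfile_ψ.contDiffAt_lift hw

theorem contDiffAt_up {x : Plane} (hx : x ∉ D.Lam) : ContDiffAt ℝ ∞ D.up x :=
  D.isProfile_ψinv.contDiffAt_lift fun c hc => norm_pos_iff.2 fun h0 => hx (by
    rwa [sub_eq_zero.1 h0])

end Data

end BlowUp

/-! ### Blowing down a perturbation: smallness of `blown u - hyp` -/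

namespace BlowUp

/-- A map that is Lipschitz at small scales is Lipschitz with the same constant. -/
theorem lipschitz_of_scale {f : Plane → Plane} {r K : ℝ} (hr : 0 < r)
    (h : ∀ x y, ‖x - y‖ ≤ r → ‖f x - f y‖ ≤ K * ‖x - y‖) (x y : Plane) :
    ‖f x - f y‖ ≤ K * ‖x - y‖ := by
  have key : ∀ n : ℕ, ∀ x y, ‖x - y‖ ≤ n * r → ‖f x - f y‖ ≤ K * ‖x - y‖ := by
    intro n
    induction n with
    | zero =>
      intro x y hxy
      have : ‖x - y‖ = 0 := le_antisymm (by simpa using hxy) (norm_nonneg _)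
      have : x = y := by rwa [norm_eq_zero, sub_eq_zero] at this
      simp [this]
    | succ n ih =>
      intro x y hxy
      set t : ℝ := 1 / (n + 1)
      have ht0 : 0 ≤ t := by positivity
      have ht : t * (n + 1) = 1 := by simp only [t]; field_simp
      have ht1 : 0 ≤ 1 - t := by nlinarith [Nat.cast_nonneg (α := ℝ) n]
      set z := x - t • (x - y)
      have e1 : x - z = t • (x - y) := by simp only [z]; abel
      have e2 : z - y = (1 - t) • (x - y) := by simp only [z]; module
      have n1 : ‖x - z‖ = t * ‖x - y‖ := by rw [e1, norm_smul, Real.norm_eq_abs, abs_of_nonneg ht0]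
      have n2 : ‖z - y‖ = (1 - t) * ‖x - y‖ := by
        rw [e2, norm_smul, Real.norm_eq_abs, abs_of_nonneg ht1]
      push_cast at hxy
      have h1 := h x z (by
        rw [n1]
        calc t * ‖x - y‖ ≤ t * ((n + 1) * r) := by gcongr
          _ = r := by rw [← mul_assoc, ht, one_mul])
      have h2 := ih z y (by
        rw [n2]
        calc (1 - t) * ‖x - y‖ ≤ (1 - t) * ((n + 1) * r) := by gcongr
          _ = (n + 1) * r - (t * (n + 1)) * r := by ring
          _ = n * r := by rw [ht]; ring)
      calc ‖f x - f y‖ = ‖(f x - f z) + (f z - f y)‖ := by congr 1; abel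
        _ ≤ K * ‖x - z‖ + K * ‖z - y‖ := (norm_add_le _ _).trans (add_le_add h1 h2)
        _ = K * ‖x - y‖ := by rw [n1, n2]; ring
  obtain ⟨n, hn⟩ := exists_nat_ge (‖x - y‖ / r)
  exact key n x y ((div_le_iff₀ hr).1 hn)

/-- Second differences of a map with Lipschitz derivative. -/
theorem norm_second_difference_le {E : Plane → Plane} {M : ℝ}
    (hd : Differentiable ℝ E) (hl : ∀ x y, ‖E x - E y‖ ≤ M * ‖x - y‖)
    (hl' : ∀ x y, ‖fderiv ℝ E x - fderiv ℝ E y‖ ≤ M * ‖x - y‖) (a b u v : Plane) :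
    ‖(E (a + u) - E a) - (E (b + v) - E b)‖ ≤ M * ‖u - v‖ + M * ‖v‖ * ‖a - b‖ := by
  have h1 : ‖E (a + u) - E (a + v)‖ ≤ M * ‖u - v‖ := by
    simpa using hl (a + u) (a + v)
  -- Mean value inequality for `x ↦ E (x + v) - E x`, whose derivative has norm at most `M ‖v‖`.
  have h2 : ‖(E (a + v) - E a) - (E (b + v) - E b)‖ ≤ M * ‖v‖ * ‖a - b‖ := by
    have hd' : ∀ x, HasFDerivAt (fun x => E (x + v) - E x)
        (fderiv ℝ E (x + v) - fderiv ℝ E x) x := fun x => by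
      have h3 : HasFDerivAt (fun x => E (x + v)) (fderiv ℝ E (x + v)) x :=
        (hd (x + v)).hasFDerivAt.comp x ((hasFDerivAt_id x).add_const v)
      exact h3.sub (hd x).hasFDerivAt
    refine convex_univ.norm_image_sub_le_of_norm_hasFDerivWithin_le
      (f := fun x => E (x + v) - E x) (fun x _ => (hd' x).hasFDerivWithinAt) (fun x _ => ?_)
      (mem_univ b) (mem_univ a)
    simpa using hl' (x + v) x
  calc _ = ‖(E (a + u) - E (a + v)) + ((E (a + v) - E a) - (E (b + v) - E b))‖ := by
        congr 1; abel
    _ ≤ _ := (norm_add_le _ _).trans (add_le_add h1 h2)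

theorem SmallC2.translate {η : ℝ} {u : Plane → Plane} (h : SmallC2 η u) (c : Plane) :
    SmallC2 η (fun x => u (c + x)) := by
  have hd : ∀ x, fderiv ℝ (fun x => u (c + x)) x = fderiv ℝ u (c + x) := fun x =>
    fderiv_comp_add_left c
  refine ⟨fun x => ?_, fun x => h.bound _, fun x => ?_, fun x y => ?_⟩
  · exact (h.diff (c + x)).comp x ((differentiableAt_id).const_add c)
  · rw [hd]
    exact h.bound_fderiv _
  · rw [hd, hd]
    simpa using h.lip_fderiv (c + x) (c + y)

namespace Data

variable {D : Data} {u : Plane → Plane}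

variable (D u) in
/-- The perturbation `u` keeps the boundaries of the discs invariant. -/
def KeepsCircles : Prop :=
  ∀ c ∈ D.Lam, ∀ e, ‖e‖ = 1 → ‖(D.δ / ‖hyp e‖) • hyp e + u (c + D.δ • e)‖ = D.δ

open Classical in
variable (D u) in
/-- The lift of the blown-down perturbed map. -/
def blown (x : Plane) : Plane :=
  if x ∈ D.Lam then hyp x else D.down (D.up (hyp x) + u (D.up x))

theorem blown_of_mem {x : Plane} (hx : x ∈ D.Lam) : D.blown u x = hyp x := if_pos hx

theorem blown_of_not_mem {x : Plane} (hx : x ∉ D.Lam) :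
    D.blown u x = D.down (D.up (hyp x) + u (D.up x)) := if_neg hx

theorem blown_add (hu : ∀ w, ∀ l ∈ D.L, u (w + l) = u w) (x : Plane) {l : Plane} (hl : l ∈ D.L) :
    D.blown u (x + l) = D.blown u x + hyp l := by
  have hl' := D.L_le_Lam hl
  by_cases hx : x ∈ D.Lam
  · rw [blown_of_mem hx, blown_of_mem (D.Lam.add_mem hx hl'), map_add]
  · have hx' : x + l ∉ D.Lam := fun h => hx (by simpa using D.Lam.sub_mem h hl')
    rw [blown_of_not_mem hx, blown_of_not_mem hx', map_add, up, lift_add (D.hyp_mem_Lam hl'),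
      lift_add hl', hu _ _ hl, add_right_comm, down, lift_add (D.hyp_mem_Lam hl')]

theorem far_hyp {r : ℝ} {x : Plane} (hx : ∀ c ∈ D.Lam, r ≤ ‖x - c‖) :
    ∀ c ∈ D.Lam, lam⁻¹ * r ≤ ‖hyp x - c‖ := by
  intro c hc
  have h1 := hx _ (D.hyp_symm_mem_Lam hc)
  have h2 := le_norm_hyp (x - hyp.symm c)
  rw [map_sub, ContinuousLinearEquiv.apply_symm_apply] at h2
  have := mul_le_mul_of_nonneg_left h1 lam_inv_pos.le
  linarith

theorem not_mem_of_far {r : ℝ} (hr : 0 < r) {x : Plane} (hx : ∀ c ∈ D.Lam, r ≤ ‖x - c‖) :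
    x ∉ D.Lam := fun h => by
  have := hx x h
  rw [sub_self, norm_zero] at this
  linarith

variable (D) in
/-- The blown-down perturbed map near a lattice point. -/
theorem blown_near : ∃ τ : ℝ, 0 < τ ∧ ∃ C η₁ : ℝ, 0 < C ∧ 0 < η₁ ∧ ∀ η u, η ≤ η₁ → SmallC2 η u →
    D.KeepsCircles u → ∀ c ∈ D.Lam,
      (∀ x, x ≠ c → ‖x - c‖ ≤ τ → D.up (hyp x) + u (D.up x) ∈ D.isl) ∧
      ∀ x y, ‖x - c‖ ≤ τ → ‖y - c‖ ≤ τ →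
        ‖(D.blown u x - hyp x) - (D.blown u y - hyp y)‖ ≤ C * η * ‖x - y‖ := by
  obtain ⟨s₁, hs₁, hs₁ε, hin, hinv⟩ := D.exists_inner
  have hlp := lam_pos
  -- With `(lam ^ 2 + 1) τ ^ 2 = s₁`, the perturbed images of the `τ`-ball still lie where the
  -- profile is the pure shift.
  set τ := √(s₁ / (lam ^ 2 + 1)) with hτdef
  have hτ : 0 < τ := Real.sqrt_pos.2 (by positivity)
  have hτ2 : (lam ^ 2 + 1) * τ ^ 2 = s₁ := by
    rw [hτdef, Real.sq_sqrt (by positivity)]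
    field_simp
  obtain ⟨C, η₁, hC, hη₁, H⟩ := blowDown_estimate D.δ_pos hτ
  refine ⟨τ, hτ, C, η₁, hC, hη₁, fun η u hη hu hk c hc => ?_⟩
  obtain ⟨H1, H2⟩ := H η _ hη (hu.translate c) (hk c hc)
  have hδ := D.δ_pos
  have hc' := D.hyp_mem_Lam hc
  have hτs : τ ^ 2 ≤ s₁ := by nlinarith [sq_nonneg lam, sq_nonneg τ]
  have hs₁' : s₁ ≤ D.ε ^ 2 := by nlinarith
  have eup : ∀ v : Plane, ‖v‖ ≤ τ → D.up (c + v) = c + blowOut D.δ v := fun v hv => by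
    have e : c + v - c = v := by abel
    rw [up_inner hs₁' hinv hc (by rw [e]; exact (pow_le_pow_left₀ (norm_nonneg _) hv 2).trans hτs),
      e]
  have euph : ∀ v : Plane, ‖v‖ ≤ τ → D.up (hyp (c + v)) = hyp c + blowOut D.δ (hyp v) := by
    intro v hv
    have e : hyp (c + v) - hyp c = hyp v := by rw [map_add]; abel
    have hle : ‖hyp v‖ ^ 2 ≤ s₁ := by
      have h1 : ‖hyp v‖ ≤ lam * τ := (norm_hyp_le v).trans (by gcongr)
      have h2 := pow_le_pow_left₀ (norm_nonneg _) h1 2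
      nlinarith [sq_nonneg τ]
    rw [up_inner hs₁' hinv hc' (by rwa [e]), e]
  have hsum : ∀ v : Plane, ‖v‖ ≤ τ → D.up (hyp (c + v)) + u (D.up (c + v)) =
      hyp c + (blowOut D.δ (hyp v) + u (c + blowOut D.δ v)) := fun v hv => by
    rw [euph v hv, eup v hv, add_assoc]
  have hnear : ∀ v : Plane, v ≠ 0 → ‖v‖ ≤ τ → c + v ∉ D.Lam := fun v hv hvτ => by
    refine not_mem_Lam_of_near hc ?_ (by simpa using hv)
    rw [add_sub_cancel_left]
    exact hvτ.trans (le_of_sq_le_sq (hτs.trans hs₁') D.ε_pos.le)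
  constructor
  · intro x hx hxτ
    have e : x = c + (x - c) := by abel
    have hne : x - c ≠ 0 := sub_ne_zero.2 hx
    obtain ⟨h1, h2⟩ := H1 (x - c) hne hxτ
    rw [e, hsum _ hxτ]
    refine mem_isl_of_near hc' ?_ ?_
    · rw [add_sub_cancel_left]
      refine le_of_sq_le_sq (h2.trans ?_) D.ε_pos.le
      linarith
    · rwa [add_sub_cancel_left]
  · intro x y hx hy
    have := H2 (fun v => D.blown u (c + v) - hyp (c + v)) (by simp [blown_of_mem hc])
      (fun v hv hvτ => ?_) (x - c) (y - c) hx hy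
    · simpa using this
    · obtain ⟨h1, h2⟩ := H1 v hv hvτ
      rw [blown_of_not_mem (hnear v hv hvτ), hsum v hvτ]
      have e : hyp c + (blowOut D.δ (hyp v) + u (c + blowOut D.δ v)) - hyp c =
          blowOut D.δ (hyp v) + u (c + blowOut D.δ v) := by abel
      rw [down_inner hs₁ε.le hin hc' (by rw [e]; exact h1.le)
        (by rw [e]; linarith), e, map_add]
      abel

-- The bound is local, at scale `ε - ε₁`, so that both points can be expressed through one centre
-- and one regular map.
variable (D) in
theorem lift_lipschitz_far {χ : ℝ → ℝ} {a b : ℝ} (h : D.IsProfile a χ) (hb : a < b) :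
    ∃ M g : ℝ, 0 ≤ M ∧ 0 < g ∧ ∀ x y, (∀ c ∈ D.Lam, b ≤ ‖x - c‖) → (∀ c ∈ D.Lam, b ≤ ‖y - c‖) →
      ‖x - y‖ ≤ g → ‖D.lift χ x - D.lift χ y‖ ≤ M * ‖x - y‖ := by
  obtain ⟨M, E, hM, hE, -, hl, -⟩ := h.exists_regular hb
  obtain ⟨ε₁, h1, h2, h3⟩ := h.outer
  refine ⟨M, D.ε - ε₁, hM, sub_pos.2 h2, fun x y hx hy hxy => ?_⟩
  obtain ⟨c, hc, H⟩ := D.exists_lattice_near (ε₁ := ε₁) y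
  rw [lift_eq_ext h3 h1 hc (H x hxy), lift_eq_ext h3 h1 hc (H y (by simpa using h2.le)),
    hE _ (hx c hc), hE _ (hy c hc), add_sub_add_left_eq_sub]
  simpa using hl (x - c) (y - c)

variable (D) in
/-- The blown-down perturbed map away from the lattice. -/
theorem blown_far {r : ℝ} (hr : 0 < r) : ∃ r₀ : ℝ, 0 < r₀ ∧ ∃ C η₁ : ℝ, 0 < C ∧ 0 < η₁ ∧
    ∀ η u, η ≤ η₁ → SmallC2 η u →
      (∀ x, (∀ c ∈ D.Lam, r ≤ ‖x - c‖) → D.up (hyp x) + u (D.up x) ∈ D.isl) ∧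
      ∀ x y, (∀ c ∈ D.Lam, r ≤ ‖x - c‖) → (∀ c ∈ D.Lam, r ≤ ‖y - c‖) → ‖x - y‖ ≤ r₀ →
        ‖(D.blown u x - hyp x) - (D.blown u y - hyp y)‖ ≤ C * η * ‖x - y‖ := by
  have hlp := lam_pos
  have hli := lam_inv_pos
  set r' := lam⁻¹ * r with hr'
  have hr'0 : 0 < r' := by positivity
  have hr'r : r' ≤ r := by
    have := lam_inv_le
    nlinarith
  obtain ⟨t, ht, htε, Hfar⟩ := D.up_far hr'0
  obtain ⟨M, g, hM, hg, HM⟩ := D.lift_lipschitz_far D.isProfile_ψinv hr'0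
  obtain ⟨N, E, hN, hE, hEd, hEl, hEl'⟩ := D.isProfile_ψ.exists_regular
    (b := D.δ + t / 2) (by linarith)
  obtain ⟨ε₁, o1, o2, o3⟩ := D.isProfile_ψ.outer
  set g' := D.ε - ε₁ with hg'
  have hg'0 : 0 < g' := sub_pos.2 o2
  -- At this scale `up (hyp x)` and `up (hyp y)` are within `g' / 2`. The other half of `g'` is
  -- reserved for `u`, so all four points below are treated with the same centre `c` and the same
  -- `E`.
  set r₀ := min (g / lam) (g' / (2 * (M + 1) * lam)) with hr₀
  have hr₀0 : 0 < r₀ := by positivity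
  have hr₀1 : lam * r₀ ≤ g := by
    have : r₀ ≤ g / lam := min_le_left _ _
    rw [le_div_iff₀ hlp] at this
    linarith
  have hr₀2 : M * (lam * r₀) ≤ g' / 2 := by
    have : r₀ ≤ g' / (2 * (M + 1) * lam) := min_le_right _ _
    rw [le_div_iff₀ (by positivity)] at this
    nlinarith [mul_pos hlp hr₀0]
  have hr₀g : r₀ ≤ g := by
    have := lam_ge
    nlinarith
  refine ⟨r₀, hr₀0, N * M + N * M * lam + 1, min (t / 2) (g' / 2), by positivity,
    lt_min (by linarith) (by linarith), fun η u hη hu => ?_⟩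
  have hηt : η ≤ t / 2 := hη.trans (min_le_left _ _)
  have hηg : η ≤ g' / 2 := hη.trans (min_le_right _ _)
  have hη0 := hu.nonneg
  have far' : ∀ x, (∀ c ∈ D.Lam, r ≤ ‖x - c‖) → ∀ c ∈ D.Lam, D.δ + t ≤ ‖D.up (hyp x) - c‖ :=
    fun x hx => Hfar _ (far_hyp hx)
  have far'' : ∀ x, (∀ c ∈ D.Lam, r ≤ ‖x - c‖) → ∀ z, ∀ c ∈ D.Lam,
      D.δ + t / 2 ≤ ‖D.up (hyp x) + u z - c‖ := by
    intro x hx z c hc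
    have h1 := far' x hx c hc
    have h2 := hu.bound z
    have h3 := norm_sub_le_norm_add (D.up (hyp x) - c) (u z)
    rw [sub_add_eq_add_sub] at h3
    linarith
  refine ⟨fun x hx c hc => by linarith [far'' x hx (D.up x) c hc], fun x y hx hy hxy => ?_⟩
  have hxL := not_mem_of_far hr hx
  have hyL := not_mem_of_far hr hy
  have d1 : ‖D.up x - D.up y‖ ≤ M * ‖x - y‖ :=
    HM x y (fun c hc => hr'r.trans (hx c hc)) (fun c hc => hr'r.trans (hy c hc)) (hxy.trans hr₀g)
  have dh : ‖hyp x - hyp y‖ ≤ lam * ‖x - y‖ := by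
    rw [← map_sub]
    exact norm_hyp_le _
  have dh' : lam * ‖x - y‖ ≤ lam * r₀ := by gcongr
  have d2 : ‖D.up (hyp x) - D.up (hyp y)‖ ≤ M * (lam * ‖x - y‖) :=
    (HM _ _ (far_hyp hx) (far_hyp hy) (dh.trans (dh'.trans hr₀1))).trans (by gcongr)
  set a := D.up (hyp x) with ha
  set b := D.up (hyp y) with hb
  obtain ⟨c, hc, Hc⟩ := D.exists_lattice_near (ε₁ := ε₁) a
  have rep : ∀ z, ‖z - a‖ ≤ g' → D.δ + t / 2 ≤ ‖z - c‖ → D.down z = c + E (z - c) := by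
    intro z hz hz'
    rw [down, lift_eq_ext o3 o1 hc (Hc z hz), hE _ hz']
  have hba : ‖b - a‖ ≤ g' / 2 := by
    rw [norm_sub_rev]
    refine d2.trans (le_trans ?_ hr₀2)
    gcongr
  have ux := hu.bound (D.up x)
  have uy := hu.bound (D.up y)
  have e1 : D.blown u x = c + E (a - c + u (D.up x)) := by
    rw [blown_of_not_mem hxL, rep _ _ (far'' x hx _ c hc), add_sub_right_comm]
    rw [add_sub_cancel_left]
    linarith
  have e2 : D.blown u y = c + E (b - c + u (D.up y)) := by
    rw [blown_of_not_mem hyL, rep _ _ (far'' y hy _ c hc), add_sub_right_comm]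
    rw [add_sub_right_comm]
    refine (norm_add_le _ _).trans ?_
    linarith
  have e3 : hyp x = c + E (a - c) := by
    rw [← rep a (by simpa using hg'0.le) (by linarith [far' x hx c hc]), ha,
      (down_up (mt D.hyp_mem_Lam_iff.1 hxL)).1]
  have e4 : hyp y = c + E (b - c) := by
    rw [← rep b (by linarith) (by linarith [far' y hy c hc]), hb,
      (down_up (mt D.hyp_mem_Lam_iff.1 hyL)).1]
  -- `blown u x - hyp x` equals `E (a - c + u) - E (a - c)`, so the quantity sought is a second
  -- difference of `E`. Both terms of its bound contain a factor `η`.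
  have key := norm_second_difference_le hEd hEl hEl' (a - c) (b - c) (u (D.up x)) (u (D.up y))
  rw [e1, e2]
  nth_rewrite 1 [e3]
  nth_rewrite 1 [e4]
  rw [add_sub_add_left_eq_sub, add_sub_add_left_eq_sub]
  refine key.trans ?_
  have f1 : ‖u (D.up x) - u (D.up y)‖ ≤ η * (M * ‖x - y‖) := (hu.lip _ _).trans (by gcongr)
  have f2 : ‖a - c - (b - c)‖ ≤ M * (lam * ‖x - y‖) := by rwa [sub_sub_sub_cancel_right]
  calc _ ≤ N * (η * (M * ‖x - y‖)) + N * η * (M * (lam * ‖x - y‖)) := by gcongr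
    _ ≤ _ := by
      have : 0 ≤ η * ‖x - y‖ := by positivity
      linarith

variable (D) in
/-- Every point of the plane is at a bounded distance from the lattice. -/
theorem exists_lattice_bounded : ∃ R : ℝ, ∀ x, ∃ c ∈ D.Lam, ‖x - c‖ ≤ R := by
  refine ⟨‖(D.P : Plane →L[ℝ] Plane)‖ * 2, fun x => ?_⟩
  set z := D.P.symm x
  let f : Plane := !₂[(⌊z 0⌋ : ℝ), (⌊z 1⌋ : ℝ)]
  refine ⟨D.P f, D.L_le_Lam ?_, ?_⟩
  · rw [mem_L]
    intro i
    rw [ContinuousLinearEquiv.symm_apply_apply]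
    fin_cases i
    · exact ⟨⌊z 0⌋, rfl⟩
    · exact ⟨⌊z 1⌋, rfl⟩
  · have e : x - D.P f = D.P (z - f) := by
      rw [map_sub, ContinuousLinearEquiv.apply_symm_apply]
    rw [e]
    refine ((D.P : Plane →L[ℝ] Plane).le_opNorm _).trans ?_
    gcongr
    refine (plane_norm_le _).trans ?_
    have h : ∀ s : ℝ, |s - ⌊s⌋| ≤ 1 := fun s => by
      rw [← Int.fract, abs_of_nonneg (Int.fract_nonneg s)]
      exact (Int.fract_lt_one s).le
    have h0 : |(z - f) 0| ≤ 1 := h (z 0)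
    have h1 : |(z - f) 1| ≤ 1 := h (z 1)
    linarith

variable (D) in
/-- A small perturbation that keeps the circles becomes, after blowing down, a small Lipschitz
perturbation of the hyperbolic map. -/
theorem exists_nearHyp : ∃ η₀ : ℝ, 0 < η₀ ∧ ∀ u, SmallC2 η₀ u → D.KeepsCircles u →
    (∀ x ∉ D.Lam, D.up (hyp x) + u (D.up x) ∈ D.isl) ∧ NearHyp (D.blown u) ∧
      ∃ K, ∀ x, ‖D.blown u x - hyp x‖ ≤ K := by
  obtain ⟨τ, hτ, C, η₁, hC, hη₁, Hn⟩ := D.blown_near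
  obtain ⟨r₀, hr₀, C', η₂, hC', hη₂, Hf⟩ := D.blown_far (half_pos hτ)
  set η₀ := min (min η₁ η₂) (1 / (50 * (C + C'))) with hη₀
  have hη₀p : 0 < η₀ := by positivity
  refine ⟨η₀, hη₀p, fun u hu hk => ?_⟩
  have Hn' := Hn η₀ u ((min_le_left _ _).trans (min_le_left _ _)) hu hk
  obtain ⟨Hf1, Hf2⟩ := Hf η₀ u ((min_le_left _ _).trans (min_le_right _ _)) hu
  have hs : η₀ * (50 * (C + C')) ≤ 1 := by
    have : η₀ ≤ 1 / (50 * (C + C')) := min_le_right _ _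
    rwa [le_div_iff₀ (by positivity)] at this
  have hCη : C * η₀ ≤ 1 / 50 := by nlinarith
  have hCη' : C' * η₀ ≤ 1 / 50 := by nlinarith
  have near : NearHyp (D.blown u) := by
    refine lipschitz_of_scale (f := fun x => D.blown u x - hyp x) (lt_min hr₀ (half_pos hτ))
      fun x y hxy => ?_
    have hxy1 := hxy.trans (min_le_left _ _)
    have hxy2 := hxy.trans (min_le_right _ _)
    -- Since `‖x - y‖ ≤ τ / 2`, either both points are within `τ` of one lattice point, or both are
    -- at least `τ / 2` away from the lattice; the two estimates cover exactly these cases.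
    by_cases h : ∃ c ∈ D.Lam, ‖x - c‖ < τ / 2 ∨ ‖y - c‖ < τ / 2
    · obtain ⟨c, hc, h⟩ := h
      have t1 : ‖y - c‖ ≤ ‖x - c‖ + ‖x - y‖ := by
        calc _ = ‖(x - c) - (x - y)‖ := by congr 1; abel
          _ ≤ _ := norm_sub_le _ _
      have t2 : ‖x - c‖ ≤ ‖y - c‖ + ‖x - y‖ := by
        calc _ = ‖(y - c) + (x - y)‖ := by congr 1; abel
          _ ≤ _ := norm_add_le _ _
      have hx : ‖x - c‖ ≤ τ := by rcases h with h | h <;> linarith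
      have hy : ‖y - c‖ ≤ τ := by rcases h with h | h <;> linarith
      refine ((Hn' c hc).2 x y hx hy).trans ?_
      gcongr
    · push Not at h
      refine (Hf2 x y (fun c hc => (h c hc).1) (fun c hc => (h c hc).2) hxy1).trans ?_
      gcongr
  refine ⟨fun x hx => ?_, near, ?_⟩
  · by_cases h : ∃ c ∈ D.Lam, ‖x - c‖ ≤ τ
    · obtain ⟨c, hc, hle⟩ := h
      exact (Hn' c hc).1 x (fun h0 => hx (h0 ▸ hc)) hle
    · push Not at h
      exact Hf1 x fun c hc => by linarith [h c hc]
  -- Boundedness comes for free: `blown u - hyp` is Lipschitz and vanishes on a lattice that meets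
  -- every `R`-ball.
  · obtain ⟨R, hR⟩ := D.exists_lattice_bounded
    refine ⟨1 / 50 * R, fun x => ?_⟩
    obtain ⟨c, hc, hle⟩ := hR x
    have := near x c
    rw [blown_of_mem hc, sub_self, sub_zero] at this
    exact this.trans (by gcongr)

end Data

end BlowUp

namespace BlowUp

/-! ### Positive Lyapunov exponents -/

theorem NearHyp.iterate_unstable {G : Plane → Plane} (hG : NearHyp G) {x y : Plane}
    (h : |(x - y) 1| ≤ |(x - y) 0|) (n : ℕ) :
    16 ^ n * |(x - y) 0| ≤ |(G^[n] x - G^[n] y) 0| ∧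
      |(G^[n] x - G^[n] y) 1| ≤ |(G^[n] x - G^[n] y) 0| := by
  induction n with
  | zero => simpa using h
  | succ n ih =>
    rw [Function.iterate_succ_apply', Function.iterate_succ_apply']
    have h1 := hG.unstable _ _ ih.2
    have h2 := abs_nonneg ((G (G^[n] x) - G (G^[n] y)) 1)
    refine ⟨?_, by linarith [h1.2]⟩
    rw [pow_succ]
    linarith [ih.1, h1.1]

theorem NearHyp.iterate_cone {G : Plane → Plane} (hG : NearHyp G) {x y : Plane}
    (h : 2 * |(x - y) 1| ≤ |(x - y) 0|) (n : ℕ) :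
    2 * |(G^[n] x - G^[n] y) 1| ≤ |(G^[n] x - G^[n] y) 0| := by
  have h0 := abs_nonneg ((x - y) 1)
  cases n with
  | zero => exact h
  | succ n =>
    rw [Function.iterate_succ_apply', Function.iterate_succ_apply']
    exact (hG.unstable _ _ (hG.iterate_unstable (by linarith) n).2).2

theorem NearHyp.norm_sub_le {G : Plane → Plane} (hG : NearHyp G) (x y : Plane) :
    ‖G x - G y‖ ≤ 19 * ‖x - y‖ := by
  have h1 := hG x y
  have h2 := (norm_hyp_le (x - y)).trans (mul_le_mul_of_nonneg_right lam_le (norm_nonneg _))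
  calc ‖G x - G y‖ = ‖(G x - hyp x - (G y - hyp y)) + hyp (x - y)‖ := by
        rw [map_sub]; congr 1; abel
    _ ≤ 1 / 50 * ‖x - y‖ + 18 * ‖x - y‖ := (norm_add_le _ _).trans (add_le_add h1 h2)
    _ ≤ _ := by linarith [norm_nonneg (x - y)]

/-- Vectors in the unstable cone make a definite angle with vectors in the stable cone. -/
theorem inner_sq_le_of_cones {d x : Plane} (hd : 2 * |d 1| ≤ |d 0|) (hx : |x 0| ≤ |x 1|) :
    |inner ℝ d x| ≤ 19 / 20 * (‖d‖ * ‖x‖) := by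
  have hi : inner ℝ d x = d 0 * x 0 + d 1 * x 1 := by
    rw [PiLp.inner_apply]
    simp
    ring
  -- Lagrange's identity. The cones give `|inner| ≤ 3 |det|`, hence a squared cosine of at most
  -- `9/10 < (19/20)²`.
  have key : ‖d‖ ^ 2 * ‖x‖ ^ 2 = (inner ℝ d x) ^ 2 + (d 0 * x 1 - d 1 * x 0) ^ 2 := by
    rw [hi, plane_norm_sq, plane_norm_sq]
    ring
  have a0 := abs_nonneg (d 0)
  have a1 := abs_nonneg (d 1)
  have b0 := abs_nonneg (x 0)
  have b1 := abs_nonneg (x 1)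
  have p1 : |d 1| * |x 0| ≤ 1 / 2 * (|d 0| * |x 1|) := by
    calc _ ≤ (|d 0| / 2) * |x 1| := by gcongr; linarith
      _ = _ := by ring
  have p2 : |d 0| * |x 0| ≤ |d 0| * |x 1| := by gcongr
  have p3 : |d 1| * |x 1| ≤ 1 / 2 * (|d 0| * |x 1|) := by
    calc _ ≤ (|d 0| / 2) * |x 1| := by gcongr; linarith
      _ = _ := by ring
  have h1 : |inner ℝ d x| ≤ 3 / 2 * (|d 0| * |x 1|) := by
    rw [hi]
    refine (abs_add_le _ _).trans ?_
    rw [abs_mul, abs_mul]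
    linarith
  have h2 : 1 / 2 * (|d 0| * |x 1|) ≤ |d 0 * x 1 - d 1 * x 0| := by
    have := abs_sub_abs_le_abs_sub (d 0 * x 1) (d 1 * x 0)
    rw [abs_mul, abs_mul] at this
    linarith
  have h3 : |inner ℝ d x| ≤ 3 * |d 0 * x 1 - d 1 * x 0| := by linarith
  have h4 : (inner ℝ d x) ^ 2 ≤ 9 * (d 0 * x 1 - d 1 * x 0) ^ 2 := by
    rw [← sq_abs (inner ℝ d x), ← sq_abs (d 0 * x 1 - d 1 * x 0)]
    nlinarith [abs_nonneg (inner ℝ d x : ℝ)]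
  apply le_of_sq_le_sq _ (by positivity)
  rw [sq_abs, mul_pow, mul_pow, key]
  nlinarith [sq_nonneg (inner ℝ d x : ℝ)]

/-- Blowing out a point expands the directions transversal to the radius. -/
theorem le_norm_blowOut_sub {δ : ℝ} {x x' : Plane} (hx0 : x ≠ 0) (hx : |x 0| ≤ |x 1|)
    (hd : 2 * |(x' - x) 1| ≤ |(x' - x) 0|) (hn : ‖x' - x‖ ≤ 1 / 100 * ‖x‖) :
    1 / 4 * ‖x' - x‖ ≤ ‖blowOut δ x' - blowOut δ x‖ := by
  have hr : 0 < ‖x‖ := norm_pos_iff.2 hx0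
  have hr1 : ‖x‖ - ‖x' - x‖ ≤ ‖x'‖ := by
    have := norm_sub_norm_le x x'
    rw [norm_sub_rev] at this
    linarith
  have hr' : 99 / 100 * ‖x‖ ≤ ‖x'‖ := by linarith
  have hr'0 : 0 < ‖x'‖ := by linarith
  have kge : ∀ y : Plane, 0 < ‖y‖ → 1 ≤ √(‖y‖ ^ 2 + δ ^ 2) / ‖y‖ := fun y hy => by
    rw [le_div_iff₀ hy, one_mul, Real.le_sqrt' hy]
    nlinarith [sq_nonneg δ]
  set k := √(‖x‖ ^ 2 + δ ^ 2) / ‖x‖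
  set k' := √(‖x'‖ ^ 2 + δ ^ 2) / ‖x'‖
  have hk : 1 ≤ k := kge x hr
  have hk' : 1 ≤ k' := kge x' hr'0
  have hkk : 1 ≤ k' * k := by nlinarith
  have hcs : inner ℝ x' x ≤ ‖x'‖ * ‖x‖ := real_inner_le_norm x' x
  -- Squared distances split into a radial and a tangential part, and `blowOut` multiplies the
  -- tangential one by `k' k ≥ 1`. The radial part, which may be crushed, is dropped. By the angle
  -- between the cones it carries at most `(24/25)²` of `‖x' - x‖²`, and `1 - (24/25)² ≥ (1/4)²`.
  have e1 : ‖blowOut δ x' - blowOut δ x‖ ^ 2 =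
      (k' * ‖x'‖ - k * ‖x‖) ^ 2 + 2 * (k' * k) * (‖x'‖ * ‖x‖ - inner ℝ x' x) := by
    change ‖k' • x' - k • x‖ ^ 2 = _
    rw [norm_sub_sq_real, norm_smul, norm_smul, real_inner_smul_left, real_inner_smul_right,
      Real.norm_eq_abs, Real.norm_eq_abs, abs_of_pos (by linarith), abs_of_pos (by linarith)]
    ring
  have e2 : ‖x' - x‖ ^ 2 = (‖x'‖ - ‖x‖) ^ 2 + 2 * (‖x'‖ * ‖x‖ - inner ℝ x' x) := by
    rw [norm_sub_sq_real]
    ring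
  have e3 : (‖x'‖ - ‖x‖) * (‖x'‖ + ‖x‖) = 2 * inner ℝ (x' - x) x + ‖x' - x‖ ^ 2 := by
    rw [norm_sub_sq_real, inner_sub_left, real_inner_self_eq_norm_sq]
    ring
  have hc := abs_le.1 (inner_sq_le_of_cones hd hx)
  have hdn := norm_nonneg (x' - x)
  have hlip : |‖x'‖ - ‖x‖| ≤ 24 / 25 * ‖x' - x‖ := by
    have hs : 199 / 100 * ‖x‖ ≤ ‖x'‖ + ‖x‖ := by linarith
    have h5 : |‖x'‖ - ‖x‖| * (‖x'‖ + ‖x‖) ≤ (191 / 100) * (‖x' - x‖ * ‖x‖) := by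
      have h0 : |‖x'‖ - ‖x‖| * (‖x'‖ + ‖x‖) = |(‖x'‖ - ‖x‖) * (‖x'‖ + ‖x‖)| := by
        rw [abs_mul, abs_of_pos (show 0 < ‖x'‖ + ‖x‖ by linarith)]
      rw [h0, e3, abs_le]
      have h6 : ‖x' - x‖ ^ 2 ≤ 1 / 100 * (‖x' - x‖ * ‖x‖) := by nlinarith
      constructor <;> nlinarith [sq_nonneg ‖x' - x‖]
    have h7 : |‖x'‖ - ‖x‖| * (199 / 100 * ‖x‖) ≤ (191 / 100 * ‖x' - x‖) * ‖x‖ := by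
      refine le_trans ?_ (h5.trans (le_of_eq (by ring)))
      gcongr
    have h8 : |‖x'‖ - ‖x‖| * (199 / 100) ≤ 191 / 100 * ‖x' - x‖ := by
      refine le_of_mul_le_mul_right ?_ hr
      linarith
    linarith
  have hsq : (‖x'‖ - ‖x‖) ^ 2 ≤ (24 / 25) ^ 2 * ‖x' - x‖ ^ 2 := by
    rw [← sq_abs, ← mul_pow]
    exact pow_le_pow_left₀ (abs_nonneg _) hlip 2
  apply le_of_sq_le_sq _ (norm_nonneg _)
  rw [e1, mul_pow]
  have h9 : ‖x'‖ * ‖x‖ - inner ℝ x' x ≤ (k' * k) * (‖x'‖ * ‖x‖ - inner ℝ x' x) :=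
    le_mul_of_one_le_left (by linarith) hkk
  nlinarith [sq_nonneg (k' * ‖x'‖ - k * ‖x‖)]

namespace Data

variable {D : Data}

theorem eventually_not_mem_Lam {x : Plane} (hx : x ∉ D.Lam) : ∀ᶠ y in 𝓝 x, y ∉ D.Lam := by
  obtain ⟨c, hc, H⟩ := D.exists_lattice_near (ε₁ := D.ε / 2) x
  have hε := D.ε_pos
  have hne : x ≠ c := fun h => hx (h ▸ hc)
  filter_upwards [Metric.closedBall_mem_nhds x (show 0 < D.ε - D.ε / 2 by linarith),
    isOpen_ne.mem_nhds hne] with y hy hyc hyL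
  have := H y (by rwa [mem_closedBall_iff_norm] at hy) y hyL hyc
  rw [sub_self, norm_zero] at this
  linarith

theorem continuousAt_up {x : Plane} (hx : x ∉ D.Lam) : ContinuousAt D.up x :=
  (contDiffAt_up hx).continuousAt

variable (D) in
/-- Near `X`, the lift of `Ψ⁻¹` does not contract unstable directions by more than `κ`. -/
def Good (κ : ℝ) (X : Plane) : Prop :=
  ∀ᶠ X' in 𝓝 X, 2 * |(X' - X) 1| ≤ |(X' - X) 0| → κ * ‖X' - X‖ ≤ ‖D.up X' - D.up X‖

-- Away from the lattice `D.down` is Lipschitz at small scales and inverts `D.up`, so `D.up`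
-- contracts by a bounded factor only.
variable (D) in
theorem good_far {τ : ℝ} (hτ : 0 < τ) : ∃ κ, 0 < κ ∧ ∀ X, (∀ c ∈ D.Lam, τ ≤ ‖X - c‖) →
    D.Good κ X := by
  obtain ⟨t, ht, -, Ht⟩ := D.up_far (half_pos hτ)
  obtain ⟨M, g, hM, hg, HM⟩ := D.lift_lipschitz_far D.isProfile_ψ (b := D.δ + t) (by linarith)
  refine ⟨(M + 1)⁻¹, by positivity, fun X hX => ?_⟩
  have hXL := not_mem_of_far hτ hX
  have hc := (continuousAt_up hXL).eventually (Metric.closedBall_mem_nhds _ hg)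
  filter_upwards [hc, Metric.closedBall_mem_nhds X (half_pos hτ), eventually_not_mem_Lam hXL]
    with X' h1 h2 h3 _
  rw [dist_eq_norm] at h1
  rw [mem_closedBall_iff_norm] at h2
  have hX' : ∀ c ∈ D.Lam, τ / 2 ≤ ‖X' - c‖ := fun c hc => by
    have : ‖X - c‖ ≤ ‖X' - c‖ + ‖X' - X‖ := by
      calc _ = ‖(X' - c) - (X' - X)‖ := by congr 1; abel
        _ ≤ _ := norm_sub_le _ _
    linarith [hX c hc]
  have h4 : ‖D.down (D.up X') - D.down (D.up X)‖ ≤ M * ‖D.up X' - D.up X‖ :=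
    HM _ _ (Ht X' hX') (Ht X fun c hc => by linarith [hX c hc]) h1
  rw [(down_up h3).1, (down_up hXL).1] at h4
  rw [inv_mul_le_iff₀ (by positivity)]
  linarith [norm_nonneg (D.up X' - D.up X)]

/-- Arbitrarily close to the lattice, a point in the stable cone has its radius transversal to
unstable vectors, so crushing the radial component costs a uniform factor. -/
theorem good_stable {s₁ : ℝ} (hs : s₁ ≤ D.ε ^ 2)
    (h : ∀ s, 0 ≤ s → s ≤ s₁ → 2 * D.ψinv (s / 2) = s + D.δ ^ 2) {X c : Plane} (hc : c ∈ D.Lam)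
    (hX0 : X ≠ c) (hX : ‖X - c‖ ^ 2 < s₁) (hcone : |(X - c) 0| ≤ |(X - c) 1|) :
    D.Good (1 / 4) X := by
  have h0 : X - c ≠ 0 := sub_ne_zero.2 hX0
  have hp : 0 < ‖X - c‖ := norm_pos_iff.2 h0
  have hcont : ContinuousAt (fun X' : Plane => ‖X' - c‖ ^ 2) X := by fun_prop
  filter_upwards [hcont.eventually (gt_mem_nhds hX),
    Metric.closedBall_mem_nhds X (show 0 < 1 / 100 * ‖X - c‖ by positivity)] with X' h1 h2 h3
  rw [mem_closedBall_iff_norm] at h2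
  rw [up_inner hs h hc h1.le, up_inner hs h hc hX.le, add_sub_add_left_eq_sub]
  have := le_norm_blowOut_sub (δ := D.δ) (x := X - c) (x' := X' - c) h0 hcone
    (by simpa using h3) (by simpa using h2)
  simpa using this

/-- Every orbit outside the lattice has infinitely many good times. -/
theorem frequently_good {G : Plane → Plane} (hG : NearHyp G) (hGL : ∀ x ∈ D.Lam, G x = hyp x)
    (hGn : ∀ x ∉ D.Lam, G x ∉ D.Lam) {x : Plane} (hx : x ∉ D.Lam) :
    ∃ κ, 0 < κ ∧ ∃ᶠ n in atTop, D.Good κ (G^[n] x) := by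
  obtain ⟨s₁, hs₁, hs₁ε, -, hinv⟩ := D.exists_inner
  have hs₁' : s₁ ≤ D.ε ^ 2 := by nlinarith [sq_nonneg D.δ]
  have hε := D.ε_pos
  set τ := min (√s₁) (D.ε / 10) with hτdef
  have hτ : 0 < τ := lt_min (Real.sqrt_pos.2 hs₁) (by linarith)
  have hτε : 20 * τ ≤ 2 * D.ε := by linarith [min_le_right (√s₁) (D.ε / 10)]
  have hτs : τ ≤ √s₁ := min_le_left _ _
  have hnL : ∀ n, G^[n] x ∉ D.Lam := fun n => by
    induction n with
    | zero => exact hx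
    | succ n ih => rw [Function.iterate_succ_apply']; exact hGn _ ih
  -- Infinitely many visits at distance at least `τ` are all good times. Otherwise the orbit is
  -- eventually always within `τ` of the lattice.
  by_cases hfar : ∃ᶠ n in atTop, ∀ c ∈ D.Lam, τ ≤ ‖G^[n] x - c‖
  · obtain ⟨κ, hκ, H⟩ := D.good_far hτ
    exact ⟨κ, hκ, hfar.mono fun n hn => H _ hn⟩
  rw [not_frequently, eventually_atTop] at hfar
  obtain ⟨N, hN⟩ := hfar
  refine ⟨1 / 4, by norm_num, (eventually_atTop.2 ⟨N, fun n hn => ?_⟩).frequently⟩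
  have hnear := hN n hn
  push Not at hnear
  obtain ⟨c, hc, hlt⟩ := hnear
  have hne : G^[n] x ≠ c := fun h => hnL n (h ▸ hc)
  refine good_stable hs₁' hinv hc hne ?_ ?_
  · have := pow_lt_pow_left₀ (hlt.trans_le hτs) (norm_nonneg _) two_ne_zero
    rwa [Real.sq_sqrt hs₁.le] at this
  by_contra hcone
  rw [not_le] at hcone
  -- The nearby lattice point cannot switch orbits: one step separates points by a factor of at most
  -- 19, and `19 τ + τ ≤ 2ε`. So the orbit shadows that of `c` forever, whereas a difference in the
  -- unstable cone would grow like `16 ^ k`.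
  have stay : ∀ k, G^[k] c ∈ D.Lam ∧ ‖G^[k] (G^[n] x) - G^[k] c‖ < τ := by
    intro k
    induction k with
    | zero => exact ⟨hc, hlt⟩
    | succ k ih =>
      obtain ⟨i1, i2⟩ := ih
      have hmem : G^[k + 1] c ∈ D.Lam := by
        rw [Function.iterate_succ_apply', hGL _ i1]
        exact D.hyp_mem_Lam i1
      refine ⟨hmem, ?_⟩
      have h1 := hN (n + (k + 1)) (by omega)
      push Not at h1
      obtain ⟨c', hc', hlt'⟩ := h1
      rw [add_comm, Function.iterate_add_apply] at hlt'
      have h2 : ‖G^[k + 1] (G^[n] x) - G^[k + 1] c‖ ≤ 19 * τ := by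
        rw [Function.iterate_succ_apply', Function.iterate_succ_apply']
        refine (hG.norm_sub_le _ _).trans ?_
        gcongr
      have h3 : c' = G^[k + 1] c := by
        refine D.eq_of_near hc' hmem ?_
        calc _ = ‖(G^[k + 1] (G^[n] x) - G^[k + 1] c) - (G^[k + 1] (G^[n] x) - c')‖ := by
              congr 1; abel
          _ ≤ _ := (norm_sub_le _ _).trans (by linarith)
      rwa [← h3]
  have hd0 : 0 < |(G^[n] x - c) 0| := (abs_nonneg _).trans_lt hcone
  obtain ⟨k, hk⟩ := pow_unbounded_of_one_lt (τ / |(G^[n] x - c) 0|) (show (1 : ℝ) < 16 by norm_num)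
  rw [div_lt_iff₀ hd0] at hk
  have h1 := (hG.iterate_unstable hcone.le k).1
  have h2 := abs_coord_le (G^[k] (G^[n] x) - G^[k] c) 0
  linarith [(stay k).2]

/-- Positivity of the Lyapunov exponents of a map whose blow-down is a Lipschitz perturbation of
the hyperbolic map. -/
theorem lyapunov_pos {G : Plane → Plane} (hG : NearHyp G) (hGL : ∀ x ∈ D.Lam, G x = hyp x)
    (hGn : ∀ x ∉ D.Lam, G x ∉ D.Lam) {T : Torus → Torus}
    (hT : ∀ x ∉ D.Lam, T (D.cov (D.up x)) = D.cov (D.up (G x))) {p : Torus} (hp : p ∈ D.island)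
    (hdiff : ∀ n, ∃ A, HasTorusFDerivAt T^[n] A p) : 0 < lyapunov T p := by
  obtain ⟨w₀, rfl⟩ := D.cov_surjective p
  rw [cov_mem_island] at hp
  obtain ⟨hup, hx⟩ := up_down hp
  set x := D.down w₀
  have hnL : ∀ n, ∀ y ∉ D.Lam, G^[n] y ∉ D.Lam := fun n y hy => by
    induction n with
    | zero => exact hy
    | succ n ih => rw [Function.iterate_succ_apply']; exact hGn _ ih
  have hTn : ∀ n, ∀ y ∉ D.Lam, T^[n] (D.cov (D.up y)) = D.cov (D.up (G^[n] y)) := fun n y hy => by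
    induction n with
    | zero => rfl
    | succ n ih =>
      rw [Function.iterate_succ_apply', Function.iterate_succ_apply', ih, hT _ (hnL n y hy)]
  obtain ⟨κ, hκ, hfreq⟩ := frequently_good hG hGL hGn hx
  obtain ⟨C, hC⟩ := ((contDiffAt_up hx).differentiableAt (by simp)).hasFDerivAt.isBigO_sub.bound
  set e : Plane := EuclideanSpace.single 0 1 with he
  have he0 : e 0 = 1 := by simp [he]
  have he1 : e 1 = 0 := by simp [he]
  have hen : ‖e‖ = 1 := by simp [he]
  set Q : ℝ := ‖(D.P : Plane →L[ℝ] Plane)‖ * ‖(D.P.symm : Plane →L[ℝ] Plane)‖ * (|C| + 1) with hQ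
  have hQ0 : 0 ≤ Q := by positivity
  have hline : Tendsto (fun t : ℝ => x + t • e) (𝓝 0) (𝓝 x) := by
    have : Continuous (fun t : ℝ => x + t • e) := by fun_prop
    simpa using this.tendsto 0
  -- Differentiability of `G` is not available, so finite differences along `x + t • e` are used.
  -- The cones and goodness bound them below by `κ 16 ^ n t`, the derivative `A` of `T^[n]` above by
  -- `Q (‖A‖ + 1) t`.
  have bound : ∀ n, D.Good κ (G^[n] x) → ∀ A, HasTorusFDerivAt T^[n] A (D.cov w₀) →
      κ * 16 ^ n ≤ Q * (‖A‖ + 1) := by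
    intro n hgood A hA
    obtain ⟨z, g, hz, hg, hgA⟩ := hA
    set l := D.P z - w₀ with hl
    have hlL : l ∈ D.L := by
      rw [← D.cov_eq_iff, ← hz, cov, ContinuousLinearEquiv.symm_apply_apply]
    let v : ℝ → Plane := fun t => D.P.symm (D.up (x + t • e) + l)
    have hv0 : v 0 = z := by
      simp only [v, zero_smul, add_zero, hup, hl]
      rw [add_sub_cancel, ContinuousLinearEquiv.symm_apply_apply]
    have hupc : Tendsto (fun t : ℝ => D.up (x + t • e)) (𝓝 0) (𝓝 (D.up x)) :=
      (continuousAt_up hx).tendsto.comp hline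
    have hvc : Tendsto v (𝓝 0) (𝓝 z) := by
      have h1 : Tendsto v (𝓝 0) (𝓝 (D.P.symm (D.up x + l))) :=
        (D.P.symm.continuous.tendsto _).comp (hupc.add_const l)
      rwa [hup, hl, add_sub_cancel, ContinuousLinearEquiv.symm_apply_apply] at h1
    have hnot : ∀ᶠ t : ℝ in 𝓝 0, x + t • e ∉ D.Lam := hline.eventually (eventually_not_mem_Lam hx)
    have hGc : Continuous (G^[n]) := hG.continuous.iterate n
    let f : ℝ → Plane := fun t => D.up (G^[n] (x + t • e))
    have hfc : Tendsto f (𝓝 0) (𝓝 (f 0)) := by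
      have h1 : Tendsto (fun t : ℝ => G^[n] (x + t • e)) (𝓝 0) (𝓝 (G^[n] x)) :=
        (hGc.tendsto x).comp hline
      have h2 : Tendsto f (𝓝 0) (𝓝 (D.up (G^[n] x))) :=
        (continuousAt_up (hnL n x hx)).tendsto.comp h1
      simpa [f] using h2
    have hcovf : ∀ᶠ t : ℝ in 𝓝 0, D.cov (f t) = D.cov (D.P (g (v t))) := by
      filter_upwards [hvc.eventually hg, hnot] with t h1 h2
      have h3 : proj (v t) = D.cov (D.up (x + t • e)) := by
        change D.cov (D.up (x + t • e) + l) = _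
        rw [cov_eq_iff, add_sub_cancel_left]
        exact hlL
      rw [cov, cov, ContinuousLinearEquiv.symm_apply_apply, h1, h3, hTn n _ h2]
      rfl
    have hgc : Tendsto (fun t => D.P (g (v t))) (𝓝 0) (𝓝 (D.P (g z))) :=
      (D.P.continuous.tendsto _).comp (hgA.continuousAt.tendsto.comp hvc)
    have hcov0 : D.cov (f 0) = D.cov (D.P (g z)) := by
      have := hcovf.self_of_nhds
      rwa [hv0] at this
    -- Both paths lift the same path on the torus. Their increments differ by an element of `D.L`
    -- that tends to `0`, hence vanishes for small `t`.
    have heq : ∀ᶠ t : ℝ in 𝓝 0, f t - f 0 = D.P (g (v t)) - D.P (g z) := by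
      have h1 : Tendsto (fun t => (f t - f 0) - (D.P (g (v t)) - D.P (g z))) (𝓝 0) (𝓝 0) := by
        have := (hfc.sub_const (f 0)).sub (hgc.sub_const (D.P (g z)))
        simpa using this
      filter_upwards [hcovf, h1.eventually (Metric.closedBall_mem_nhds 0
        (show 0 < 2 * D.ε by linarith [D.ε_pos]))] with t h2 h3
      rw [dist_zero_right] at h3
      have h4 : (f t - f 0) - (D.P (g (v t)) - D.P (g z)) ∈ D.L := by
        have := D.L.sub_mem (D.cov_eq_iff.1 h2) (D.cov_eq_iff.1 hcov0)
        convert this using 1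
        abel
      exact sub_eq_zero.1 (D.eq_of_near (D.L_le_Lam h4) D.Lam.zero_mem (by simpa using h3))
    have hglip : ∀ᶠ t : ℝ in 𝓝 0, ‖g (v t) - g z‖ ≤ (‖A‖ + 1) * ‖v t - z‖ := by
      have h1 := hvc.eventually (hgA.isLittleO.bound (show (0 : ℝ) < 1 by norm_num))
      filter_upwards [h1] with t h2
      have h3 := A.le_opNorm (v t - z)
      calc _ = ‖(g (v t) - g z - A (v t - z)) + A (v t - z)‖ := by congr 1; abel
        _ ≤ 1 * ‖v t - z‖ + ‖A‖ * ‖v t - z‖ := (norm_add_le _ _).trans (add_le_add h2 h3)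
        _ = _ := by ring
    have hGt : Tendsto (fun t : ℝ => G^[n] (x + t • e)) (𝓝 0) (𝓝 (G^[n] x)) :=
      (hGc.tendsto x).comp hline
    have hall := (heq.and (hglip.and ((hline.eventually hC).and (hGt.eventually hgood))))
    have hpos : ∃ᶠ t : ℝ in 𝓝 0, 0 < t := by
      have : (𝓝[>] (0 : ℝ)).NeBot := inferInstance
      exact (eventually_mem_nhdsWithin.frequently (f := 𝓝[>] (0 : ℝ))).filter_mono
        nhdsWithin_le_nhds
    obtain ⟨t, ht, h1, h2, h3, h4⟩ := (hpos.and_eventually hall).exists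
    have hdiff0 : (x + t • e - x) 0 = t := by simp [he0]
    have hdiff1 : (x + t • e - x) 1 = 0 := by simp [he1]
    have hcone : 2 * |(x + t • e - x) 1| ≤ |(x + t • e - x) 0| := by
      rw [hdiff0, hdiff1]
      simp
    have h5 := h4 (hG.iterate_cone hcone n)
    have h6 := (hG.iterate_unstable (x := x + t • e) (y := x) (by
      rw [hdiff0, hdiff1]
      simp) n).1
    rw [hdiff0, abs_of_pos ht] at h6
    have h7 := abs_coord_le (G^[n] (x + t • e) - G^[n] x) 0
    have hf0 : f 0 = D.up (G^[n] x) := by simp [f]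
    have h8 : κ * (16 ^ n * t) ≤ ‖f t - f 0‖ := by
      rw [hf0]
      refine le_trans ?_ h5
      gcongr
      linarith
    have hvz : v t - z = D.P.symm (D.up (x + t • e) - D.up x) := by
      rw [← hv0]
      simp only [v, zero_smul, add_zero]
      rw [← map_sub, add_sub_add_right_eq_sub]
    have h9 : ‖v t - z‖ ≤ ‖(D.P.symm : Plane →L[ℝ] Plane)‖ * ((|C| + 1) * t) := by
      rw [hvz]
      refine ((D.P.symm : Plane →L[ℝ] Plane).le_opNorm _).trans ?_
      gcongr
      refine h3.trans ?_
      rw [add_sub_cancel_left, norm_smul, hen, mul_one, Real.norm_eq_abs, abs_of_pos ht]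
      gcongr
      linarith [le_abs_self C]
    have h10 : ‖f t - f 0‖ ≤ ‖(D.P : Plane →L[ℝ] Plane)‖ * ((‖A‖ + 1) * ‖v t - z‖) := by
      rw [h1, ← map_sub]
      refine ((D.P : Plane →L[ℝ] Plane).le_opNorm _).trans ?_
      gcongr
    have h11 : (κ * 16 ^ n) * t ≤ (Q * (‖A‖ + 1)) * t := by
      calc _ = κ * (16 ^ n * t) := by ring
        _ ≤ ‖(D.P : Plane →L[ℝ] Plane)‖ * ((‖A‖ + 1) *
            (‖(D.P.symm : Plane →L[ℝ] Plane)‖ * ((|C| + 1) * t))) := by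
          refine h8.trans (h10.trans ?_)
          gcongr
        _ = _ := by rw [hQ]; ring
    exact le_of_mul_le_mul_right h11 ht
  have hspec : ∀ n, HasTorusFDerivAt T^[n] (torusFDeriv T^[n] (D.cov w₀)) (D.cov w₀) := fun n => by
    rw [torusFDeriv, dif_pos (hdiff n)]
    exact (hdiff n).choose_spec
  -- The surplus of `16 ^ n` over `2 ^ n` absorbs all constants, leaving the exponent at least `log
  -- 2`.
  have hlarge : ∀ᶠ n : ℕ in atTop, (Q + 1) * (2 * 2 ^ n) ≤ κ * 16 ^ n := by
    have h1 : Tendsto (fun n : ℕ => κ * (8 : ℝ) ^ n) atTop atTop :=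
      (tendsto_pow_atTop_atTop_of_one_lt (by norm_num)).const_mul_atTop hκ
    filter_upwards [h1.eventually_ge_atTop ((Q + 1) * 2)] with n hn
    have : (16 : ℝ) ^ n = 8 ^ n * 2 ^ n := by rw [← mul_pow]; norm_num
    rw [this, ← mul_assoc, ← mul_assoc]
    gcongr
  have hlog : (0 : ℝ) < Real.log 2 := Real.log_pos (by norm_num)
  have hfin : ∃ᶠ n : ℕ in atTop, ((Real.log 2 : ℝ) : EReal) ≤
      ((1 / (n : ℝ) * Real.log ‖torusFDeriv T^[n] (D.cov w₀)‖ : ℝ) : EReal) := by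
    refine (hfreq.and_eventually (hlarge.and (eventually_gt_atTop 0))).mono ?_
    rintro n ⟨h1, h2, h3⟩
    have h4 := bound n h1 _ (hspec n)
    set a := ‖torusFDeriv T^[n] (D.cov w₀)‖
    have ha : 0 ≤ a := norm_nonneg _
    have h5 : (2 : ℝ) ^ n ≤ a := by
      have h6 : (Q + 1) * (2 * 2 ^ n) ≤ (Q + 1) * (a + 1) := by linarith
      have h7 := le_of_mul_le_mul_left h6 (by linarith)
      have h8 : (1 : ℝ) ≤ 2 ^ n := one_le_pow₀ (by norm_num)
      linarith
    have h6 : n * Real.log 2 ≤ Real.log a := by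
      rw [← Real.log_pow]
      exact Real.log_le_log (by positivity) h5
    rw [EReal.coe_le_coe_iff, one_div, ← div_eq_inv_mul, le_div_iff₀ (by exact_mod_cast h3)]
    linarith
  refine lt_of_lt_of_le (EReal.coe_pos.2 hlog) ?_
  exact le_limsup_of_frequently_le hfin

end Data

end BlowUp

/-! ### Transitivity modulo the lattice -/

namespace BlowUp

theorem iterate_hyp_zero (n : ℕ) (w : Plane) : (hyp^[n] w) 0 = lam ^ n * w 0 := by
  induction n with
  | zero => simp
  | succ n ih => rw [Function.iterate_succ_apply', hyp_zero, ih, pow_succ]; ring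

theorem iterate_hyp_one (n : ℕ) (w : Plane) : (hyp^[n] w) 1 = lam⁻¹ ^ n * w 1 := by
  induction n with
  | zero => simp
  | succ n ih => rw [Function.iterate_succ_apply', hyp_one, ih, pow_succ]; ring

/-- A nonzero additive subgroup of the line that is invariant under multiplication by `λ⁻¹` is
dense. -/
theorem dense_of_lam_inv {S : AddSubgroup ℝ} (h0 : S ≠ ⊥) (hS : ∀ a ∈ S, lam⁻¹ * a ∈ S) :
    Dense (S : Set ℝ) := by
  rcases S.dense_or_cyclic with h | ⟨a, ha⟩
  · exact h
  exfalso
  rw [← AddSubgroup.zmultiples_eq_closure] at ha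
  have ha0 : a ≠ 0 := by
    rintro rfl
    exact h0 (by rw [ha, AddSubgroup.zmultiples_zero_eq_bot])
  have h1 := hS a (by rw [ha]; exact AddSubgroup.mem_zmultiples a)
  rw [ha] at h1
  obtain ⟨k, hk⟩ := AddSubgroup.mem_zmultiples_iff.1 h1
  rw [zsmul_eq_mul] at hk
  have hk' := mul_right_cancel₀ ha0 hk
  have p := lam_inv_pos
  have q := lam_inv_le
  rw [← hk'] at p q
  have p' : 0 < k := by exact_mod_cast p
  have q' : (k : ℝ) < 1 := by linarith
  have q'' : k < 1 := by exact_mod_cast q'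
  omega

namespace Data

variable {D : Data}

variable (D) in
/-- The values of a coordinate on the lattice. -/
def coordValues (i : Fin 2) : AddSubgroup ℝ :=
  D.L.map (EuclideanSpace.proj i : Plane →L[ℝ] ℝ).toLinearMap.toAddMonoidHom

theorem mem_coordValues {i : Fin 2} {a : ℝ} : a ∈ D.coordValues i ↔ ∃ l ∈ D.L, l i = a := Iff.rfl

theorem coordValues_ne_bot (i : Fin 2) : D.coordValues i ≠ ⊥ := by
  intro h
  have hz : ∀ l ∈ D.L, l i = 0 := fun l hl => by
    have : l i ∈ D.coordValues i := mem_coordValues.2 ⟨l, hl, rfl⟩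
    rwa [h, AddSubgroup.mem_bot] at this
  have hP : ∀ j, D.P (EuclideanSpace.single j 1) i = 0 := fun j => by
    apply hz
    rw [mem_L]
    intro k
    rw [ContinuousLinearEquiv.symm_apply_apply]
    by_cases hjk : k = j
    · exact ⟨1, by simp [hjk]⟩
    · exact ⟨0, by simp [hjk]⟩
  obtain ⟨z, hzz⟩ := D.P.surjective (EuclideanSpace.single i 1)
  have e : z = z 0 • EuclideanSpace.single 0 1 + z 1 • EuclideanSpace.single 1 1 := by
    apply plane_ext <;> simp
  rw [e, map_add, map_smul, map_smul] at hzz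
  have h1 := congrArg (fun v : Plane => v i) hzz
  simp [hP] at h1

/-- Multiplication by `lam⁻¹` is realised by `hyp.symm` on the first coordinate and by `hyp` on the
second, both of which preserve `D.L`. -/
theorem dense_coordValues (i : Fin 2) : Dense (D.coordValues i : Set ℝ) := by
  refine dense_of_lam_inv (coordValues_ne_bot i) fun a ha => ?_
  obtain ⟨l, hl, rfl⟩ := mem_coordValues.1 ha
  fin_cases i
  · exact mem_coordValues.2 ⟨hyp.symm l, D.hyp_symm_mem_L hl, rfl⟩
  · exact mem_coordValues.2 ⟨hyp l, D.hyp_mem_L hl, rfl⟩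

theorem iterate_hyp_mem_L {l : Plane} (hl : l ∈ D.L) (n : ℕ) : hyp^[n] l ∈ D.L := by
  induction n with
  | zero => exact hl
  | succ n ih => rw [Function.iterate_succ_apply']; exact D.hyp_mem_L ih

/-- Topological transitivity of the hyperbolic map modulo the lattice. -/
theorem exists_transit {x y : Plane} {U V : Set Plane} (hU : U ∈ 𝓝 x) (hV : V ∈ 𝓝 y) :
    ∃ n, ∃ z ∈ U, ∃ l ∈ D.L, hyp^[n] z + l ∈ V := by
  obtain ⟨r, hr, hrU⟩ := Metric.mem_nhds_iff.1 hU
  obtain ⟨r', hr', hrV⟩ := Metric.mem_nhds_iff.1 hV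
  obtain ⟨a, ha, haS⟩ := (dense_coordValues (D := D) 0).exists_dist_lt (x 0) (half_pos hr)
  obtain ⟨l₁, hl₁, rfl⟩ := mem_coordValues.1 ha
  obtain ⟨b, hb, hbS⟩ := (dense_coordValues (D := D) 1).exists_dist_lt (y 1) (half_pos hr')
  obtain ⟨l₂, hl₂, rfl⟩ := mem_coordValues.1 hb
  set t := y 0 - l₂ 0
  set s := x 1 - l₁ 1
  have hpow : Tendsto (fun n : ℕ => lam⁻¹ ^ n) atTop (𝓝 0) :=
    tendsto_pow_atTop_nhds_zero_of_lt_one lam_inv_pos.le (lam_inv_le.trans_lt (by norm_num))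
  have ht : Tendsto (fun n : ℕ => |lam⁻¹ ^ n * t|) atTop (𝓝 0) := by
    simpa using (hpow.mul_const t).abs
  have hs : Tendsto (fun n : ℕ => |lam⁻¹ ^ n * s|) atTop (𝓝 0) := by
    simpa using (hpow.mul_const s).abs
  obtain ⟨n, h1, h2⟩ := ((ht.eventually (gt_mem_nhds (half_pos hr))).and
    (hs.eventually (gt_mem_nhds (half_pos hr')))).exists
  rw [Real.dist_eq] at haS hbS
  -- Relative to `l₁` the point is `(lam⁻¹ ^ n t, s)`, so `hyp^[n]` sends it to `(t, lam⁻¹ ^ n s)`.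
  -- Relative to `l₂` this has the first coordinate of `y` exactly and the second one approximately.
  -- Only `l₁ 0 ≈ x 0` and `l₂ 1 ≈ y 1` are needed.
  refine ⟨n, !₂[l₁ 0 + lam⁻¹ ^ n * t, x 1], hrU ?_, l₂ - hyp^[n] l₁,
    D.L.sub_mem hl₂ (iterate_hyp_mem_L hl₁ n), hrV ?_⟩
  · rw [mem_ball_iff_norm]
    refine (plane_norm_le _).trans_lt ?_
    have e0 : (!₂[l₁ 0 + lam⁻¹ ^ n * t, x 1] - x) 0 = lam⁻¹ ^ n * t - (x 0 - l₁ 0) := by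
      simp; ring
    have e1 : (!₂[l₁ 0 + lam⁻¹ ^ n * t, x 1] - x) 1 = 0 := by simp
    rw [e0, e1, abs_zero, add_zero]
    refine (abs_sub _ _).trans_lt ?_
    linarith
  · rw [mem_ball_iff_norm]
    refine (plane_norm_le _).trans_lt ?_
    have hl : lam ^ n * lam⁻¹ ^ n = 1 := by rw [← mul_pow, lam_mul_inv, one_pow]
    have e0 : (hyp^[n] !₂[l₁ 0 + lam⁻¹ ^ n * t, x 1] + (l₂ - hyp^[n] l₁) - y) 0 = 0 := by
      simp only [PiLp.add_apply, PiLp.sub_apply, iterate_hyp_zero]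
      simp only [Matrix.cons_val_zero]
      calc _ = (lam ^ n * lam⁻¹ ^ n) * t - t := by simp only [t]; ring
        _ = 0 := by rw [hl]; ring
    have e1 : (hyp^[n] !₂[l₁ 0 + lam⁻¹ ^ n * t, x 1] + (l₂ - hyp^[n] l₁) - y) 1 =
        lam⁻¹ ^ n * s - (y 1 - l₂ 1) := by
      simp only [PiLp.add_apply, PiLp.sub_apply, iterate_hyp_one]
      simp only [Matrix.cons_val_one, Matrix.cons_val_fin_one, s]
      ring
    rw [e0, e1, abs_zero, zero_add]
    refine (abs_sub _ _).trans_lt ?_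
    linarith

/-! ### Maps of the island -/

theorem exists_of_mem_island {p : Torus} (hp : p ∈ D.island) :
    ∃ x ∉ D.Lam, D.cov (D.up x) = p := by
  obtain ⟨w, rfl⟩ := D.cov_surjective p
  obtain ⟨h1, h2⟩ := up_down (cov_mem_island.1 hp)
  exact ⟨D.down w, h2, by rw [h1]⟩

theorem cov_up_mem_island {x : Plane} (hx : x ∉ D.Lam) : D.cov (D.up x) ∈ D.island :=
  cov_mem_island.2 (down_up hx).2

theorem cov_up_eq {x y l : Plane} (hl : l ∈ D.L) (h : x = y + l) :
    D.cov (D.up x) = D.cov (D.up y) := by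
  rw [h, up, lift_add (D.L_le_Lam hl), cov_eq_iff, add_sub_cancel_left]
  exact hl

theorem cov_up_inj {x y : Plane} (hx : x ∉ D.Lam) (hy : y ∉ D.Lam)
    (h : D.cov (D.up x) = D.cov (D.up y)) : x - y ∈ D.L := by
  have hl := D.cov_eq_iff.1 h
  have h1 : D.up x = D.up y + (D.up x - D.up y) := by abel
  have h2 := congrArg D.down h1
  rw [(down_up hx).1, down, lift_add (D.L_le_Lam hl)] at h2
  have h3 : D.lift D.ψ (D.up y) = y := (down_up hy).1
  rw [h3] at h2
  rw [h2, add_sub_cancel_left]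
  exact hl

variable (D) in
/-- A homeomorphism of the plane that fixes the points of `Λ` and commutes with the deck
transformations. -/
structure Equivariant (H : Plane ≃ₜ Plane) : Prop where
  fix : ∀ x ∈ D.Lam, H x = x
  add : ∀ x, ∀ l ∈ D.L, H (x + l) = H x + l

namespace Equivariant

variable {H : Plane ≃ₜ Plane}

theorem symm (hH : D.Equivariant H) : D.Equivariant H.symm where
  fix := fun x hx => by rw [H.symm_apply_eq, hH.fix x hx]
  add := fun x l hl => by rw [H.symm_apply_eq, hH.add _ l hl, H.apply_symm_apply]

theorem not_mem (hH : D.Equivariant H) {x : Plane} (hx : x ∉ D.Lam) :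
    H x ∉ D.Lam := fun h => hx (by
  have := hH.symm.fix _ h
  rw [H.symm_apply_apply] at this
  rwa [this])

end Equivariant

variable (D) in
/-- The map of the torus covered by an equivariant map of the blown-down plane. -/
def islandMap (H : Plane → Plane) (p : Torus) : Torus :=
  D.PsiInv (D.cov (H (Function.surjInv D.cov_surjective (D.Psi p))))

/-- The arbitrary preimage in `islandMap` differs from `D.down w` by a deck translation, which
equivariance carries through. -/
theorem islandMap_cov {H : Plane ≃ₜ Plane} (hH : D.Equivariant H) (w : Plane) :
    D.islandMap H (D.cov w) = D.cov (D.up (H (D.down w))) := by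
  rw [islandMap, Psi, surgery_cov, PsiInv, surgery_cov]
  set q := Function.surjInv D.cov_surjective (D.cov (D.lift D.ψ w)) with hq
  have h1 : D.cov q = D.cov (D.lift D.ψ w) := Function.surjInv_eq D.cov_surjective _
  have hl := D.cov_eq_iff.1 h1
  have h2 : q = D.lift D.ψ w + (q - D.lift D.ψ w) := by abel
  refine cov_up_eq hl ?_
  nth_rewrite 1 [h2]
  rw [hH.add _ _ hl]

theorem islandMap_cov_up {H : Plane ≃ₜ Plane} (hH : D.Equivariant H) {x : Plane}
    (hx : x ∉ D.Lam) : D.islandMap H (D.cov (D.up x)) = D.cov (D.up (H x)) := by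
  rw [islandMap_cov hH, (down_up hx).1]

theorem continuousAt_islandMap {H : Plane ≃ₜ Plane} (hH : D.Equivariant H) {p : Torus}
    (hp : p ∈ D.island) : ContinuousAt (D.islandMap H) p := by
  obtain ⟨w, rfl⟩ := D.cov_surjective p
  have hw := cov_mem_island.1 hp
  have hn : 𝓝 (D.cov w) = map D.cov (𝓝 w) :=
    (D.isOpenMap_cov.map_nhds_eq D.continuous_cov.continuousAt).symm
  rw [ContinuousAt, hn, tendsto_map'_iff, islandMap_cov hH]
  have h1 : D.islandMap H ∘ D.cov = fun w => D.cov (D.up (H (D.down w))) :=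
    funext (islandMap_cov hH)
  rw [h1]
  have h2 := (contDiffAt_down hw).continuousAt
  have h3 : ContinuousAt (fun w => H (D.down w)) w := H.continuous.continuousAt.comp h2
  have h4 : ContinuousAt (fun w => D.up (H (D.down w))) w :=
    ContinuousAt.comp (f := fun w => H (D.down w))
      (continuousAt_up (hH.not_mem (up_down hw).2)) h3
  exact D.continuous_cov.continuousAt.comp h4

/-- The homeomorphism of the island covered by an equivariant homeomorphism. -/
def islandHomeo {H : Plane ≃ₜ Plane} (hH : D.Equivariant H) : D.island ≃ₜ D.island where
  toFun p := ⟨D.islandMap H p, by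
    obtain ⟨x, hx, h⟩ := exists_of_mem_island p.2
    rw [← h, islandMap_cov_up hH hx]
    exact cov_up_mem_island (hH.not_mem hx)⟩
  invFun p := ⟨D.islandMap H.symm p, by
    obtain ⟨x, hx, h⟩ := exists_of_mem_island p.2
    rw [← h, islandMap_cov_up hH.symm hx]
    exact cov_up_mem_island (hH.symm.not_mem hx)⟩
  left_inv p := Subtype.ext (by
    obtain ⟨x, hx, h⟩ := exists_of_mem_island p.2
    dsimp only
    rw [← h, islandMap_cov_up hH hx, islandMap_cov_up hH.symm (hH.not_mem hx), H.symm_apply_apply])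
  right_inv p := Subtype.ext (by
    obtain ⟨x, hx, h⟩ := exists_of_mem_island p.2
    dsimp only
    rw [← h, islandMap_cov_up hH.symm hx, islandMap_cov_up hH (hH.symm.not_mem hx),
      H.apply_symm_apply])
  continuous_toFun := by
    refine Continuous.subtype_mk (continuous_iff_continuousAt.2 fun p => ?_) _
    exact (continuousAt_islandMap hH p.2).comp continuous_subtype_val.continuousAt
  continuous_invFun := by
    refine Continuous.subtype_mk (continuous_iff_continuousAt.2 fun p => ?_) _
    exact (continuousAt_islandMap hH.symm p.2).comp continuous_subtype_val.continuousAt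

/-! ### Transfer of the dynamics to the island -/

variable (D) in
/-- On the island, `T` is covered by a map `G` of the blown-down plane which is conjugate to the
hyperbolic map by `H`. -/
structure Models (T : Torus → Torus) (G : Plane → Plane) (H : Plane ≃ₜ Plane) : Prop where
  near : NearHyp G
  onLam : ∀ x ∈ D.Lam, G x = hyp x
  offLam : ∀ x ∉ D.Lam, G x ∉ D.Lam
  equivariant : D.Equivariant H
  conj : ∀ x, H (hyp x) = G (H x)
  covers : ∀ x ∉ D.Lam, T (D.cov (D.up x)) = D.cov (D.up (G x))

namespace Models

variable {T : Torus → Torus} {G : Plane → Plane} {H : Plane ≃ₜ Plane}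

/-- Write `G = H ∘ hyp ∘ H⁻¹`. All three factors are invertible and respect `D.L` and `D.Lam`, so
injectivity and surjectivity pass to the quotient. -/
theorem bijOn (h : D.Models T G H) : BijOn T D.island D.island := by
  have hG : ∀ x, G x = H (hyp (H.symm x)) := fun x => by
    rw [h.conj, H.apply_symm_apply]
  refine ⟨fun p hp => ?_, fun p hp q hq hpq => ?_, fun p hp => ?_⟩
  · obtain ⟨x, hx, rfl⟩ := exists_of_mem_island hp
    rw [h.covers x hx]
    exact cov_up_mem_island (h.offLam x hx)
  · obtain ⟨x, hx, rfl⟩ := exists_of_mem_island hp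
    obtain ⟨y, hy, rfl⟩ := exists_of_mem_island hq
    rw [h.covers x hx, h.covers y hy] at hpq
    have hl := cov_up_inj (h.offLam x hx) (h.offLam y hy) hpq
    set l := G x - G y
    have hl' := D.hyp_symm_mem_L hl
    refine cov_up_eq hl' ?_
    have h1 : G x = G y + l := by simp only [l]; abel
    rw [hG, hG, ← h.equivariant.add _ l hl] at h1
    have h2 := H.injective h1
    have h3 : hyp (H.symm x) = hyp (H.symm y + hyp.symm l) := by
      rw [h2, map_add, ContinuousLinearEquiv.apply_symm_apply]
    have h4 := hyp.injective h3
    rw [← h.equivariant.symm.add _ _ hl'] at h4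
    exact H.symm.injective h4
  · obtain ⟨y, hy, rfl⟩ := exists_of_mem_island hp
    have hGx : G (H (hyp.symm (H.symm y))) = y := by
      rw [← h.conj, ContinuousLinearEquiv.apply_symm_apply, H.apply_symm_apply]
    have hx : H (hyp.symm (H.symm y)) ∉ D.Lam := fun hm => by
      apply hy
      rw [← hGx, h.onLam _ hm]
      exact D.hyp_mem_Lam hm
    exact ⟨_, cov_up_mem_island hx, by rw [h.covers _ hx, hGx]⟩

theorem iterate_covers (h : D.Models T G H) (n : ℕ) {y : Plane} (hy : y ∉ D.Lam) :
    T^[n] (D.cov (D.up (H y))) = D.cov (D.up (H (hyp^[n] y))) := by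
  have hn : ∀ n, hyp^[n] y ∉ D.Lam := fun n => by
    induction n with
    | zero => exact hy
    | succ n ih => rw [Function.iterate_succ_apply']; exact mt D.hyp_mem_Lam_iff.1 ih
  induction n with
  | zero => rfl
  | succ n ih =>
    rw [Function.iterate_succ_apply', ih, h.covers _ (h.equivariant.not_mem (hn n)),
      Function.iterate_succ_apply', h.conj]

theorem transitiveOn (h : D.Models T G H) : TransitiveOn T D.island := by
  refine ⟨h.bijOn.image_eq, fun U V hU hV hUK hVK => ?_⟩
  have prep : ∀ W : Set Torus, IsOpen W → (W ∩ D.island).Nonempty →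
      ∃ y, ∀ᶠ z in 𝓝 y, z ∉ D.Lam ∧ D.cov (D.up (H z)) ∈ W := by
    rintro W hW ⟨p, hpW, hp⟩
    obtain ⟨x, hx, rfl⟩ := exists_of_mem_island hp
    refine ⟨H.symm x, (eventually_not_mem_Lam (h.equivariant.symm.not_mem hx)).and ?_⟩
    have h1 : ContinuousAt (fun z => D.up (H z)) (H.symm x) := by
      have h0 : ContinuousAt D.up (H (H.symm x)) := by
        rw [H.apply_symm_apply]
        exact continuousAt_up hx
      exact h0.comp H.continuous.continuousAt
    have h2 : ContinuousAt (fun z => D.cov (D.up (H z))) (H.symm x) :=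
      D.continuous_cov.continuousAt.comp h1
    refine h2.eventually (hW.mem_nhds ?_)
    dsimp only
    rwa [H.apply_symm_apply]
  obtain ⟨y, hy⟩ := prep U hU hUK
  obtain ⟨y', hy'⟩ := prep V hV hVK
  obtain ⟨n, z, ⟨hz, hzU⟩, l, hl, hm, hlV⟩ := exists_transit (D := D) hy hy'
  refine ⟨n, T^[n] (D.cov (D.up (H z))),
    ⟨_, ⟨hzU, cov_up_mem_island (h.equivariant.not_mem hz)⟩, rfl⟩, ?_⟩
  rw [h.iterate_covers n hz, ← cov_up_eq (x := H (hyp^[n] z + l)) hl (h.equivariant.add _ _ hl)]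
  exact ⟨hlV, cov_up_mem_island (h.equivariant.not_mem hm)⟩

theorem lyapunov_pos (h : D.Models T G H) {p : Torus} (hp : p ∈ D.island)
    (hdiff : ∀ n, ∃ A, HasTorusFDerivAt T^[n] A p) : 0 < lyapunov T p :=
  Data.lyapunov_pos h.near h.onLam h.offLam h.covers hp hdiff

end Models

variable (D) in
theorem models_hatF : D.Models D.hatF hyp (Homeomorph.refl Plane) where
  near := nearHyp_hyp
  onLam := fun _ _ => rfl
  offLam := fun _ hx => mt D.hyp_mem_Lam_iff.1 hx
  equivariant := ⟨fun _ _ => rfl, fun _ _ _ => rfl⟩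
  conj := fun _ => rfl
  covers := fun x hx => by
    have h := down_up hx
    rw [hatF_cov h.2]
    change D.cov (D.up (hyp (D.down (D.up x)))) = _
    rw [h.1]

theorem Models.conjugateOn {T : Torus → Torus} {G : Plane → Plane} {H : Plane ≃ₜ Plane}
    (h : D.Models T G H) : ConjugateOn D.hatF T D.island := by
  refine ⟨D.models_hatF.bijOn, h.bijOn, islandHomeo h.equivariant, fun p => Subtype.ext ?_⟩
  obtain ⟨x, hx, hp⟩ := exists_of_mem_island p.2
  change D.islandMap H (D.hatF p) = T (D.islandMap H p)
  rw [← hp, D.models_hatF.covers x hx, islandMap_cov_up h.equivariant hx,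
    islandMap_cov_up h.equivariant (D.models_hatF.offLam x hx), h.conj,
    h.covers _ (h.equivariant.not_mem hx)]

theorem eventually_mem_isl {w : Plane} (hw : w ∈ D.isl) : ∀ᶠ z in 𝓝 w, z ∈ D.isl := by
  have hlt := D.δ_lt
  obtain ⟨c, hc, H⟩ := D.exists_lattice_near (ε₁ := (D.δ + D.ε) / 2) w
  have hcont : ContinuousAt (fun z : Plane => ‖z - c‖) w := by fun_prop
  filter_upwards [Metric.closedBall_mem_nhds w (show 0 < D.ε - (D.δ + D.ε) / 2 by linarith),
    hcont.eventually (lt_mem_nhds (hw c hc))] with z hz hzc c' hc'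
  rw [mem_closedBall_iff_norm] at hz
  by_cases h : c' = c
  · rwa [h]
  · linarith [H z hz c' hc' h]

/-- The explicit local lift `up ∘ hyp^[n] ∘ down` is smooth on the open preimage of the island, so
no global smoothness of `hatF` is required. -/
theorem hasTorusFDerivAt_hatF {p : Torus} (hp : p ∈ D.island) (n : ℕ) :
    ∃ A, HasTorusFDerivAt D.hatF^[n] A p := by
  obtain ⟨w, rfl⟩ := D.cov_surjective p
  have hw := cov_mem_island.1 hp
  let f : Plane → Plane := fun v => D.P.symm (D.up (hyp^[n] (D.down (D.P v))))
  have hn : ∀ n, ∀ x ∉ D.Lam, hyp^[n] x ∉ D.Lam := fun n x hx => by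
    induction n with
    | zero => exact hx
    | succ n ih => rw [Function.iterate_succ_apply']; exact mt D.hyp_mem_Lam_iff.1 ih
  have hPw : D.P (D.P.symm w) = w := D.P.apply_symm_apply w
  have hf : DifferentiableAt ℝ f (D.P.symm w) := by
    have d1 : DifferentiableAt ℝ D.down (D.P (D.P.symm w)) := by
      rw [hPw]
      exact (contDiffAt_down hw).differentiableAt (by simp)
    have d2 : DifferentiableAt ℝ (fun v => D.down (D.P v)) (D.P.symm w) :=
      d1.comp _ D.P.differentiableAt
    have d3 : Differentiable ℝ (hyp^[n]) := hyp.differentiable.iterate n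
    have d4 : DifferentiableAt ℝ (fun v => hyp^[n] (D.down (D.P v))) (D.P.symm w) :=
      DifferentiableAt.comp _ (d3 _) d2
    have d5 : DifferentiableAt ℝ D.up (hyp^[n] (D.down (D.P (D.P.symm w)))) := by
      rw [hPw]
      exact (contDiffAt_up (hn n _ (up_down hw).2)).differentiableAt (by simp)
    have d6 : DifferentiableAt ℝ (fun v => D.up (hyp^[n] (D.down (D.P v)))) (D.P.symm w) :=
      DifferentiableAt.comp (f := fun v => hyp^[n] (D.down (D.P v))) _ d5 d4
    exact D.P.symm.differentiableAt.comp _ d6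
  refine ⟨fderiv ℝ f (D.P.symm w), D.P.symm w, f, rfl, ?_, hf.hasFDerivAt⟩
  have hc : ContinuousAt D.P (D.P.symm w) := D.P.continuous.continuousAt
  have hev : ∀ᶠ v in 𝓝 (D.P.symm w), D.P v ∈ D.isl := by
    apply hc.eventually
    rw [hPw]
    exact eventually_mem_isl hw
  filter_upwards [hev] with v hv
  have h1 : D.hatF^[n] (D.cov (D.up (D.down (D.P v)))) =
      D.cov (D.up (hyp^[n] (D.down (D.P v)))) := D.models_hatF.iterate_covers n (up_down hv).2
  have h2 : proj v = D.cov (D.up (D.down (D.P v))) := by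
    rw [(up_down hv).1, cov, D.P.symm_apply_apply]
  rw [h2, h1]
  rfl

theorem hasTorusFDerivAt_of_contDiff {T : Torus → Torus} {r : ℕ∞} (hr : 1 ≤ r)
    (hT : TorusContDiff r T) (n : ℕ) (p : Torus) : ∃ A, HasTorusFDerivAt T^[n] A p := by
  obtain ⟨g, hg, hgT⟩ := hT
  obtain ⟨z, rfl⟩ := proj_surjective p
  have hr0 : (r : WithTop ℕ∞) ≠ 0 := by
    intro h0
    have : (1 : WithTop ℕ∞) ≤ r := by exact_mod_cast hr
    rw [h0] at this
    simp at this
  have hd : Differentiable ℝ (g^[n]) := (hg.differentiable hr0).iterate n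
  refine ⟨_, z, g^[n], rfl, Eventually.of_forall fun w => ?_, (hd z).hasFDerivAt⟩
  clear hd
  induction n with
  | zero => rfl
  | succ n ih => rw [Function.iterate_succ_apply', Function.iterate_succ_apply', hgT, ih]

end Data

end BlowUp

namespace BlowUp

/-! ### Perturbations of the blown-up map -/

/-- Small `C²` maps stay small after a linear change of coordinates. -/
theorem smallC2_conj (P : Plane ≃L[ℝ] Plane) : ∃ K : ℝ, 0 < K ∧ ∀ η u, ContDiff ℝ 2 u →
    (∀ k : ℕ, k ≤ 2 → ∀ z, ‖iteratedFDeriv ℝ k u z‖ < η) →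
    SmallC2 (K * η) (fun w => P (u (P.symm w))) := by
  set p := ‖(P : Plane →L[ℝ] Plane)‖
  set q := ‖(P.symm : Plane →L[ℝ] Plane)‖
  have hp : 0 ≤ p := norm_nonneg _
  have hq : 0 ≤ q := norm_nonneg _
  -- The terms `p`, `p q`, `p q²` account for the map, its derivative and the Lipschitz constant of
  -- the derivative; the `1` ensures positivity.
  refine ⟨p * (1 + q + q * q) + 1, by positivity, fun η u hu hk => ?_⟩
  have h0 : ∀ z, ‖u z‖ ≤ η := fun z => by simpa using (hk 0 (by norm_num) z).le
  have h1 : ∀ z, ‖fderiv ℝ u z‖ ≤ η := fun z => by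
    rw [← norm_iteratedFDeriv_one]
    exact (hk 1 (by norm_num) z).le
  have h2 : ∀ z, ‖fderiv ℝ (fderiv ℝ u) z‖ ≤ η := fun z => by
    rw [← norm_iteratedFDeriv_one, norm_iteratedFDeriv_fderiv]
    exact (hk 2 le_rfl z).le
  have hη : 0 ≤ η := (norm_nonneg _).trans (h0 0)
  have hd : Differentiable ℝ u := hu.differentiable (by norm_num)
  have hd' : Differentiable ℝ (fderiv ℝ u) :=
    (hu.fderiv_right (m := 1) (by norm_num)).differentiable (by norm_num)
  have hl : ∀ x y, ‖fderiv ℝ u x - fderiv ℝ u y‖ ≤ η * ‖x - y‖ := fun x y =>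
    convex_univ.norm_image_sub_le_of_norm_fderiv_le (fun z _ => hd' z) (fun z _ => h2 z)
      (mem_univ y) (mem_univ x)
  let A : (Plane →L[ℝ] Plane) → (Plane →L[ℝ] Plane) := fun B =>
    (P : Plane →L[ℝ] Plane).comp (B.comp (P.symm : Plane →L[ℝ] Plane))
  have hA : ∀ B, ‖A B‖ ≤ p * ‖B‖ * q := fun B => by
    refine (ContinuousLinearMap.opNorm_comp_le _ _).trans ?_
    rw [mul_assoc]
    gcongr
    exact ContinuousLinearMap.opNorm_comp_le _ _
  have hf : ∀ w, HasFDerivAt (fun w => P (u (P.symm w))) (A (fderiv ℝ u (P.symm w))) w := fun w =>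
    P.hasFDerivAt.comp w ((hd (P.symm w)).hasFDerivAt.comp w P.symm.hasFDerivAt)
  have c1 : p * η ≤ (p * (1 + q + q * q) + 1) * η := by
    have : 0 ≤ p * q * η := by positivity
    have : 0 ≤ p * q * q * η := by positivity
    linarith
  have c2 : p * η * q ≤ (p * (1 + q + q * q) + 1) * η := by
    have : 0 ≤ p * η := by positivity
    have : 0 ≤ p * q * q * η := by positivity
    linarith
  have c3 : p * η * q * q ≤ (p * (1 + q + q * q) + 1) * η := by
    have : 0 ≤ p * η := by positivity
    have : 0 ≤ p * q * η := by positivity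
    linarith
  refine ⟨fun w => (hf w).differentiableAt, fun w => ?_, fun w => ?_, fun w w' => ?_⟩
  · refine ((P : Plane →L[ℝ] Plane).le_opNorm _).trans (le_trans ?_ c1)
    gcongr
    exact h0 _
  · rw [(hf w).fderiv]
    refine (hA _).trans (le_trans ?_ c2)
    gcongr
    exact h1 _
  · rw [(hf w).fderiv, (hf w').fderiv]
    have e : A (fderiv ℝ u (P.symm w)) - A (fderiv ℝ u (P.symm w')) =
        A (fderiv ℝ u (P.symm w) - fderiv ℝ u (P.symm w')) := by
      simp only [A, ContinuousLinearMap.sub_comp, ContinuousLinearMap.comp_sub]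
    rw [e]
    refine (hA _).trans ?_
    have h3 : ‖P.symm w - P.symm w'‖ ≤ q * ‖w - w'‖ := by
      rw [← map_sub]
      exact (P.symm : Plane →L[ℝ] Plane).le_opNorm _
    calc _ ≤ p * (η * (q * ‖w - w'‖)) * q := by
          gcongr
          exact (hl _ _).trans (by gcongr)
      _ = (p * η * q * q) * ‖w - w'‖ := by ring
      _ ≤ _ := by gcongr

theorem blowOut_smul {δ t : ℝ} (ht : 0 < t) (v : Plane) :
    blowOut δ (t • v) = (√(t ^ 2 * ‖v‖ ^ 2 + δ ^ 2) / ‖v‖) • v := by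
  rw [blowOut, norm_smul, Real.norm_eq_abs, abs_of_pos ht, mul_pow, smul_smul]
  congr 1
  by_cases hv : ‖v‖ = 0
  · simp [hv]
  · field_simp

/-- Rays into the lattice point blow out to paths landing on the circle; `keepsCircles` reads
boundary values along them. -/
theorem tendsto_blowOut {δ : ℝ} (hδ : 0 < δ) (v : Plane) :
    Tendsto (fun t : ℝ => blowOut δ (t • v)) (𝓝[>] 0) (𝓝 ((δ / ‖v‖) • v)) := by
  have h1 : Continuous (fun t : ℝ => (√(t ^ 2 * ‖v‖ ^ 2 + δ ^ 2) / ‖v‖) • v) := by fun_prop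
  have h2 := (h1.tendsto 0).mono_left (nhdsWithin_le_nhds (s := Ioi (0 : ℝ)))
  simp only [ne_eq, OfNat.ofNat_ne_zero, not_false_eq_true, zero_pow, zero_mul, zero_add,
    Real.sqrt_sq hδ.le] at h2
  refine h2.congr' ?_
  filter_upwards [self_mem_nhdsWithin] with t ht
  exact (blowOut_smul ht v).symm

namespace Data

variable {D : Data} {u : Plane → Plane} {F : Torus → Torus}

/-- A perturbation of the blown-up map that preserves the circles preserves them in the linear
coordinates. -/
theorem keepsCircles {η : ℝ} (hη : η ≤ 2 * (D.ε - D.δ)) (hu : SmallC2 η u) (hF : Continuous F)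
    (hFu : ∀ w ∈ D.isl, F (D.cov w) = D.cov (D.up (hyp (D.down w)) + u w))
    (hcirc : ∀ i, F '' D.circle i = D.circle i) : D.KeepsCircles u := by
  intro c hc e he
  obtain ⟨s₁, hs₁, hs₁ε, -, hinv⟩ := D.exists_inner
  have hs₁' : s₁ ≤ D.ε ^ 2 := by nlinarith [sq_nonneg D.δ]
  have hδ := D.δ_pos
  have he0 : e ≠ 0 := norm_ne_zero_iff.1 (by rw [he]; norm_num)
  have hhe : 0 < ‖hyp e‖ := norm_pos_iff.2 (by simpa using he0)
  have hc' := D.hyp_mem_Lam hc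
  set X := (D.δ / ‖hyp e‖) • hyp e with hX
  have hXn : ‖X‖ = D.δ := by
    rw [hX, norm_smul, Real.norm_eq_abs, abs_of_pos (by positivity), div_mul_cancel₀ _ hhe.ne']
  have hpt : Tendsto (fun t : ℝ => c + blowOut D.δ (t • e)) (𝓝[>] 0) (𝓝 (c + D.δ • e)) := by
    have := (tendsto_blowOut hδ e).const_add c
    rwa [he, div_one] at this
  have him : Tendsto (fun t : ℝ => hyp c + blowOut D.δ (t • hyp e)) (𝓝[>] 0) (𝓝 (hyp c + X)) :=
    (tendsto_blowOut hδ (hyp e)).const_add (hyp c)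
  have hsmall : ∀ v : Plane, ∀ᶠ t : ℝ in 𝓝[>] 0, ‖t • v‖ ^ 2 ≤ s₁ := fun v => by
    have h1 : Continuous (fun t : ℝ => ‖t • v‖ ^ 2) := by fun_prop
    have h2 := h1.tendsto 0
    simp only [zero_smul, norm_zero, ne_eq, OfNat.ofNat_ne_zero, not_false_eq_true,
      zero_pow] at h2
    exact ((h2.eventually (gt_mem_nhds hs₁)).filter_mono nhdsWithin_le_nhds).mono
      fun t ht => le_of_lt ht
  -- The formula for `F` holds only on the open island. Continuity of `F` extends it to the circle
  -- along the blown-out ray in direction `e`.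
  have hFeq : F (D.cov (c + D.δ • e)) = D.cov (hyp c + X + u (c + D.δ • e)) := by
    have l1 : Tendsto (fun t : ℝ => F (D.cov (c + blowOut D.δ (t • e)))) (𝓝[>] 0)
        (𝓝 (F (D.cov (c + D.δ • e)))) :=
      ((hF.comp D.continuous_cov).tendsto _).comp hpt
    have l2 : Tendsto (fun t : ℝ => D.cov (hyp c + blowOut D.δ (t • hyp e) +
        u (c + blowOut D.δ (t • e)))) (𝓝[>] 0) (𝓝 (D.cov (hyp c + X + u (c + D.δ • e)))) :=
      (D.continuous_cov.tendsto _).comp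
        (him.add ((hu.diff.continuous.tendsto _).comp hpt))
    refine tendsto_nhds_unique (l1.congr' ?_) l2
    filter_upwards [hsmall e, hsmall (hyp e), self_mem_nhdsWithin] with t h1 h2 ht
    have ht : 0 < t := ht
    have hne : t • e ≠ 0 := smul_ne_zero ht.ne' he0
    have e1 : c + t • e - c = t • e := by abel
    have e2 : hyp (c + t • e) - hyp c = t • hyp e := by rw [map_add, map_smul]; abel
    have hx : c + t • e ∉ D.Lam := by
      refine not_mem_Lam_of_near hc ?_ (by simpa using hne)
      rw [e1]
      exact le_of_sq_le_sq (h1.trans hs₁') D.ε_pos.le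
    have e3 := up_inner hs₁' hinv hc (x := c + t • e) (by rwa [e1])
    have e4 := up_inner hs₁' hinv hc' (x := hyp (c + t • e)) (by rwa [e2])
    rw [e1] at e3
    rw [e2] at e4
    obtain ⟨d1, d2⟩ := down_up hx
    rw [e3] at d1 d2
    rw [hFu _ d2, d1, e4]
  obtain ⟨i, l, hl, hcl⟩ := D.exists_center hc
  have hin : D.cov (c + D.δ • e) ∈ D.circle i := by
    refine ⟨D.δ • e, ?_, ?_⟩
    · rw [mem_sphere_zero_iff_norm, norm_smul, he, mul_one, Real.norm_eq_abs, abs_of_pos hδ]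
    · rw [chartAt_eq, cov_eq_iff, hcl]
      have : D.P (center i) + D.δ • e - (D.P (center i) + l + D.δ • e) = -l := by abel
      rw [this]
      exact D.L.neg_mem hl
  have hout : D.cov (hyp c + X + u (c + D.δ • e)) ∈ D.circle i := by
    rw [← hFeq, ← hcirc i]
    exact mem_image_of_mem F hin
  obtain ⟨w', hw', hcov⟩ := hout
  rw [mem_sphere_zero_iff_norm] at hw'
  rw [chartAt_eq, cov_eq_iff] at hcov
  set m := D.P (center i) + w' - (hyp c + X + u (c + D.δ • e)) with hm
  have hmem : D.P (center i) - m ∈ D.Lam := D.Lam.sub_mem (D.center_mem i) (D.L_le_Lam hcov)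
  have hdiff : D.P (center i) - m - hyp c = X + u (c + D.δ • e) - w' := by rw [hm]; abel
  have hb := hu.bound (c + D.δ • e)
  -- The image lies on a circle of radius `δ` about some lift of the centre. That lift is within `δ
  -- + η + δ ≤ 2ε` of `hyp c`, so it is `hyp c`.
  have heq : D.P (center i) - m = hyp c := by
    refine D.eq_of_near hmem hc' ?_
    rw [hdiff]
    refine (norm_sub_le _ _).trans ?_
    have := norm_add_le X (u (c + D.δ • e))
    linarith
  rw [heq, sub_self] at hdiff
  rw [sub_eq_zero.1 hdiff.symm, hw']

variable (D) in
/-- Every `C²`-small perturbation of the blown-up map that keeps the circles is modelled on the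
hyperbolic map. -/
theorem exists_models : ∃ η : ℝ, 0 < η ∧ ∀ F : Torus → Torus, Continuous F →
    C2Close η F D.hatF → (∀ i, F '' D.circle i = D.circle i) → ∃ G H, D.Models F G H := by
  obtain ⟨K, hK, hsmall⟩ := smallC2_conj D.P
  obtain ⟨η₀, hη₀, Hη₀⟩ := D.exists_nearHyp
  have hε := D.ε_pos
  have hδε := D.δ_lt
  -- The three bounds serve `exists_nearHyp`, `keepsCircles` and the periodicity `hper`,
  -- respectively.
  set κ := min η₀ (min (2 * (D.ε - D.δ)) D.ε) with hκ
  have hκ0 : 0 < κ := lt_min hη₀ (lt_min (by linarith) hε)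
  refine ⟨κ / K, by positivity, fun F hF hclose hcirc => ?_⟩
  obtain ⟨u₀, hu₀, hFu₀, hb₀⟩ := hclose
  set u : Plane → Plane := fun w => D.P (u₀ (D.P.symm w)) with hu
  have hsm : SmallC2 κ u := by
    have := hsmall _ u₀ hu₀ hb₀
    rwa [mul_div_cancel₀ _ hK.ne'] at this
  have hsm₀ : SmallC2 η₀ u := by
    have hle : κ ≤ η₀ := min_le_left _ _
    exact ⟨hsm.diff, fun x => (hsm.bound x).trans hle, fun x => (hsm.bound_fderiv x).trans hle,
      fun x y => (hsm.lip_fderiv x y).trans (by gcongr)⟩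
  have hcovu : ∀ w, proj (u₀ (D.P.symm w)) = D.cov (u w) := fun w => by
    rw [cov, hu, D.P.symm_apply_apply]
  have hFhat : ∀ w, F (D.cov w) = D.hatF (D.cov w) + D.cov (u w) := fun w => by
    rw [← hcovu]
    exact hFu₀ _
  have hFu : ∀ w ∈ D.isl, F (D.cov w) = D.cov (D.up (hyp (D.down w)) + u w) := fun w hw => by
    rw [hFhat, hatF_cov hw, cov_add]
  -- Periodicity of `u₀` is not part of `C2Close`. The two values agree modulo `D.L` and differ by
  -- at most `2ε`, hence coincide.
  have hper : ∀ w, ∀ l ∈ D.L, u (w + l) = u w := fun w l hl => by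
    have h1 : D.cov (w + l) = D.cov w := by
      rw [cov_eq_iff, add_sub_cancel_left]
      exact hl
    have h2 := hFhat (w + l)
    rw [h1, hFhat w] at h2
    refine (D.cov_inj_of_near (add_left_cancel h2) ?_).symm
    have h3 : κ ≤ D.ε := (min_le_right _ _).trans (min_le_right _ _)
    refine (norm_sub_le _ _).trans ?_
    linarith [hsm.bound w, hsm.bound (w + l)]
  have hkeep : D.KeepsCircles u :=
    keepsCircles ((min_le_right _ _).trans (min_le_left _ _)) hsm hF hFu hcirc
  obtain ⟨hisl, hnear, B, hB⟩ := Hη₀ u hsm₀ hkeep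
  obtain ⟨H, hconj, hfix, hadd⟩ := hnear.exists_conj hB (S := D.Lam)
    (fun x hx => D.hyp_mem_Lam hx) (fun x hx => D.hyp_symm_mem_Lam hx)
    (fun x hx => blown_of_mem hx) (L := D.L) (fun x hx => D.hyp_mem_L hx)
    (fun x hx => D.hyp_symm_mem_L hx) (fun x l hl => blown_add hper x hl)
  refine ⟨D.blown u, H, hnear, fun x hx => blown_of_mem hx, fun x hx => ?_, ⟨hfix, hadd⟩, hconj,
    fun x hx => ?_⟩
  · rw [blown_of_not_mem hx]
    exact (up_down (hisl x hx)).2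
  · obtain ⟨d1, d2⟩ := down_up hx
    rw [blown_of_not_mem hx, (up_down (hisl x hx)).1, hFu _ d2, d1]

end Data

end BlowUp

end

theorem theorem3p2 (D : BlowUp.Data) :
    (∀ p ∈ D.island, 0 < BlowUp.lyapunov D.hatF p) ∧
    BlowUp.TransitiveOn D.hatF D.island ∧
    ∃ η : ℝ, 0 < η ∧ ∀ F : BlowUp.Torus ≃ₜ BlowUp.Torus,
      BlowUp.TorusContDiff 2 F → BlowUp.TorusContDiff 2 F.symm →
      BlowUp.C2Close η F D.hatF →
      (∀ i, F '' D.circle i = D.circle i) →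
        (∀ p ∈ D.island, 0 < BlowUp.lyapunov F p) ∧
        BlowUp.ConjugateOn D.hatF F D.island ∧
        BlowUp.TransitiveOn F D.island := by
  refine ⟨fun p hp => D.models_hatF.lyapunov_pos hp (BlowUp.Data.hasTorusFDerivAt_hatF hp),
    D.models_hatF.transitiveOn, ?_⟩
  obtain ⟨η, hη, h⟩ := D.exists_models
  refine ⟨η, hη, fun F hF _ hclose hcirc => ?_⟩
  obtain ⟨G, H, hm⟩ := h F F.continuous hclose hcirc
  exact ⟨fun p hp => hm.lyapunov_pos hp fun n =>
      BlowUp.Data.hasTorusFDerivAt_of_contDiff (by norm_num) hF n p,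
    hm.conjugateOn, hm.transitiveOn⟩
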